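/- Let $k$ be an algebraically closed field of characteristic $p\ge 5$, and let $\mathfrak g=W(1,1)$ be the Witt algebra over $k$: the $p$-dimensional Lie algebra with basis $e_{-1},e_0,\dots,e_{p-2}$ and bracket $[e_i,e_j]=(j-i)e_{i+j}$, where $e_{i+j}:=0$ if $i+j\notin\{-1,\dots,p-2\}$, with the $p$-mapping determined by $e_i^{[p]}=\delta_{i,0}\,e_i$. Let $\mathfrak b^+$ be the span of $e_0,\dots,e_{p-2}$. For a restricted Lie algebra $L$ (here $L=\mathfrak g$ or $\mathfrak b^+$) let $u(L)$ be the restricted enveloping algebra, i.e. the quotient of the universal enveloping algebra $U(L)$ by the ideal generated by all $x^p-x^{[p]}$, $x\in L$. For $\lambda\in\mathbb F_p$ let $k_\lambda$ be the one-dimensional $u(\mathfrak b^+)$-module on which $e_0$ acts as $\lambda$ and $e_1,\dots,e_{p-2}$ act as $0$, and let $Z^+(\lambda)=u(\mathfrak g)\otimes_{u(\mathfrak b^+)}k_\lambda$, the ($p$-dimensional) Verma module. Let $\lambda,\mu\in\mathbb F_p$; all equalities between weights below are in $\mathbb F_p$. (a) If $p=5$, then, as a $k$-vector space, $\operatorname{Ext}^1_{u(\mathfrak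 g)}(Z^+(\mu),Z^+(\lambda))\cong k$ if $\lambda-\mu\in\{2,3\}$ or if the set $\{\mu,\lambda\}$ is one of $\{0\},\{4\},\{0,1\},\{0,4\},\{3,4\}$; otherwise $\operatorname{Ext}^1_{u(\mathfrak g)}(Z^+(\mu),Z^+(\lambda))=0$. (b) If $p\ge 7$, then, as a $k$-vector space, $\operatorname{Ext}^1_{u(\mathfrak g)}(Z^+(\mu),Z^+(\lambda))\cong k$ if at least one of the following holds: (i) $\lambda-\mu\in\{2,3,4\}$; (ii) $(\mu,\lambda)$ is one of $(0,0),(-1,-1),(-1,0),(0,-1),(0,1),(-2,-1),(-5,0),(-1,4)$; (iii) $2\lambda^2-10\lambda+3=0$ and $\lambda-\mu=6$. Otherwise $\operatorname{Ext}^1_{u(\mathfrak g)}(Z^+(\mu),Z^+(\lambda))=0$. -/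

import Mathlib

noncomputable section

namespace Witt11

universe u

/-! ### The Witt algebra W(1,1) -/

/-- The index set `{-1, 0, …, p - 2}` of the standard basis. -/
abbrev Idx (p : ℕ) : Type := {i : ℤ // i ∈ Finset.Icc (-1 : ℤ) ((p : ℤ) - 2)}

/-- The underlying space of the Witt algebra `W(1,1)`: an element `x` is the combination
`∑ i, x i • e i` of the basis vectors `e i`, `-1 ≤ i ≤ p - 2`. -/
def W (k : Type u) (p : ℕ) : Type u := Idx p → k

set_option linter.unusedSectionVars false

section Basic

variable {k : Type u} [Field k] {p : ℕ}

instance : AddCommGroup (W k p) := inferInstanceAs (AddCommGroup (Idx p → k))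

instance : Module k (W k p) := inferInstanceAs (Module k (Idx p → k))

/-- The basis vector `e i`, `-1 ≤ i ≤ p - 2`. -/
def e (i : Idx p) : W k p := Pi.single i (1 : k)

/-- The bilinear bracket with `[e i, e j] = (j - i) e (i + j)`, where `e (i + j) = 0` if `i + j`
is not in the index set. -/
instance : Bracket (W k p) (W k p) where
  bracket x y := fun m => ∑ i : Idx p, ∑ j : Idx p,
    if (i : ℤ) + (j : ℤ) = (m : ℤ) then (((j : ℤ) - (i : ℤ) : ℤ) : k) * (x i * y j) else 0

theorem add_apply (x y : W k p) (m : Idx p) : (x + y) m = x m + y m := rfl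

theorem smul_apply (c : k) (x : W k p) (m : Idx p) : (c • x) m = c * x m := rfl

theorem zero_apply (m : Idx p) : (0 : W k p) m = 0 := rfl

theorem e_apply (i m : Idx p) : (e i : W k p) m = if m = i then 1 else 0 := Pi.single_apply _ _ _

theorem bracket_apply (x y : W k p) (m : Idx p) : ⁅x, y⁆ m = ∑ i : Idx p, ∑ j : Idx p,
    if (i : ℤ) + (j : ℤ) = (m : ℤ) then (((j : ℤ) - (i : ℤ) : ℤ) : k) * (x i * y j) else 0 := rfl

theorem sum_smul_e (x : W k p) : ∑ i : Idx p, x i • (e i : W k p) = x := by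
  funext m
  have h : ∀ s : Finset (Idx p), (∑ i ∈ s, x i • (e i : W k p)) m = ∑ i ∈ s, x i * (e i : W k p) m := by
    intro s
    exact Finset.sum_apply m s _
  rw [h]
  rw [Finset.sum_eq_single m]
  · rw [e_apply, if_pos rfl, mul_one]
  · intro i _ hi
    rw [e_apply, if_neg (Ne.symm hi), mul_zero]
  · simp

/-- The bracket as a bilinear map. -/
def bracketLin : W k p →ₗ[k] W k p →ₗ[k] W k p :=
  LinearMap.mk₂ k (fun x y => ⁅x, y⁆)
    (fun x y z => by
      funext m
      simp only [bracket_apply, add_apply, ← Finset.sum_add_distrib]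
      refine Finset.sum_congr rfl fun i _ => Finset.sum_congr rfl fun j _ => ?_
      split_ifs <;> ring)
    (fun c x y => by
      funext m
      simp only [bracket_apply, smul_apply, Finset.mul_sum]
      refine Finset.sum_congr rfl fun i _ => Finset.sum_congr rfl fun j _ => ?_
      split_ifs <;> ring)
    (fun x y z => by
      funext m
      simp only [bracket_apply, add_apply, ← Finset.sum_add_distrib]
      refine Finset.sum_congr rfl fun i _ => Finset.sum_congr rfl fun j _ => ?_
      split_ifs <;> ring)
    (fun c x y => by
      funext m
      simp only [bracket_apply, smul_apply, Finset.mul_sum]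
      refine Finset.sum_congr rfl fun i _ => Finset.sum_congr rfl fun j _ => ?_
      split_ifs <;> ring)

theorem bracketLin_apply (x y : W k p) : bracketLin x y = ⁅x, y⁆ := rfl

theorem bracket_e_apply (i : Idx p) (y : W k p) (m : Idx p) :
    ⁅(e i : W k p), y⁆ m = if h : (m : ℤ) - i ∈ Finset.Icc (-1 : ℤ) ((p : ℤ) - 2) then
      (((m : ℤ) - 2 * (i : ℤ) : ℤ) : k) * y ⟨(m : ℤ) - i, h⟩ else 0 := by
  rw [bracket_apply, Finset.sum_eq_single i]
  · split_ifs with h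
    · rw [Finset.sum_eq_single ⟨(m : ℤ) - i, h⟩]
      · rw [if_pos (by simp), e_apply, if_pos rfl, one_mul]
        congr 2
        push_cast
        ring
      · intro j _ hj
        rw [if_neg]
        intro h'
        exact hj (Subtype.ext (by simp; omega))
      · simp
    · refine Finset.sum_eq_zero fun j _ => if_neg ?_
      intro h'
      apply h
      rw [show (m : ℤ) - i = j by omega]
      exact j.2
  · intro j _ hj
    refine Finset.sum_eq_zero fun l _ => ?_
    rw [e_apply, if_neg hj]
    simp
  · simp

theorem bracket_e_e (i j : Idx p) (h : (i : ℤ) + j ∈ Finset.Icc (-1 : ℤ) ((p : ℤ) - 2)) :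
    ⁅(e i : W k p), (e j : W k p)⁆ = (((j : ℤ) - i : ℤ) : k) • e ⟨(i : ℤ) + j, h⟩ := by
  funext m
  rw [bracket_e_apply, smul_apply, e_apply]
  by_cases hm : m = ⟨(i : ℤ) + j, h⟩
  · subst hm
    rw [dif_pos (by simp [-Finset.mem_Icc]), e_apply, if_pos (Subtype.ext (by simp)), if_pos rfl]
    congr 2
    push_cast
    ring
  · rw [if_neg hm, mul_zero]
    split_ifs
    · rw [e_apply, if_neg, mul_zero]
      intro h'
      apply hm
      have := congrArg Subtype.val h'
      exact Subtype.ext (by simp at this ⊢; omega)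
    · rfl

theorem bracket_e_e_of_notMem (i j : Idx p) (h : (i : ℤ) + j ∉ Finset.Icc (-1 : ℤ) ((p : ℤ) - 2)) :
    ⁅(e i : W k p), (e j : W k p)⁆ = 0 := by
  funext m
  rw [bracket_e_apply, zero_apply]
  split_ifs
  · rw [e_apply, if_neg, mul_zero]
    intro h'
    apply h
    have := congrArg Subtype.val h'
    rw [show (i : ℤ) + j = m by simp at this; omega]
    exact m.2
  · rfl

theorem bracket_self (x : W k p) : ⁅x, x⁆ = 0 := by
  funext m
  rw [bracket_apply, zero_apply, ← Fintype.sum_prod_type']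
  refine Finset.sum_involution (fun a _ => a.swap) ?_ ?_ ?_ ?_
  · rintro ⟨i, j⟩ _
    by_cases h : (i : ℤ) + j = m
    · simp only [Prod.fst_swap, Prod.snd_swap]
      rw [if_pos h, if_pos (by omega)]
      push_cast
      ring
    · simp only [Prod.fst_swap, Prod.snd_swap]
      rw [if_neg h, if_neg (by omega), add_zero]
  · rintro ⟨i, j⟩ _ h1 h2
    apply h1
    have : j = i := congrArg Prod.fst h2
    subst this
    simp
  · simp
  · simp

theorem bracket_bracket_e [CharP k p] (i j l m : Idx p) :
    ⁅(e i : W k p), ⁅(e j : W k p), (e l : W k p)⁆⁆ m =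
      if (i : ℤ) + j + l = m then ((((l : ℤ) - j) * ((j : ℤ) + l - i) : ℤ) : k) else 0 := by
  have hi := Finset.mem_Icc.1 i.2
  have hj := Finset.mem_Icc.1 j.2
  have hl := Finset.mem_Icc.1 l.2
  have hm := Finset.mem_Icc.1 m.2
  by_cases h : (j : ℤ) + l ∈ Finset.Icc (-1 : ℤ) ((p : ℤ) - 2)
  · rw [bracket_e_e j l h, ← bracketLin_apply, map_smul, bracketLin_apply, smul_apply]
    by_cases h' : (i : ℤ) + ((j : ℤ) + l) ∈ Finset.Icc (-1 : ℤ) ((p : ℤ) - 2)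
    · rw [bracket_e_e i ⟨_, h⟩ h', smul_apply, e_apply]
      by_cases hs : (i : ℤ) + j + l = m
      · rw [if_pos hs, if_pos (Subtype.ext (by simp; omega))]
        push_cast
        ring
      · rw [if_neg hs, if_neg]
        · simp
        · intro h2
          have := congrArg Subtype.val h2
          simp at this
          omega
    · rw [bracket_e_e_of_notMem i ⟨_, h⟩ h', zero_apply, mul_zero, if_neg]
      intro h2
      rw [← add_assoc, h2] at h'
      exact h' m.2
  · rw [bracket_e_e_of_notMem j l h, ← bracketLin_apply, map_zero, zero_apply]
    split_ifs with hs
    · rw [Finset.mem_Icc] at h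
      by_cases h2 : (l : ℤ) = j
      · simp [h2]
      · have h3 : (j : ℤ) + l - i = (p : ℤ) := by omega
        rw [h3]
        simp
    · rfl

theorem induction_e {P : W k p → Prop} (he : ∀ i, P (e i)) (hadd : ∀ x y, P x → P y → P (x + y))
    (hsmul : ∀ (c : k) x, P x → P (c • x)) (h0 : P 0) (x : W k p) : P x := by
  rw [← sum_smul_e x]
  exact Finset.sum_induction _ P hadd h0 fun i _ => hsmul _ _ (he i)

theorem bracket_anti (x y : W k p) : ⁅x, y⁆ = -⁅y, x⁆ := by
  have h := bracket_self (x + y)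
  simp only [← bracketLin_apply, map_add, LinearMap.add_apply] at h
  simp only [bracketLin_apply, bracket_self, zero_add, add_zero] at h
  exact eq_neg_of_add_eq_zero_right h

theorem jacobi [CharP k p] (x y z : W k p) : ⁅x, ⁅y, z⁆⁆ = ⁅⁅x, y⁆, z⁆ + ⁅y, ⁅x, z⁆⁆ := by
  have key : ∀ i j l : Idx p, ⁅(e i : W k p), ⁅(e j : W k p), (e l : W k p)⁆⁆ =
      ⁅⁅(e i : W k p), (e j : W k p)⁆, (e l : W k p)⁆
        + ⁅(e j : W k p), ⁅(e i : W k p), (e l : W k p)⁆⁆ := by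
    intro i j l
    rw [bracket_anti ⁅(e i : W k p), (e j : W k p)⁆, eq_neg_add_iff_add_eq]
    funext m
    simp only [add_apply, bracket_bracket_e]
    have h1 : (l : ℤ) + i + j = (i : ℤ) + j + l := by ring
    have h2 : (j : ℤ) + i + l = (i : ℤ) + j + l := by ring
    rw [h1, h2]
    split_ifs
    · push_cast
      ring
    · simp
  simp only [← bracketLin_apply] at key ⊢
  induction x using induction_e with
  | h0 => simp
  | hadd x x' hx hx' => simp only [map_add, LinearMap.add_apply, hx, hx']; abel
  | hsmul c x hx => simp only [map_smul, LinearMap.smul_apply, hx, smul_add]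
  | he i =>
    induction y using induction_e with
    | h0 => simp
    | hadd x x' hx hx' => simp only [map_add, LinearMap.add_apply, hx, hx']; abel
    | hsmul c x hx => simp only [map_smul, LinearMap.smul_apply, hx, smul_add]
    | he j =>
      induction z using induction_e with
      | h0 => simp
      | hadd x x' hx hx' => simp only [map_add, hx, hx']; abel
      | hsmul c x hx => simp only [map_smul, hx, smul_add]
      | he l => exact key i j l

instance [CharP k p] : LieRing (W k p) where
  add_lie x y z := by simp only [← bracketLin_apply, map_add, LinearMap.add_apply]
  lie_add x y z := by simp only [← bracketLin_apply, map_add]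
  lie_self := bracket_self
  leibniz_lie := jacobi

instance [CharP k p] : LieAlgebra k (W k p) where
  lie_smul c x y := by simp only [← bracketLin_apply, map_smul]

end Basic

/-! ### Powers of sums in characteristic `p` -/

theorem choose_pred_prime {E : Type*} [Ring E] (p : ℕ) [hp : Fact p.Prime] (h : (p : E) = 0) :
    ∀ m : ℕ, m ≤ p - 1 → ((p - 1).choose m : E) = (-1) ^ m := by
  intro m
  induction m with
  | zero => intro _; simp
  | succ m ih =>
    intro hm
    have h1 := ih (by omega)
    have hp1 : p - 1 + 1 = p := by have := hp.out.pos; omega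
    have h2 : p.choose (m + 1) = (p - 1).choose m + (p - 1).choose (m + 1) := by
      conv_lhs => rw [← hp1]
      exact Nat.choose_succ_succ _ _
    have h3 : p ∣ p.choose (m + 1) := hp.out.dvd_choose_self (by omega) (by omega)
    obtain ⟨c, hc⟩ := h3
    have h4 : ((p.choose (m + 1) : ℕ) : E) = 0 := by rw [hc]; simp [h]
    rw [h2, Nat.cast_add, h1] at h4
    rw [pow_succ, mul_neg_one]
    exact eq_neg_of_add_eq_zero_right h4

theorem commute_sub_pow_pred_prime {E : Type*} [Ring E] (p : ℕ) [hp : Fact p.Prime]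
    (h : (p : E) = 0) {u v : E} (huv : Commute u v) :
    (u - v) ^ (p - 1) = ∑ j ∈ Finset.range p, u ^ j * v ^ (p - 1 - j) := by
  have hp1 : p - 1 + 1 = p := by have := hp.out.pos; omega
  rw [sub_eq_add_neg, (huv.neg_right).add_pow, hp1]
  refine Finset.sum_congr rfl fun j hj => ?_
  have hj' : j ≤ p - 1 := by have := Finset.mem_range.1 hj; omega
  rw [choose_pred_prime p h j hj', neg_pow v, mul_assoc, mul_assoc]
  congr 1
  have h1 : ((-1 : E)) ^ (p - 1 - j) * (v ^ (p - 1 - j) * (-1) ^ j)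
      = (-1) ^ (p - 1 - j) * (-1) ^ j * v ^ (p - 1 - j) := by
    rw [mul_assoc, ((Commute.neg_one_left (v ^ (p - 1 - j))).pow_left j).eq]
  rw [h1, ← pow_add, Nat.sub_add_cancel hj', ← choose_pred_prime p h (p - 1) le_rfl]
  simp

open Polynomial in
theorem derivative_pow_noncomm {B : Type*} [Ring B] (q : B[X]) (n : ℕ) :
    derivative (q ^ n) = ∑ j ∈ Finset.range n, q ^ j * derivative q * q ^ (n - 1 - j) := by
  induction n with
  | zero => simp
  | succ n ih =>
    rw [pow_succ, derivative_mul, ih, Finset.sum_range_succ, Finset.sum_mul]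
    congr 1
    · refine Finset.sum_congr rfl fun j hj => ?_
      have := Finset.mem_range.1 hj
      rw [mul_assoc _ _ q, ← pow_succ]
      congr 2
      omega
    · simp

open Polynomial in
theorem pow_add_sub_mem {k B : Type*} [Field k] [Ring B] [Algebra k B] (p : ℕ)
    [hp : Fact p.Prime] [CharP k p] (S : Submodule k B)
    (hS : ∀ a ∈ S, ∀ b ∈ S, a * b - b * a ∈ S) (a b : B) (ha : a ∈ S) (hb : b ∈ S) :
    (a + b) ^ p - a ^ p - b ^ p ∈ S := by
  have hp1 : p - 1 + 1 = p := by have := hp.out.pos; omega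
  have hchar : (p : B) = 0 := by
    rw [← map_natCast (algebraMap k B), CharP.cast_eq_zero, map_zero]
  have hcomm : ∀ f g : B[X], (∀ n, f.coeff n ∈ S) → (∀ n, g.coeff n ∈ S) →
      ∀ n, (f * g - g * f).coeff n ∈ S := by
    intro f g hf hg n
    rw [coeff_sub, coeff_mul, coeff_mul, ← Finset.Nat.sum_antidiagonal_swap, ← Finset.sum_sub_distrib]
    refine S.sum_mem fun x _ => ?_
    have := hS _ (hf x.2) _ (hg x.1)
    simpa using this
  set q : B[X] := C a * X + C b with hq
  have hqc : ∀ n, q.coeff n ∈ S := by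
    intro n
    rw [hq, coeff_add, coeff_C_mul, coeff_X, coeff_C]
    refine S.add_mem ?_ ?_
    · split_ifs <;> simp [ha]
    · split_ifs <;> simp [hb]
  have hder : derivative q = C a := by simp [hq]
  let u : Module.End ℤ B[X] := LinearMap.mulLeft ℤ q
  let v : Module.End ℤ B[X] := LinearMap.mulRight ℤ q
  have huv : Commute u v := by
    ext1 z
    simp [u, v, mul_assoc]
  have hE : ((p : ℕ) : Module.End ℤ B[X]) = 0 := by
    ext1 z
    rw [Module.End.natCast_apply, LinearMap.zero_apply, ← Nat.cast_smul_eq_nsmul B, hchar, zero_smul]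
  have hDP : derivative (q ^ p) = ((u - v) ^ (p - 1)) (C a) := by
    rw [derivative_pow_noncomm, commute_sub_pow_pred_prime p hE huv, LinearMap.sum_apply]
    refine Finset.sum_congr rfl fun j _ => ?_
    simp only [u, v, LinearMap.pow_mulLeft, LinearMap.pow_mulRight, Module.End.mul_apply,
      LinearMap.mulLeft_apply, LinearMap.mulRight_apply, hder, mul_assoc]
  have hit : ∀ m n, (((u - v) ^ m) (C a)).coeff n ∈ S := by
    intro m
    induction m with
    | zero => intro n; simp only [pow_zero, Module.End.one_apply, coeff_C]; split_ifs <;> simp [ha]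
    | succ m ih =>
      intro n
      rw [pow_succ', Module.End.mul_apply]
      exact hcomm q _ hqc ih n
  have hmid : ∀ n, n + 1 < p → (q ^ p).coeff (n + 1) ∈ S := by
    intro n hn
    have h1 := hit (p - 1) n
    rw [← hDP, coeff_derivative] at h1
    have h2 : ((n + 1 : ℕ) : k) ≠ 0 := by
      rw [Ne, CharP.cast_eq_zero_iff k p]
      exact fun h => absurd (Nat.le_of_dvd (by omega) h) (by omega)
    have h3 : (q ^ p).coeff (n + 1) * ((n : B) + 1) = ((n + 1 : ℕ) : k) • (q ^ p).coeff (n + 1) := by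
      rw [Nat.cast_smul_eq_nsmul, nsmul_eq_mul', Nat.cast_add, Nat.cast_one]
    rw [h3] at h1
    exact (S.smul_mem_iff h2).1 h1
  have hqdeg : q.natDegree ≤ 1 := natDegree_linear_le
  have hdeg : (q ^ p).natDegree < p + 1 := by
    have := natDegree_pow_le_of_le p hqdeg
    omega
  let ev : B[X] →+* B := eval₂RingHom' (RingHom.id B) 1 (fun _ => Commute.one_right _)
  have hev : ev (q ^ p) = (a + b) ^ p := by
    rw [map_pow]; congr 1
    simp [ev, hq]
  have hsum : ev (q ^ p) = ∑ i ∈ Finset.range (p + 1), (q ^ p).coeff i := by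
    change eval₂ _ _ _ = _
    rw [eval₂_eq_sum_range' _ hdeg]; simp
  have hc0 : (q ^ p).coeff 0 = b ^ p := by
    rw [coeff_zero_eq_eval_zero]
    have : (q ^ p).coeff 0 = constantCoeff (q ^ p) := rfl
    rw [← coeff_zero_eq_eval_zero, this, map_pow]; simp [hq]
  have hcp : (q ^ p).coeff p = a ^ p := by
    have := coeff_pow_of_natDegree_le hqdeg (m := p)
    rw [mul_one] at this
    rw [this]; simp [hq]
  rw [← hev, hsum, Finset.sum_range_succ, hcp]
  have hs := Finset.sum_range_succ' (fun i => (q ^ p).coeff i) (p - 1)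
  rw [hp1] at hs
  rw [hs, hc0]
  rw [add_sub_cancel_right, add_sub_cancel_right]
  refine S.sum_mem fun n hn => hmid n ?_
  have := Finset.mem_range.1 hn
  omega

attribute [local instance] LieRing.ofAssociativeRing

/-! ### The `p`-mapping -/

section PMap

variable {k : Type u} [Field k] {p : ℕ} [hp : Fact p.Prime]

/-- The index `0`. -/
def idxZero (p : ℕ) [hp : Fact p.Prime] : Idx p :=
  ⟨0, Finset.mem_Icc.2 ⟨by norm_num, by have := hp.out.two_le; omega⟩⟩

/-- The index `-1`. -/
def idxNegOne (p : ℕ) [hp : Fact p.Prime] : Idx p :=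
  ⟨-1, Finset.mem_Icc.2 ⟨le_rfl, by have := hp.out.two_le; omega⟩⟩

variable [CharP k p]

theorem intCast_pow_char (n : ℤ) : ((n : k)) ^ p = n := by
  rw [← frobenius_def, map_intCast]

open LieAlgebra in
theorem ad_e_zero_pow_apply (n : ℕ) (x : W k p) (m : Idx p) :
    ((ad k (W k p) (e (idxZero p)) ^ n) x) m = ((m : ℤ) : k) ^ n * x m := by
  induction n generalizing m with
  | zero => simp
  | succ n ih =>
    rw [_root_.pow_succ', Module.End.mul_apply, ad_apply, bracket_e_apply, dif_pos (by
      simp [idxZero, -Finset.mem_Icc])]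
    have : (⟨(m : ℤ) - (idxZero p : Idx p), by simp [idxZero, -Finset.mem_Icc]⟩ : Idx p) = m :=
      Subtype.ext (by simp [idxZero])
    rw [this, ih]
    simp only [idxZero]
    push_cast
    ring

open LieAlgebra in
theorem ad_e_pow_apply_of_pos (i : Idx p) (hi : 0 < (i : ℤ)) (x : W k p) (n : ℕ) (m : Idx p)
    (hm : (m : ℤ) < -1 + n) : ((ad k (W k p) (e i) ^ n) x) m = 0 := by
  induction n generalizing m with
  | zero =>
    have := (Finset.mem_Icc.1 m.2).1
    simp at hm
    omega
  | succ n ih =>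
    rw [pow_succ', Module.End.mul_apply, ad_apply, bracket_e_apply]
    split_ifs with h
    · rw [ih, mul_zero]
      push_cast at hm
      simp only
      omega
    · rfl

open LieAlgebra in
theorem ad_e_pow_apply_of_neg (i : Idx p) (hi : (i : ℤ) < 0) (x : W k p) (n : ℕ) (m : Idx p)
    (hm : (p : ℤ) - 2 - n < (m : ℤ)) : ((ad k (W k p) (e i) ^ n) x) m = 0 := by
  induction n generalizing m with
  | zero =>
    have := (Finset.mem_Icc.1 m.2).2
    simp at hm
    omega
  | succ n ih =>
    rw [pow_succ', Module.End.mul_apply, ad_apply, bracket_e_apply]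
    split_ifs with h
    · rw [ih, mul_zero]
      push_cast at hm
      simp only
      omega
    · rfl

open LieAlgebra in
theorem ad_e_pow (i : Idx p) :
    ad k (W k p) (if (i : ℤ) = 0 then e i else 0) = ad k (W k p) (e i) ^ p := by
  ext x : 1
  funext m
  have hm := Finset.mem_Icc.1 m.2
  split_ifs with h
  · have hi : i = idxZero p := Subtype.ext h
    subst hi
    have h1 := ad_e_zero_pow_apply (k := k) 1 x m
    rw [pow_one, pow_one] at h1
    rw [ad_e_zero_pow_apply, intCast_pow_char, h1]
  · rw [map_zero, LinearMap.zero_apply, zero_apply]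
    rcases lt_or_gt_of_ne h with h' | h'
    · rw [ad_e_pow_apply_of_neg i h' x p m (by omega)]
    · rw [ad_e_pow_apply_of_pos i h' x p m (by omega)]

theorem exists_pow_eq {B : Type*} [Ring B] [Algebra k B] (F : W k p →ₗ⁅k⁆ B)
    (hF : ∀ i, ∃ y, F y = F (e i) ^ p) (x : W k p) : ∃ y, F y = F x ^ p := by
  induction x using induction_e with
  | h0 => exact ⟨0, by rw [map_zero, zero_pow hp.out.ne_zero]⟩
  | he i => exact hF i
  | hsmul c x hx =>
    obtain ⟨y, hy⟩ := hx
    exact ⟨c ^ p • y, by rw [map_smul, map_smul, smul_pow, hy]⟩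
  | hadd x x' hx hx' =>
    obtain ⟨y, hy⟩ := hx
    obtain ⟨y', hy'⟩ := hx'
    obtain ⟨s, hs⟩ := pow_add_sub_mem (k := k) p (LinearMap.range (F : W k p →ₗ[k] B)) (by
      rintro _ ⟨a, rfl⟩ _ ⟨b, rfl⟩
      exact ⟨⁅a, b⁆, LieHom.map_lie F a b⟩) (F x) (F x') ⟨x, rfl⟩ ⟨x', rfl⟩
    refine ⟨s + y + y', ?_⟩
    have hs' : F s = (F x + F x') ^ p - F x ^ p - F x' ^ p := hs
    rw [map_add, map_add, map_add, hs', hy, hy']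
    abel

theorem eq_zero_of_ad_eq_zero (y : W k p) (hy : LieAlgebra.ad k (W k p) y = 0) : y = 0 := by
  have hb : ∀ z : W k p, ⁅z, y⁆ = 0 := by
    intro z
    rw [bracket_anti, ← LieAlgebra.ad_apply k, hy, LinearMap.zero_apply, neg_zero]
  funext m
  have hm := Finset.mem_Icc.1 m.2
  rw [zero_apply]
  by_cases h : (m : ℤ) = 0
  · have h1 : ⁅(e (idxNegOne p) : W k p), y⁆ (idxNegOne p) = 0 := by rw [hb]; rfl
    rw [bracket_e_apply, dif_pos (by have := (idxZero p).2; simpa [idxNegOne, idxZero] using this)]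
      at h1
    have h2 : (⟨((idxNegOne p : Idx p) : ℤ) - (idxNegOne p : Idx p),
        by have := (idxZero p).2; simpa [idxNegOne, idxZero] using this⟩ : Idx p) = m :=
      Subtype.ext (by simp [h])
    rw [h2] at h1
    simpa [idxNegOne] using h1
  · have h1 := ad_e_zero_pow_apply (k := k) 1 y m
    rw [pow_one, pow_one, LieAlgebra.ad_apply, hb, zero_apply] at h1
    rcases mul_eq_zero.1 h1.symm with h2 | h2
    · rw [CharP.intCast_eq_zero_iff k p] at h2
      exfalso
      by_cases h3 : (m : ℤ) = -1
      · rw [h3] at h2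
        have := Int.le_of_dvd one_pos ((Int.dvd_neg).1 h2)
        have := hp.out.two_le
        omega
      · have := Int.le_of_dvd (by omega) h2
        omega
    · exact h2

theorem existsUnique_ad_eq (x : W k p) :
    ∃! y : W k p, LieAlgebra.ad k (W k p) y = LieAlgebra.ad k (W k p) x ^ p := by
  obtain ⟨y, hy⟩ := exists_pow_eq (LieAlgebra.ad k (W k p)) (fun i => ⟨_, ad_e_pow i⟩) x
  refine ⟨y, hy, fun z hz => ?_⟩
  rw [← sub_eq_zero]
  apply eq_zero_of_ad_eq_zero
  rw [map_sub, hy, hz, sub_self]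

/-- The `p`-mapping `x ↦ x^[p]` of `W(1,1)`: since the algebra has trivial centre, `x^[p]` is
determined by `ad (x^[p]) = (ad x)^p`. -/
def pMap (x : W k p) : W k p := (existsUnique_ad_eq x).choose

theorem ad_pMap (x : W k p) :
    LieAlgebra.ad k (W k p) (pMap x) = LieAlgebra.ad k (W k p) x ^ p :=
  (existsUnique_ad_eq x).choose_spec.1

theorem pMap_eq (x y : W k p) (h : LieAlgebra.ad k (W k p) y = LieAlgebra.ad k (W k p) x ^ p) :
    pMap x = y :=
  ((existsUnique_ad_eq x).choose_spec.2 y h).symm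

/-- On the standard basis the `p`-mapping is `e i ↦ δ_{i,0} e i`. -/
theorem pMap_e (i : Idx p) : pMap (e i : W k p) = if (i : ℤ) = 0 then e i else 0 :=
  pMap_eq _ _ (ad_e_pow i)

end PMap

/-! ### The Borel subalgebra -/

section Borel

variable (k : Type u) [Field k] (p : ℕ) [hp : Fact p.Prime] [CharP k p]

/-- The subalgebra `𝔟⁺` spanned by `e 0, …, e (p - 2)`. -/
def borel : LieSubalgebra k (W k p) where
  carrier := {x | ∀ i : Idx p, (i : ℤ) < 0 → x i = 0}
  add_mem' hx hy i hi := by rw [add_apply, hx i hi, hy i hi, add_zero]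
  zero_mem' _ _ := rfl
  smul_mem' c x hx i hi := by rw [smul_apply, hx i hi, mul_zero]
  lie_mem' := by
    intro x y hx hy m hm
    rw [bracket_apply]
    refine Finset.sum_eq_zero fun i _ => Finset.sum_eq_zero fun j _ => ?_
    split_ifs with h
    · by_cases hi : (i : ℤ) < 0
      · rw [hx i hi, zero_mul, mul_zero]
      · rw [hy j (by omega), mul_zero, mul_zero]
    · rfl

variable {k p}

theorem mem_borel {x : W k p} : x ∈ borel k p ↔ ∀ i : Idx p, (i : ℤ) < 0 → x i = 0 := Iff.rfl

theorem ad_pow_mem_borel {x y : W k p} (hx : x ∈ borel k p) (hy : y ∈ borel k p) (n : ℕ) :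
    (LieAlgebra.ad k (W k p) x ^ n) y ∈ borel k p := by
  induction n with
  | zero => simpa using hy
  | succ n ih =>
    rw [pow_succ', Module.End.mul_apply, LieAlgebra.ad_apply]
    exact (borel k p).lie_mem hx ih

theorem pMap_mem_borel {x : W k p} (hx : x ∈ borel k p) : pMap x ∈ borel k p := by
  intro i hi
  have hi' : i = idxNegOne p := Subtype.ext (by
    have := (Finset.mem_Icc.1 i.2).1
    simp only [idxNegOne]
    omega)
  have he : (e (idxZero p) : W k p) ∈ borel k p := by
    intro j hj
    rw [e_apply, if_neg]
    rintro rfl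
    simp [idxZero] at hj
  have h1 := ad_pow_mem_borel hx he p i hi
  rw [← ad_pMap, LieAlgebra.ad_apply, bracket_anti] at h1
  have h2 := ad_e_zero_pow_apply (k := k) 1 (pMap x) i
  rw [pow_one, pow_one, LieAlgebra.ad_apply] at h2
  have h3 : ⁅(e (idxZero p) : W k p), pMap x⁆ i = 0 := neg_eq_zero.1 h1
  rw [h2, hi'] at h3
  rw [hi']
  simpa [idxNegOne] using h3

/-- The `p`-mapping of `𝔟⁺`, the restriction of the one of `W(1,1)`. -/
def pMapBorel (x : borel k p) : borel k p := ⟨pMap (x : W k p), pMap_mem_borel x.2⟩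

theorem bracket_apply_negOne {x : W k p} (hx : x ∈ borel k p) (z : W k p) :
    ⁅x, z⁆ (idxNegOne p) = -(x (idxZero p)) * z (idxNegOne p) := by
  rw [bracket_apply, Finset.sum_eq_single (idxZero p), Finset.sum_eq_single (idxNegOne p)]
  · simp [idxZero, idxNegOne]
  · intro j _ hj
    rw [if_neg]
    intro h
    exact hj (Subtype.ext (by simpa [idxZero] using h))
  · simp
  · intro i _ hi
    refine Finset.sum_eq_zero fun j _ => ?_
    split_ifs with h
    · have hi2 : (i : ℤ) < 0 := by
        have h1 := (Finset.mem_Icc.1 j.2).1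
        have h2 : (i : ℤ) ≠ 0 := fun h0 => hi (Subtype.ext h0)
        simp only [idxNegOne] at h
        omega
      rw [hx i hi2, zero_mul, mul_zero]
    · rfl
  · simp

theorem pMap_apply_zero {x : W k p} (hx : x ∈ borel k p) :
    pMap x (idxZero p) = x (idxZero p) ^ p := by
  have h1 : ∀ n : ℕ, ((LieAlgebra.ad k (W k p) x ^ n) (e (idxNegOne p))) (idxNegOne p)
      = (-(x (idxZero p))) ^ n := by
    intro n
    induction n with
    | zero => simp [e_apply]
    | succ n ih =>
      rw [pow_succ', Module.End.mul_apply, LieAlgebra.ad_apply, bracket_apply_negOne hx, ih,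
        pow_succ']
  have h2 := h1 p
  rw [← ad_pMap, LieAlgebra.ad_apply, bracket_apply_negOne (pMap_mem_borel hx), e_apply,
    if_pos rfl, mul_one, ← frobenius_def, map_neg, neg_inj, frobenius_def] at h2
  exact h2

/-- The Lie algebra character of `𝔟⁺` of weight `c`: `𝔫⁺` acts by zero and `e 0` acts as `c`. -/
def borelCharacter (c : k) : borel k p →ₗ⁅k⁆ k where
  toFun x := c * (x : W k p) (idxZero p)
  map_add' x y := mul_add _ _ _
  map_smul' a x := mul_left_comm c a ((x : W k p) (idxZero p))
  map_lie' := by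
    intro x y
    rw [LieRing.of_associative_ring_bracket, mul_comm (c * (x : W k p) (idxZero p)), sub_self,
      LieSubalgebra.coe_bracket, bracket_apply, Finset.sum_eq_zero, mul_zero]
    intro i _
    refine Finset.sum_eq_zero fun j _ => ?_
    split_ifs with h
    · by_cases hi : (i : ℤ) < 0
      · rw [x.2 i hi, zero_mul, mul_zero]
      · by_cases hj : (j : ℤ) < 0
        · rw [y.2 j hj, mul_zero, mul_zero]
        · simp only [idxZero] at h
          rw [show (j : ℤ) - i = 0 by omega]
          simp
    · rfl

end Borel

/-! ### Restricted enveloping algebras -/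

section Envelope

variable (k : Type u) [Field k] (p : ℕ) {L : Type u} [LieRing L] [LieAlgebra k L]

/-- The relations `x ^ p = x^[p]`, `x ∈ L`, in the universal enveloping algebra of `L`. -/
inductive RestrictedRel (f : L → L) :
    UniversalEnvelopingAlgebra k L → UniversalEnvelopingAlgebra k L → Prop
  | pow (x : L) : RestrictedRel f (UniversalEnvelopingAlgebra.ι k x ^ p)
      (UniversalEnvelopingAlgebra.ι k (f x))

/-- The restricted enveloping algebra `u(L)` of a Lie algebra `L` with `p`-mapping `f`: the quotient
of the universal enveloping algebra by the two-sided ideal generated by all `x ^ p - f x`. -/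
abbrev RestrictedEnvelope (f : L → L) : Type u := RingQuot (RestrictedRel k p f)

/-- The canonical map `L → u(L)`. -/
def RestrictedEnvelope.ι (f : L → L) : L →ₗ⁅k⁆ RestrictedEnvelope k p f :=
  (AlgHom.toLieHom (RingQuot.mkAlgHom k (RestrictedRel k p f))).comp
    (UniversalEnvelopingAlgebra.ι k)

theorem RestrictedEnvelope.ι_pow (f : L → L) (x : L) :
    RestrictedEnvelope.ι k p f x ^ p = RestrictedEnvelope.ι k p f (f x) := by
  have h := RingQuot.mkAlgHom_rel k (RestrictedRel.pow (k := k) (p := p) (f := f) x)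
  rw [map_pow] at h
  exact h

/-- The universal property of `u(L)`. -/
def RestrictedEnvelope.lift (f : L → L) {A : Type*} [Ring A] [Algebra k A] (F : L →ₗ⁅k⁆ A)
    (hF : ∀ x, F x ^ p = F (f x)) : RestrictedEnvelope k p f →ₐ[k] A :=
  RingQuot.liftAlgHom k ⟨UniversalEnvelopingAlgebra.lift k F, by
    rintro _ _ ⟨x⟩
    rw [map_pow, UniversalEnvelopingAlgebra.lift_ι_apply,
      UniversalEnvelopingAlgebra.lift_ι_apply, hF]⟩

theorem RestrictedEnvelope.lift_ι (f : L → L) {A : Type*} [Ring A] [Algebra k A] (F : L →ₗ⁅k⁆ A)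
    (hF : ∀ x, F x ^ p = F (f x)) (x : L) :
    RestrictedEnvelope.lift k p f F hF (RestrictedEnvelope.ι k p f x) = F x := by
  simp [RestrictedEnvelope.lift, RestrictedEnvelope.ι]

end Envelope

/-! ### Induced modules -/

section Induced

open TensorProduct

variable {k A B : Type*} [Field k] [Ring A] [Algebra k A] [Ring B] [Algebra k B]
  (φ : B →ₐ[k] A) (V : Type*) [AddCommGroup V] [Module k V] (ρ : B →ₐ[k] Module.End k V)

/-- The `A`-submodule of `A ⊗[k] V` generated by all `a φ(b) ⊗ v - a ⊗ b v`. -/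
def balancedRel : Submodule A (A ⊗[k] V) :=
  Submodule.span A {t | ∃ (a : A) (b : B) (v : V), t = (a * φ b) ⊗ₜ[k] v - a ⊗ₜ[k] (ρ b v)}

/-- The induced module `A ⊗_B V`, for an algebra map `φ : B → A` and a `B`-module `V` given by the
representation `ρ`. -/
abbrev InducedModule : Type _ := (A ⊗[k] V) ⧸ balancedRel φ V ρ

end Induced

/-! ### Baby Verma modules -/

section Verma

variable (k : Type u) [Field k] (p : ℕ) [hp : Fact p.Prime] [CharP k p]

/-- The restricted enveloping algebra `u(𝔤)` of `𝔤 = W(1,1)`. -/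
abbrev RestrictedU : Type u := RestrictedEnvelope k p (pMap : W k p → W k p)

/-- The restricted enveloping algebra `u(𝔟⁺)`. -/
abbrev RestrictedUBorel : Type u := RestrictedEnvelope k p (pMapBorel : borel k p → borel k p)

/-- The map `u(𝔟⁺) → u(𝔤)` induced by the inclusion. -/
def borelMap : RestrictedUBorel k p →ₐ[k] RestrictedU k p :=
  RestrictedEnvelope.lift k p _ ((RestrictedEnvelope.ι k p pMap).comp (borel k p).incl)
    fun x => RestrictedEnvelope.ι_pow k p pMap (x : W k p)

variable {p}

/-- The algebra character `u(𝔟⁺) → k` of weight `lam ∈ 𝔽_p`. -/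
def weightCharacter (lam : ZMod p) : RestrictedUBorel k p →ₐ[k] k :=
  RestrictedEnvelope.lift k p _ (borelCharacter (ZMod.castHom (dvd_refl p) k lam)) fun x => by
    change (_ * _) ^ p = _ * pMap (x : W k p) (idxZero p)
    rw [mul_pow, ← map_pow, ZMod.pow_card, pMap_apply_zero x.2]

/-- The Verma module `Z⁺(lam) = u(𝔤) ⊗_{u(𝔟⁺)} lam` of highest weight `lam ∈ 𝔽_p`. -/
abbrev Verma (lam : ZMod p) : Type u :=
  InducedModule (borelMap k p) k ((Algebra.lmul k k).comp (weightCharacter k lam))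

/-- The `k`-vector space `Ext¹_{u(𝔤)}(Z⁺(mu), Z⁺(lam))`. -/
abbrev ExtVerma (mu lam : ZMod p) : Type u :=
  CategoryTheory.Abelian.Ext (ModuleCat.of (RestrictedU k p) (Verma k mu))
    (ModuleCat.of (RestrictedU k p) (Verma k lam)) 1

end Verma

end Witt11

end

/-! Present `Z⁺(μ)` as `P / I`, with `P = u(𝔤) ⊗ k` free of rank one and `I` generated by the
elements `b ⊗ 1 - 1 ⊗ χ_μ(b)`, `b ∈ u(𝔟⁺)`. As `P` is projective, `Ext¹(Z⁺(μ), M)` is `Hom(I, M)`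
modulo the homomorphisms that extend to `P`. The decomposition of `u(𝔤)` as the direct sum of the `e
(-1) ^ j u(𝔟⁺)`, `j < p`, identifies `Hom(I, M)` with the cocycles of `u(𝔟⁺)` in `Hom(k_μ, M)`, and
the homomorphisms that extend with the coboundaries: an explicit Shapiro lemma. This decomposition
is proved by letting `u(𝔤)` act on tensor fields `k[x]/(x^p) ⊗ u(𝔟⁺)`. The same construction with
coefficients `k_λ` turns `M = Z⁺(λ)` into `k[x]/(x^p)`, with `x^n ∂` acting as `x^n ∂ + c n
x^(n-1)`, `c = λ + 1` (`vermaEquiv`).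

Since `e 0` is diagonalizable with distinct eigenvalues on monomials, a cocycle may be normalized to
vanish on `e 0`. It then has the form `e r ↦ C r x^((s + r) mod p)` with `s ≡ μ - λ - 1`. Put `d = p
- 1 - s`, the representative of `λ - μ`; the exponent `s + r` wraps around modulo `p` exactly when
`r > d`. As `e 1` and `e 2` generate the nilradical, only `(C 1, C 2)` matters, and the remaining
coboundaries, those of `x^s`, span at most a line in this plane. So `Ext¹` is the space of
admissible pairs modulo that line (`subsingleton_extVerma`, `extVerma_equiv`).

Which pairs are admissible is governed by the relations between `e 1` and `e 2`, in degrees 5 and 7.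
For `d = 2, 3` there is none, nor for `d = 4` when `p ≥ 7`: every pair is admissible and `Ext¹` is a
line. The relation of degree 5 is a quadratic polynomial times the determinant of `(C 1, C 2)`
against the coboundary pair (`quadratic_mul_det`); the quadratic is `4 (c - 1) (c - 5)` for `d = 5`
and `2 (2λ² - 10λ + 3)` for `d = 6`. For `d ≥ 7` the relation of degree 7 forces the determinant to
vanish (`det_eq_zero`).

The exceptions come from `d = 0`, `d = 1` and `s = 0`, where exponents wrap around or the coboundary
line degenerates. There one finds the cocycles `f ∂ ↦ f'`, `f''`, `f'''` with values in densities of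
weight 0, 1, 2, and those supported on `e 1` or `e 2`; the equations `e (p - 1) = 0` and `e 1 ^ p =
0` exclude everything else. For `p = 5` and `d = 4`, the equation `e 4 = 0` plays the role of the
missing relation of degree 5. -/

noncomputable section

namespace Witt11

universe u

set_option linter.unusedSectionVars false

attribute [local instance] LieRing.ofAssociativeRing

/-! ### Extensions from a presentation -/

section ExtPresentation

open CategoryTheory CategoryTheory.Abelian

variable {k : Type u} [Field k] {A : Type u} [Ring A] [Algebra k A] {P M : Type u}
  [AddCommGroup P] [Module A P] [AddCommGroup M] [Module A M] (I : Submodule A P)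

/-- The short exact sequence `0 → I → P → P ⧸ I → 0`. -/
abbrev quotientSequence : ShortComplex (ModuleCat.{u} A) :=
  ShortComplex.mk (ModuleCat.ofHom I.subtype) (ModuleCat.ofHom I.mkQ) (by ext; simp)

theorem quotientSequence_shortExact : (quotientSequence I).ShortExact :=
  ModuleCat.shortComplex_shortExact _
    (fun x => by simp [quotientSequence])
    I.injective_subtype I.mkQ_surjective

variable (k) in
/-- The connecting map `Hom(I, M) → Ext¹(P ⧸ I, M)`. -/
def connecting (M : ModuleCat.{u} A) : (ModuleCat.of A I ⟶ M) →ₗ[k]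
    Ext (ModuleCat.of A (P ⧸ I)) M 1 where
  toFun f := (quotientSequence_shortExact I).extClass.comp (Ext.mk₀ f) (add_zero 1)
  map_add' f g := by rw [Ext.mk₀_add, Ext.comp_add]
  map_smul' c f := by rw [Ext.mk₀_smul, Ext.comp_smul]; rfl

theorem connecting_surjective [Module.Projective A P] (M : ModuleCat.{u} A) :
    Function.Surjective (connecting k I M) := by
  intro x
  have : Projective (ModuleCat.of A P) := inferInstance
  obtain ⟨y, hy⟩ := Ext.contravariant_sequence_exact₃ (quotientSequence_shortExact I) M x
    (Ext.eq_zero_of_projective _) (n₀ := 0) (by norm_num)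
  obtain ⟨f, rfl⟩ := (Ext.mk₀_bijective _ _).2 y
  exact ⟨f, hy⟩

theorem connecting_eq_zero_iff (M : ModuleCat.{u} A) (f : ModuleCat.of A I ⟶ M) :
    connecting k I M f = 0 ↔ ∃ g : P →ₗ[A] M, g ∘ₗ I.subtype = f.hom := by
  constructor
  · intro h
    obtain ⟨y, hy⟩ := Ext.contravariant_sequence_exact₁ (quotientSequence_shortExact I) M
      (Ext.mk₀ f) (by norm_num) h
    obtain ⟨g, rfl⟩ := (Ext.mk₀_bijective _ _).2 y
    rw [Ext.mk₀_comp_mk₀] at hy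
    have h2 := (Ext.mk₀_bijective _ _).1 hy
    exact ⟨g.hom, by rw [← h2]; rfl⟩
  · rintro ⟨g, hg⟩
    have hf : f = (quotientSequence I).f ≫ ModuleCat.ofHom g := by
      ext x
      exact (LinearMap.congr_fun hg x).symm
    change (quotientSequence_shortExact I).extClass.comp (Ext.mk₀ f) (add_zero 1) = 0
    rw [hf, ← Ext.mk₀_comp_mk₀, ← Ext.comp_assoc_of_second_deg_zero,
      ShortComplex.ShortExact.extClass_comp, Ext.zero_comp]

theorem subsingleton_ext_of_extends (k : Type u) [Field k] [Algebra k A] [Module.Projective A P]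
    (h : ∀ f : I →ₗ[A] M, ∃ g : P →ₗ[A] M, g ∘ₗ I.subtype = f) :
    Subsingleton (Ext (ModuleCat.of A (P ⧸ I)) (ModuleCat.of A M) 1) := by
  refine ⟨fun x y => ?_⟩
  have key : ∀ z : Ext (ModuleCat.of A (P ⧸ I)) (ModuleCat.of A M) 1, z = 0 := by
    intro z
    obtain ⟨f, rfl⟩ := connecting_surjective (k := k) I _ z
    exact (connecting_eq_zero_iff I _ f).2 (h f.hom)
  rw [key x, key y]

/-- `T` and the connecting map are surjections from `Hom(I, M)` with the same kernel, so their
targets agree. `T` is only additive, with `hsmul` in place of linearity, because scalars act on `M`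
through `algebraMap k A`. -/
theorem ext_equiv_of_functional [Module.Projective A P] (T : (I →ₗ[A] M) →+ k)
    (hsmul : ∀ (c : k) (f g : I →ₗ[A] M), (∀ x, g x = algebraMap k A c • f x) → T g = c * T f)
    (hsurj : ∃ f, T f ≠ 0)
    (hker : ∀ f : I →ₗ[A] M, T f = 0 ↔ ∃ g : P →ₗ[A] M, g ∘ₗ I.subtype = f) :
    Nonempty (Ext (ModuleCat.of A (P ⧸ I)) (ModuleCat.of A M) 1 ≃ₗ[k] k) := by
  let T' : (ModuleCat.of A I ⟶ ModuleCat.of A M) →ₗ[k] k :=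
    { toFun := fun f => T f.hom
      map_add' := fun f g => map_add T f.hom g.hom
      map_smul' := fun c f => hsmul c f.hom _ fun x => rfl }
  have hT' : Function.Surjective T' := by
    obtain ⟨f, hf⟩ := hsurj
    intro c
    refine ⟨(c / T f) • ModuleCat.ofHom f, ?_⟩
    rw [map_smul]
    exact div_mul_cancel₀ c hf
  have hk : LinearMap.ker (connecting k I (ModuleCat.of A M)) = LinearMap.ker T' := by
    ext f
    rw [LinearMap.mem_ker, LinearMap.mem_ker, connecting_eq_zero_iff]
    exact (hker f.hom).symm
  exact ⟨((connecting k I (ModuleCat.of A M)).quotKerEquivOfSurjective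
    (connecting_surjective I _)).symm.trans
    ((Submodule.quotEquivOfEq _ _ hk).trans (T'.quotKerEquivOfSurjective hT'))⟩

end ExtPresentation

/-! ### Brackets of vector fields -/

section VectorFields

variable {R : Type*} [Ring R] (x D : R) (E : ℕ → R)

/-- The additive map `ℤ[X, Z] → R` with `X ^ a * Z ^ b ↦ x ^ a * E b`. -/
def symbolMap : MvPolynomial (Fin 2) ℤ →ₗ[ℤ] R :=
  (MvPolynomial.basisMonomials (Fin 2) ℤ).constr ℤ fun s => x ^ s 0 * E (s 1)

theorem symbolMap_monomial (s : Fin 2 →₀ ℕ) (c : ℤ) :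
    symbolMap x E (MvPolynomial.monomial s c) = c • (x ^ s 0 * E (s 1)) := by
  have h : MvPolynomial.monomial s c
      = c • (MvPolynomial.basisMonomials (Fin 2) ℤ) s := by
    rw [MvPolynomial.coe_basisMonomials, MvPolynomial.smul_monomial, smul_eq_mul, mul_one]
  rw [h, map_smul, symbolMap, Module.Basis.constr_basis]

theorem symbolMap_X_pow_mul_X_pow (a b : ℕ) :
    symbolMap x E (MvPolynomial.X 0 ^ a * MvPolynomial.X 1 ^ b) = x ^ a * E b := by
  rw [MvPolynomial.X_pow_eq_monomial, MvPolynomial.X_pow_eq_monomial, MvPolynomial.monomial_mul,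
    symbolMap_monomial]
  simp

/-- The symbol `((X + Z) ^ n - X ^ n) / Z`. -/
def shiftSymbol (n : ℕ) : MvPolynomial (Fin 2) ℤ :=
  ∑ r ∈ Finset.range n, (n.choose (r + 1) : ℤ) • (MvPolynomial.X 0 ^ (n - 1 - r) * MvPolynomial.X 1 ^ r)

theorem X_mul_shiftSymbol (n : ℕ) : MvPolynomial.X 1 * shiftSymbol n =
    (MvPolynomial.X 0 + MvPolynomial.X 1) ^ n - MvPolynomial.X 0 ^ n := by
  rw [add_comm (MvPolynomial.X 0), add_pow, Finset.sum_range_succ', shiftSymbol, Finset.mul_sum]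
  simp only [pow_zero, Nat.sub_zero, one_mul, Nat.choose_zero_right, Nat.cast_one, mul_one,
    add_sub_cancel_right]
  refine Finset.sum_congr rfl fun r _ => ?_
  rw [show n - (r + 1) = n - 1 - r by omega, zsmul_eq_mul]
  push_cast
  ring

/-- The operator `x ^ n D + ∑ r, (n choose r + 1) x ^ (n - 1 - r) E r`, by which the vector field
`x ^ n ∂` acts on tensor fields. -/
def tensorField (n : ℕ) : R :=
  x ^ n * D + ∑ r ∈ Finset.range n, n.choose (r + 1) • (x ^ (n - 1 - r) * E r)

theorem tensorField_eq (n : ℕ) : tensorField x D E n = x ^ n * D + symbolMap x E (shiftSymbol n) := by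
  rw [tensorField, shiftSymbol, map_sum]
  congr 1
  refine Finset.sum_congr rfl fun r _ => ?_
  rw [map_smul, symbolMap_X_pow_mul_X_pow, natCast_zsmul]

variable {x D E}

theorem mul_pow_of_mul_eq (hDx : D * x = x * D + 1) (n : ℕ) :
    D * x ^ n = x ^ n * D + n • x ^ (n - 1) := by
  induction n with
  | zero => simp
  | succ n ih =>
    rw [pow_succ, ← mul_assoc, ih, add_mul, mul_assoc, hDx, mul_add, mul_one, succ_nsmul, add_assoc,
      ← mul_assoc, add_tsub_cancel_right]
    congr 1
    rw [add_comm]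
    congr 1
    rcases n with _ | n
    · simp
    · rw [smul_mul_assoc, add_tsub_cancel_right, pow_succ]

theorem pow_mul_bracket_pow_mul (hDx : D * x = x * D + 1) (n m : ℕ) :
    ⁅x ^ n * D, x ^ m * D⁆ = ((m : ℤ) - n) • (x ^ (n + m - 1) * D) := by
  have key : ∀ n m : ℕ, x ^ n * D * (x ^ m * D) =
      x ^ (n + m) * D * D + (m : ℤ) • (x ^ (n + m - 1) * D) := by
    intro n m
    rw [mul_assoc, ← mul_assoc D, mul_pow_of_mul_eq hDx, add_mul, mul_add, ← mul_assoc, ← mul_assoc,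
      ← pow_add, smul_mul_assoc, mul_smul_comm, ← mul_assoc, ← pow_add, natCast_zsmul]
    congr 1
    rcases m with _ | m
    · simp
    · rw [add_tsub_cancel_right, ← add_assoc, add_tsub_cancel_right]
  rw [LieRing.of_associative_ring_bracket, key, key, add_comm m n, sub_smul]
  abel

/-- `D` differentiates powers of `x` and commutes with the `E r`, so on symbols the commutator with
`x ^ n D` is the vector field `X^n ∂_X`. -/
theorem pow_mul_bracket_symbolMap (hDx : D * x = x * D + 1) (hD : ∀ r, Commute D (E r))
    (hx : ∀ r, Commute x (E r)) (n : ℕ) (f : MvPolynomial (Fin 2) ℤ) :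
    ⁅x ^ n * D, symbolMap x E f⁆ =
      symbolMap x E (MvPolynomial.X 0 ^ n * MvPolynomial.pderiv 0 f) := by
  induction f using MvPolynomial.induction_on' with
  | add f g hf hg => rw [map_add, lie_add, hf, hg, map_add, mul_add, map_add]
  | monomial s c =>
    rw [symbolMap_monomial, MvPolynomial.pderiv_monomial, MvPolynomial.X_pow_eq_monomial,
      MvPolynomial.monomial_mul, symbolMap_monomial, lie_zsmul, one_mul, mul_smul, natCast_zsmul]
    congr 1
    simp only [Finsupp.add_apply, Finsupp.single_eq_same, Finsupp.tsub_apply,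
      LieRing.of_associative_ring_bracket]
    have h1 : (Finsupp.single (0 : Fin 2) n) 1 = 0 := by simp
    have h2 : (Finsupp.single (0 : Fin 2) 1) 1 = 0 := by simp
    rw [h1, h2, zero_add, tsub_zero, pow_add]
    have h3 : x ^ s 0 * E (s 1) * (x ^ n * D) = x ^ n * x ^ s 0 * D * E (s 1) := by
      rw [mul_assoc _ D, (hD _).eq, mul_assoc, ← mul_assoc (E _), ← ((hx _).pow_left n).eq,
        mul_assoc (x ^ n), ← mul_assoc, ← pow_add, ← pow_add, add_comm]
    rw [h3, mul_assoc (x ^ n) D, ← mul_assoc D, mul_pow_of_mul_eq hDx, add_mul, mul_add]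
    simp only [mul_assoc, add_sub_cancel_left, smul_mul_assoc, mul_smul_comm]

/-- The `E r` multiply like the vector fields `Z^(r+1) ∂_Z`, so a symbol `f` stands for `Z f ∂_Z`
and the right side is the bracket of two such fields. -/
theorem symbolMap_bracket_symbolMap (hx : ∀ r, Commute x (E r))
    (hE : ∀ r s : ℕ, ⁅E r, E s⁆ = ((s : ℤ) - r) • E (r + s)) (f g : MvPolynomial (Fin 2) ℤ) :
    ⁅symbolMap x E f, symbolMap x E g⁆ =
      symbolMap x E (f * MvPolynomial.pderiv 1 (MvPolynomial.X 1 * g)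
        - MvPolynomial.pderiv 1 (MvPolynomial.X 1 * f) * g) := by
  induction f using MvPolynomial.induction_on' with
  | add f f' hf hf' =>
    rw [map_add, add_lie, hf, hf', ← map_add (symbolMap x E), mul_add (MvPolynomial.X 1) f f',
      map_add (MvPolynomial.pderiv 1)]
    congr 1
    ring
  | monomial s c =>
    induction g using MvPolynomial.induction_on' with
    | add f f' hf hf' =>
      rw [map_add, lie_add, hf, hf', ← map_add (symbolMap x E), mul_add (MvPolynomial.X 1) f f',
        map_add (MvPolynomial.pderiv 1)]
      congr 1
      ring
    | monomial t d =>
      have hp : ∀ (s : Fin 2 →₀ ℕ) (c : ℤ), MvPolynomial.pderiv 1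
          (MvPolynomial.X 1 * MvPolynomial.monomial s c)
          = ((s 1 : ℤ) + 1) • MvPolynomial.monomial s c := by
        intro s c
        rw [MvPolynomial.X, MvPolynomial.monomial_mul, MvPolynomial.pderiv_monomial,
          add_tsub_cancel_left, MvPolynomial.smul_monomial]
        simp [mul_comm, add_comm]
      rw [hp, hp, mul_smul_comm, smul_mul_assoc, ← sub_smul, MvPolynomial.monomial_mul, map_smul,
        symbolMap_monomial, symbolMap_monomial, symbolMap_monomial, lie_zsmul, zsmul_lie,
        smul_smul, smul_smul]
      have h : ⁅x ^ s 0 * E (s 1), x ^ t 0 * E (t 1)⁆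
          = ((t 1 : ℤ) - s 1) • (x ^ (s + t) 0 * E ((s + t) 1)) := by
        have h3 : ∀ a b a' b' : ℕ, x ^ a * E b * (x ^ a' * E b') = x ^ (a + a') * (E b * E b') := by
          intro a b a' b'
          rw [mul_assoc, ← mul_assoc (E b), ← ((hx _).pow_left a').eq, pow_add]
          simp only [mul_assoc]
        rw [LieRing.of_associative_ring_bracket, h3, h3, add_comm (t 0), ← mul_sub,
          ← LieRing.of_associative_ring_bracket, hE, mul_smul_comm]
        rfl
      rw [h, smul_smul]
      congr 1
      ring

open MvPolynomial in
-- In the coordinates `X` and `Y = X + Z`, the field `X^n ∂_X + ((X + Z)^n - X^n) ∂_Z` becomes `X^n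
-- ∂_X + Y^n ∂_Y`, which visibly respects brackets. The identity is its `∂_Z` component, checked
-- after multiplication by `Z` to clear the denominators of `shiftSymbol`.
theorem shiftSymbol_bracket (n m : ℕ) :
    X 0 ^ n * pderiv 0 (shiftSymbol m) - X 0 ^ m * pderiv 0 (shiftSymbol n)
      + (shiftSymbol n * pderiv 1 (X 1 * shiftSymbol m) - pderiv 1 (X 1 * shiftSymbol n) * shiftSymbol m)
      = ((m : ℤ) - n) • shiftSymbol (n + m - 1) := by
  have hX : (X 1 : MvPolynomial (Fin 2) ℤ) ≠ 0 := X_ne_zero 1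
  have h10 : pderiv 0 (X 1 : MvPolynomial (Fin 2) ℤ) = 0 := pderiv_X_of_ne (by decide)
  have h01 : pderiv 1 (X 0 : MvPolynomial (Fin 2) ℤ) = 0 := pderiv_X_of_ne (by decide)
  have hd : ∀ m : ℕ, X 1 * pderiv 0 (shiftSymbol m) =
      (m : MvPolynomial (Fin 2) ℤ) * (X 0 + X 1) ^ (m - 1)
        - (m : MvPolynomial (Fin 2) ℤ) * X 0 ^ (m - 1) := by
    intro m
    have h := congrArg (pderiv 0) (X_mul_shiftSymbol m)
    rw [Derivation.leibniz, h10, smul_zero, add_zero, smul_eq_mul] at h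
    rw [h, map_sub, pderiv_pow, pderiv_pow, map_add, h10, pderiv_X_self]
    ring
  have hd1 : ∀ m : ℕ, pderiv 1 (X 1 * shiftSymbol m) =
      (m : MvPolynomial (Fin 2) ℤ) * (X 0 + X 1) ^ (m - 1) := by
    intro m
    rw [X_mul_shiftSymbol, map_sub, pderiv_pow, pderiv_pow, map_add, h01, pderiv_X_self]
    ring
  apply mul_left_cancel₀ hX
  have e1 : X 1 * (X 0 ^ n * pderiv 0 (shiftSymbol m) - X 0 ^ m * pderiv 0 (shiftSymbol n)
      + (shiftSymbol n * pderiv 1 (X 1 * shiftSymbol m)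
        - pderiv 1 (X 1 * shiftSymbol n) * shiftSymbol m))
      = X 0 ^ n * (X 1 * pderiv 0 (shiftSymbol m)) - X 0 ^ m * (X 1 * pderiv 0 (shiftSymbol n))
      + ((X 1 * shiftSymbol n) * pderiv 1 (X 1 * shiftSymbol m)
        - pderiv 1 (X 1 * shiftSymbol n) * (X 1 * shiftSymbol m)) := by ring
  rw [e1, hd, hd, hd1, hd1, X_mul_shiftSymbol, X_mul_shiftSymbol, mul_smul_comm, X_mul_shiftSymbol,
    zsmul_eq_mul]
  rcases n with _ | n
  · rcases m with _ | m
    · simp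
    · simp
      ring
  · rcases m with _ | m
    · simp
      ring
    · rw [show n + 1 + (m + 1) - 1 = n + m + 1 by omega]
      simp only [add_tsub_cancel_right]
      push_cast
      ring

theorem tensorField_bracket (hDx : D * x = x * D + 1) (hD : ∀ r, Commute D (E r))
    (hx : ∀ r, Commute x (E r)) (hE : ∀ r s : ℕ, ⁅E r, E s⁆ = ((s : ℤ) - r) • E (r + s)) (n m : ℕ) :
    ⁅tensorField x D E n, tensorField x D E m⁆ = ((m : ℤ) - n) • tensorField x D E (n + m - 1) := by
  simp only [tensorField_eq]
  rw [smul_add, ← map_smul, ← shiftSymbol_bracket, map_add, map_sub, add_lie, lie_add, lie_add,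
    ← symbolMap_bracket_symbolMap hx hE, ← pow_mul_bracket_symbolMap hDx hD hx,
    ← pow_mul_bracket_symbolMap hDx hD hx, ← pow_mul_bracket_pow_mul hDx,
    ← lie_skew (symbolMap x E (shiftSymbol n)) (x ^ m * D)]
  abel

/-- A term survives `x ^ p = 0` and the vanishing of `E` only if `r + 1 < p` and `n - (r + 1) < p`;
as `n ≥ p`, the binomial coefficient is then divisible by `p`. -/
theorem tensorField_eq_zero (p : ℕ) [hp : Fact p.Prime] (hpR : (p : R) = 0) (hxp : x ^ p = 0)
    (hE : ∀ r, p ≤ r + 1 → E r = 0) {n : ℕ} (hn : p ≤ n) : tensorField x D E n = 0 := by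
  rw [tensorField, pow_eq_zero_of_le hn hxp, zero_mul, zero_add]
  refine Finset.sum_eq_zero fun r hr => ?_
  by_cases h1 : p ≤ r + 1
  · rw [hE r h1, mul_zero, smul_zero]
  by_cases h2 : p ≤ n - 1 - r
  · rw [pow_eq_zero_of_le h2 hxp, zero_mul, smul_zero]
  obtain ⟨c, hc⟩ := hp.out.dvd_choose (a := r + 1) (b := n) (by omega) (by omega) hn
  rw [hc, mul_comm, mul_smul, nsmul_eq_mul p, hpR, zero_mul, smul_zero]

end VectorFields

/-! ### Induction on restricted envelopes -/

section EnvelopeInduction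

variable {k : Type u} [Field k] {p : ℕ} {L : Type u} [LieRing L] [LieAlgebra k L] {f : L → L}

theorem RestrictedEnvelope.algHom_ext {R : Type*} [Ring R] [Algebra k R]
    {F G : RestrictedEnvelope k p f →ₐ[k] R}
    (h : ∀ x, F (RestrictedEnvelope.ι k p f x) = G (RestrictedEnvelope.ι k p f x)) : F = G := by
  apply RingQuot.ringQuot_ext'
  apply UniversalEnvelopingAlgebra.hom_ext
  ext x
  exact h x

/-- The elements satisfying `P` form a subalgebra containing the image of `L`. The universal
property maps `u(L)` into it, and composing with the inclusion gives the identity. -/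
theorem RestrictedEnvelope.induction {P : RestrictedEnvelope k p f → Prop}
    (halg : ∀ c, P (algebraMap k _ c)) (hι : ∀ x, P (RestrictedEnvelope.ι k p f x))
    (hmul : ∀ a b, P a → P b → P (a * b)) (hadd : ∀ a b, P a → P b → P (a + b))
    (a : RestrictedEnvelope k p f) : P a := by
  let S : Subalgebra k (RestrictedEnvelope k p f) :=
    { carrier := {a | P a}
      mul_mem' := fun ha hb => hmul _ _ ha hb
      add_mem' := fun ha hb => hadd _ _ ha hb
      algebraMap_mem' := halg }
  let F : L →ₗ⁅k⁆ S :=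
    { toFun := fun x => ⟨RestrictedEnvelope.ι k p f x, hι x⟩
      map_add' := fun x y => Subtype.ext (map_add _ x y)
      map_smul' := fun c x => Subtype.ext (map_smul _ c x)
      map_lie' := fun {x y} => Subtype.ext (LieHom.map_lie _ x y) }
  have h : S.val.comp (RestrictedEnvelope.lift k p f F fun x =>
      Subtype.ext (RestrictedEnvelope.ι_pow k p f x)) = AlgHom.id k _ := by
    apply RestrictedEnvelope.algHom_ext
    intro x
    rw [AlgHom.comp_apply, RestrictedEnvelope.lift_ι]
    rfl
  have h2 := DFunLike.congr_fun h a
  rw [AlgHom.comp_apply, AlgHom.id_apply] at h2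
  rw [← h2]
  exact (RestrictedEnvelope.lift k p f F _ a).2

end EnvelopeInduction

/-! ### Lie homomorphisms and restrictedness tested on a spanning set -/

section RestrictedHom

variable {k : Type u} [Field k] {L : Type*} [LieRing L] [LieAlgebra k L]
  {R : Type*} [Ring R] [Algebra k R]

/-- A linear map which is compatible with brackets on a spanning set is a Lie homomorphism. -/
def lieHomOfSpan (F : L →ₗ[k] R) (S : Set L) (hS : Submodule.span k S = ⊤)
    (h : ∀ x ∈ S, ∀ y ∈ S, F ⁅x, y⁆ = ⁅F x, F y⁆) : L →ₗ⁅k⁆ R :=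
  { F with
    map_lie' := by
      intro x y
      change F ⁅x, y⁆ = ⁅F x, F y⁆
      have hx : x ∈ Submodule.span k S := hS ▸ Submodule.mem_top
      have hy : y ∈ Submodule.span k S := hS ▸ Submodule.mem_top
      induction hx using Submodule.span_induction with
      | zero => simp
      | add a b _ _ ha hb => rw [add_lie, map_add, ha, hb, map_add, add_lie]
      | smul c a _ ha => rw [smul_lie, map_smul, ha, map_smul, smul_lie]
      | mem a ha =>
        induction hy using Submodule.span_induction with
        | zero => simp
        | add b c _ _ hb hc => rw [lie_add, map_add, hb, hc, map_add, lie_add]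
        | smul c b _ hb => 
          rw [lie_smul, map_smul, hb, map_smul]
          simp only [LieRing.of_associative_ring_bracket, mul_smul_comm, smul_mul_assoc, smul_sub]
        | mem b hb => exact h a ha b hb }

/-- A Lie homomorphism which is compatible with a `p`-mapping on a spanning set is restricted. -/
theorem pow_eq_of_span {p : ℕ} [hp : Fact p.Prime] [CharP k p] {R' : Type*} [Ring R'] [Algebra k R']
    (F : L →ₗ⁅k⁆ R) (G : L →ₗ⁅k⁆ R') (hG : Function.Injective G) (f : L → L)
    (hf : ∀ x, G x ^ p = G (f x)) (S : Set L) (hS : Submodule.span k S = ⊤)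
    (h : ∀ x ∈ S, F x ^ p = F (f x)) (x : L) : F x ^ p = F (f x) := by
  -- Closure under sums, by `pow_add_sub_mem`, only shows that `H x ^ p` is `H y` for some `y`.
  -- Pairing `F` with the injective `G` then identifies `y` as `f x`.
  let H : L →ₗ⁅k⁆ R × R' :=
    { (F : L →ₗ[k] R).prod (G : L →ₗ[k] R') with
      map_lie' := fun {x y} => Prod.ext (LieHom.map_lie F x y) (LieHom.map_lie G x y) }
  have hH : ∀ x, ∃ y, H y = H x ^ p := by
    intro x
    have hx : x ∈ Submodule.span k S := hS ▸ Submodule.mem_top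
    induction hx using Submodule.span_induction with
    | zero => exact ⟨0, by rw [map_zero, zero_pow hp.out.ne_zero]⟩
    | mem x hx => exact ⟨f x, Prod.ext (h x hx).symm (hf x).symm⟩
    | smul c x _ hx =>
      obtain ⟨y, hy⟩ := hx
      exact ⟨c ^ p • y, by rw [map_smul, map_smul, smul_pow, hy]⟩
    | add x x' _ _ hx hx' =>
      obtain ⟨y, hy⟩ := hx
      obtain ⟨y', hy'⟩ := hx'
      obtain ⟨s, hs⟩ := pow_add_sub_mem (k := k) p (LinearMap.range (H : L →ₗ[k] R × R')) (by
        rintro _ ⟨a, rfl⟩ _ ⟨b, rfl⟩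
        exact ⟨⁅a, b⁆, LieHom.map_lie H a b⟩) (H x) (H x') ⟨x, rfl⟩ ⟨x', rfl⟩
      refine ⟨s + y + y', ?_⟩
      have hs' : H s = (H x + H x') ^ p - H x ^ p - H x' ^ p := hs
      rw [map_add, map_add, map_add, hs', hy, hy']
      abel
  obtain ⟨y, hy⟩ := hH x
  have h1 : F y = F x ^ p := congrArg Prod.fst hy
  have h2 : G y = G x ^ p := congrArg Prod.snd hy
  rw [← h1, hG (h2.trans (hf x))]

end RestrictedHom

/-! ### The vector fields `x ^ n ∂` as spanning families of `W(1,1)` and `𝔟⁺` -/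

section Generators

variable (k : Type u) [Field k] (p : ℕ) [hp : Fact p.Prime] [CharP k p]

/-- The vector field `x ^ n ∂ = e (n - 1)`, which is zero for `n ≥ p`. -/
def field (n : ℕ) : W k p :=
  if h : (n : ℤ) - 1 ∈ Finset.Icc (-1 : ℤ) ((p : ℤ) - 2) then e ⟨(n : ℤ) - 1, h⟩ else 0

variable {p}

theorem field_of_lt {n : ℕ} (hn : n < p) :
    field k p n = e ⟨(n : ℤ) - 1, Finset.mem_Icc.2 ⟨by omega, by omega⟩⟩ := dif_pos _

theorem field_of_le {n : ℕ} (hn : p ≤ n) : field k p n = 0 :=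
  dif_neg fun h => by rw [Finset.mem_Icc] at h; omega

theorem field_eq (i : Idx p) : field k p ((i : ℤ) + 1).toNat = e i := by
  have hi := Finset.mem_Icc.1 i.2
  rw [field_of_lt k (by omega)]
  congr 1
  exact Subtype.ext (by simp; omega)

theorem natCast_zsmul_eq_zero {V : Type*} [AddCommGroup V] [Module k V] (v : V) :
    (p : ℤ) • v = 0 := by
  rw [natCast_zsmul, ← Nat.cast_smul_eq_nsmul k, CharP.cast_eq_zero, zero_smul]

theorem field_bracket (n m : ℕ) :
    ⁅field k p n, field k p m⁆ = ((m : ℤ) - n) • field k p (n + m - 1) := by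
  -- The one case where the field on the right is nonzero is `n = p`, `m = 0`, and there the
  -- coefficient is `-p`.
  have key : ∀ n m : ℕ, p ≤ n → ((m : ℤ) - n) • field k p (n + m - 1) = 0 := by
    intro n m hn
    by_cases h : p ≤ n + m - 1
    · rw [field_of_le k h, smul_zero]
    · rw [show ((m : ℤ) - n) = -p by have := hp.out.pos; omega, neg_smul,
        natCast_zsmul_eq_zero k, neg_zero]
  by_cases hn : p ≤ n
  · rw [field_of_le k hn, zero_lie, key n m hn]
  by_cases hm : p ≤ m
  · have h1 := key m n hm
    rw [add_comm] at h1
    rw [field_of_le k hm, lie_zero, ← neg_sub, neg_smul, h1, neg_zero]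
  rw [field_of_lt k (not_le.1 hn), field_of_lt k (not_le.1 hm)]
  by_cases h0 : n = 0 ∧ m = 0
  · obtain ⟨rfl, rfl⟩ := h0
    simp
  by_cases h : p ≤ n + m - 1
  · rw [bracket_e_e_of_notMem _ _ (by rw [Finset.mem_Icc]; simp only; omega), field_of_le k h,
      smul_zero]
  · rw [bracket_e_e _ _ (by rw [Finset.mem_Icc]; simp only; omega), field_of_lt k (not_le.1 h),
      ← Int.cast_smul_eq_zsmul k]
    congr 2
    · push_cast
      ring
    · exact Subtype.ext (by simp only; omega)

theorem pMap_field (n : ℕ) : pMap (field k p n) = if n = 1 then field k p 1 else 0 := by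
  by_cases hn : p ≤ n
  · rw [field_of_le k hn, if_neg (by have := hp.out.two_le; omega)]
    refine pMap_eq _ _ ?_
    rw [map_zero, zero_pow hp.out.ne_zero]
  · rw [field_of_lt k (not_le.1 hn), pMap_e]
    by_cases h1 : n = 1
    · subst h1
      rw [if_pos (by simp), if_pos rfl, field_of_lt k (not_le.1 hn)]
    · rw [if_neg (by simp; omega), if_neg h1]

theorem span_field : Submodule.span k (Set.range (field k p)) = ⊤ := by
  rw [eq_top_iff]
  intro x _
  rw [← sum_smul_e x]
  exact Submodule.sum_mem _ fun i _ => Submodule.smul_mem _ _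
    (Submodule.subset_span ⟨_, field_eq k i⟩)

theorem field_mem_borel (r : ℕ) : field k p (r + 1) ∈ borel k p := by
  intro i hi
  by_cases hr : p ≤ r + 1
  · rw [field_of_le k hr, zero_apply]
  · rw [field_of_lt k (not_le.1 hr), e_apply, if_neg]
    rintro rfl
    simp only at hi
    omega

variable (p) in
/-- The vector field `x ^ (r + 1) ∂ = e r` as an element of `𝔟⁺`. -/
def borelField (r : ℕ) : borel k p := ⟨field k p (r + 1), field_mem_borel k r⟩

theorem coe_borelField (r : ℕ) : (borelField k p r : W k p) = field k p (r + 1) := rfl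

theorem borelField_bracket (r s : ℕ) :
    ⁅borelField k p r, borelField k p s⁆ = ((s : ℤ) - r) • borelField k p (r + s) := by
  apply Subtype.ext
  rw [LieSubalgebra.coe_bracket, coe_borelField, coe_borelField, field_bracket]
  change _ = ((s : ℤ) - r) • field k p (r + s + 1)
  rw [show r + 1 + (s + 1) - 1 = r + s + 1 by omega]
  congr 1
  push_cast
  ring

theorem pMapBorel_borelField (r : ℕ) :
    pMapBorel (borelField k p r) = if r = 0 then borelField k p 0 else 0 := by
  apply Subtype.ext
  change pMap (field k p (r + 1)) = _
  rw [pMap_field]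
  by_cases hr : r = 0
  · subst hr
    rfl
  · rw [if_neg (by omega), if_neg hr]
    rfl

theorem span_borelField : Submodule.span k (Set.range (borelField k p)) = ⊤ := by
  rw [eq_top_iff]
  intro x _
  have hx : x = ∑ i : Idx p, (x : W k p) i • (if (i : ℤ) < 0 then 0 else borelField k p (i : ℤ).toNat) := by
    apply Subtype.ext
    conv_lhs => rw [← sum_smul_e (x : W k p)]
    change _ = ((borel k p).incl : borel k p →ₗ[k] W k p) _
    rw [map_sum]
    refine Finset.sum_congr rfl fun i _ => ?_
    rw [map_smul]
    split_ifs with hi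
    · rw [x.2 i hi, zero_smul, zero_smul]
    · congr 1
      change _ = field k p _
      rw [← field_eq]
      congr 1
      omega
  rw [hx]
  refine Submodule.sum_mem _ fun i _ => Submodule.smul_mem _ _ ?_
  split_ifs
  · exact Submodule.zero_mem _
  · exact Submodule.subset_span ⟨_, rfl⟩

end Generators

/-! ### Homomorphisms from restricted envelopes -/

section Families

/-- Elements `v n` of an algebra that satisfy the bracket relations of the vector fields
`x ^ n ∂` of `W(1,1)`. -/
structure IsWittFamily (p : ℕ) {R : Type*} [Ring R] (v : ℕ → R) : Prop where
  zero : ∀ n, p ≤ n → v n = 0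
  lie : ∀ n m, ⁅v n, v m⁆ = ((m : ℤ) - n) • v (n + m - 1)

/-- Elements `y r` of an algebra that satisfy the bracket relations of the basis `e r` of `𝔟⁺`. -/
structure IsBorelFamily (p : ℕ) {R : Type*} [Ring R] (y : ℕ → R) : Prop where
  zero : ∀ r, p ≤ r + 1 → y r = 0
  lie : ∀ r s, ⁅y r, y s⁆ = ((s : ℤ) - r) • y (r + s)

/-- The `p`-th powers of a family `y` are given by the `p`-mapping `e r ↦ δ_{r,0} e r`. -/
def IsRestrictedBorel (p : ℕ) {R : Type*} [Ring R] (y : ℕ → R) : Prop :=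
  ∀ r, y r ^ p = if r = 0 then y 0 else 0

/-- The `p`-th powers of a family `v` are given by the `p`-mapping of `W(1,1)`. -/
def IsRestrictedWitt (p : ℕ) {R : Type*} [Ring R] (v : ℕ → R) : Prop :=
  ∀ n, v n ^ p = if n = 1 then v 1 else 0

variable (k : Type u) [Field k] {p : ℕ} [hp : Fact p.Prime] [CharP k p]
  {R : Type*} [Ring R] [Algebra k R]

variable (p) in
/-- The linear map on `W(1,1)` with `x ^ n ∂ ↦ v n`. -/
def fieldLinear {V : Type*} [AddCommGroup V] [Module k V] (v : ℕ → V) : W k p →ₗ[k] V where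
  toFun x := ∑ i : Idx p, x i • v ((i : ℤ) + 1).toNat
  map_add' x y := by simp only [add_apply, add_smul, Finset.sum_add_distrib]
  map_smul' c x := by simp only [smul_apply, mul_smul, Finset.smul_sum, RingHom.id_apply]

theorem fieldLinear_field {V : Type*} [AddCommGroup V] [Module k V] {v : ℕ → V}
    (hv : ∀ n, p ≤ n → v n = 0) (n : ℕ) : fieldLinear k p v (field k p n) = v n := by
  by_cases hn : p ≤ n
  · rw [field_of_le k hn, map_zero, hv n hn]
  · rw [field_of_lt k (not_le.1 hn)]
    change ∑ i : Idx p, (e _ : W k p) i • _ = _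
    rw [Finset.sum_eq_single ⟨(n : ℤ) - 1, Finset.mem_Icc.2 ⟨by omega, by omega⟩⟩]
    · rw [e_apply, if_pos rfl, one_smul]
      simp
    · intro i _ hi
      rw [e_apply, if_neg hi, zero_smul]
    · simp

/-- The Lie homomorphism `W(1,1) → R` given by a family of elements with the right brackets. -/
def IsWittFamily.lieHom {v : ℕ → R} (hv : IsWittFamily p v) : W k p →ₗ⁅k⁆ R :=
  lieHomOfSpan (fieldLinear k p v) (Set.range (field k p)) (span_field k) (by
    rintro _ ⟨n, rfl⟩ _ ⟨m, rfl⟩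
    rw [field_bracket, map_zsmul, fieldLinear_field k hv.zero, fieldLinear_field k hv.zero,
      fieldLinear_field k hv.zero, hv.lie])

theorem IsWittFamily.lieHom_field {v : ℕ → R} (hv : IsWittFamily p v) (n : ℕ) :
    hv.lieHom k (field k p n) = v n :=
  fieldLinear_field k hv.zero n

/-- The comparison representation is the adjoint one: it is faithful and satisfies `(ad x) ^ p = ad
(x^[p])` for all `x`, so restrictedness need only be tested on the `x ^ n ∂`. -/
theorem IsWittFamily.lieHom_pow {v : ℕ → R} (hv : IsWittFamily p v) (hr : IsRestrictedWitt p v)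
    (x : W k p) : hv.lieHom k x ^ p = hv.lieHom k (pMap x) := by
  refine pow_eq_of_span (k := k) _ (LieAlgebra.ad k (W k p)) ?_ _ (fun x => (ad_pMap x).symm) _
    (span_field k) ?_ x
  · exact (injective_iff_map_eq_zero (LieAlgebra.ad k (W k p))).2
      fun y hy => eq_zero_of_ad_eq_zero y hy
  · rintro _ ⟨n, rfl⟩
    rw [hv.lieHom_field k, hr, pMap_field]
    split_ifs
    · rw [hv.lieHom_field k]
    · rw [map_zero]

/-- The algebra homomorphism `u(𝔤) → R` given by a restricted family. -/
def IsWittFamily.lift {v : ℕ → R} (hv : IsWittFamily p v) (hr : IsRestrictedWitt p v) :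
    RestrictedU k p →ₐ[k] R :=
  RestrictedEnvelope.lift k p _ (hv.lieHom k) (hv.lieHom_pow k hr)

variable (p) in
/-- The element `x ^ n ∂` of `u(𝔤)`. -/
def fieldU (n : ℕ) : RestrictedU k p := RestrictedEnvelope.ι k p pMap (field k p n)

theorem IsWittFamily.lift_fieldU {v : ℕ → R} (hv : IsWittFamily p v) (hr : IsRestrictedWitt p v)
    (n : ℕ) : hv.lift k hr (fieldU k p n) = v n :=
  (RestrictedEnvelope.lift_ι k p _ _ _ _).trans (hv.lieHom_field k n)

theorem isWittFamily_fieldU : IsWittFamily p (fieldU k p) where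
  zero n hn := by rw [fieldU, field_of_le k hn, map_zero]
  lie n m := by rw [fieldU, fieldU, ← LieHom.map_lie, field_bracket, map_zsmul]; rfl

theorem isRestrictedWitt_fieldU : IsRestrictedWitt p (fieldU k p) := by
  intro n
  rw [fieldU, RestrictedEnvelope.ι_pow, pMap_field]
  split_ifs
  · rfl
  · rw [map_zero]

variable (p) in
/-- The linear map on `𝔟⁺` with `e r ↦ y r`. -/
def borelLinear {V : Type*} [AddCommGroup V] [Module k V] (y : ℕ → V) : borel k p →ₗ[k] V :=
  fieldLinear k p (fun n => if n = 0 then 0 else y (n - 1)) ∘ₗ (borel k p).toSubmodule.subtype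

theorem borelLinear_borelField {V : Type*} [AddCommGroup V] [Module k V] {y : ℕ → V}
    (hy : ∀ r, p ≤ r + 1 → y r = 0) (r : ℕ) : borelLinear k p y (borelField k p r) = y r := by
  refine (fieldLinear_field (V := V) k (v := fun n => if n = 0 then 0 else y (n - 1))
    (fun n hn => ?_) (r + 1)).trans ?_
  · split_ifs
    · rfl
    · exact hy _ (by omega)
  · rw [if_neg (by omega), add_tsub_cancel_right]

/-- The Lie homomorphism `𝔟⁺ → R` given by a family of elements with the right brackets. -/
def IsBorelFamily.lieHom {y : ℕ → R} (hy : IsBorelFamily p y) : borel k p →ₗ⁅k⁆ R :=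
  lieHomOfSpan (borelLinear k p y) (Set.range (borelField k p)) (span_borelField k) (by
    rintro _ ⟨n, rfl⟩ _ ⟨m, rfl⟩
    rw [borelField_bracket, map_zsmul, borelLinear_borelField k hy.zero,
      borelLinear_borelField k hy.zero, borelLinear_borelField k hy.zero, hy.lie])

theorem IsBorelFamily.lieHom_borelField {y : ℕ → R} (hy : IsBorelFamily p y) (r : ℕ) :
    hy.lieHom k (borelField k p r) = y r :=
  borelLinear_borelField k hy.zero r

/-- Here `𝔟⁺` is compared with its action on all of `W(1,1)`, so that faithfulness is again the
triviality of the centre of `W(1,1)`. -/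
theorem IsBorelFamily.lieHom_pow {y : ℕ → R} (hy : IsBorelFamily p y)
    (hr : IsRestrictedBorel p y) (x : borel k p) :
    hy.lieHom k x ^ p = hy.lieHom k (pMapBorel x) := by
  let G : borel k p →ₗ⁅k⁆ Module.End k (W k p) := (LieAlgebra.ad k (W k p)).comp (borel k p).incl
  have hG : ∀ x, G x = LieAlgebra.ad k (W k p) (x : W k p) := fun _ => rfl
  refine pow_eq_of_span (k := k) (hy.lieHom k) G ?_ pMapBorel ?_ _
    (span_borelField k) ?_ x
  · refine (injective_iff_map_eq_zero G).2 fun x hx => ?_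
    rw [hG] at hx
    exact Subtype.ext (eq_zero_of_ad_eq_zero _ hx)
  · intro x
    rw [hG, hG]
    exact (ad_pMap (x : W k p)).symm
  · rintro _ ⟨n, rfl⟩
    rw [hy.lieHom_borelField k, hr, pMapBorel_borelField]
    split_ifs
    · rw [hy.lieHom_borelField k]
    · rw [map_zero]

/-- The algebra homomorphism `u(𝔟⁺) → R` given by a restricted family. -/
def IsBorelFamily.lift {y : ℕ → R} (hy : IsBorelFamily p y) (hr : IsRestrictedBorel p y) :
    RestrictedUBorel k p →ₐ[k] R :=
  RestrictedEnvelope.lift k p _ (hy.lieHom k) (hy.lieHom_pow k hr)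

variable (p) in
/-- The element `e r` of `u(𝔟⁺)`. -/
def fieldB (r : ℕ) : RestrictedUBorel k p := RestrictedEnvelope.ι k p pMapBorel (borelField k p r)

theorem IsBorelFamily.lift_fieldB {y : ℕ → R} (hy : IsBorelFamily p y)
    (hr : IsRestrictedBorel p y) (r : ℕ) : hy.lift k hr (fieldB k p r) = y r :=
  (RestrictedEnvelope.lift_ι k p _ _ _ _).trans (hy.lieHom_borelField k r)

theorem isBorelFamily_fieldB : IsBorelFamily p (fieldB k p) where
  zero r hr := by
    rw [fieldB, show borelField k p r = 0 from Subtype.ext (field_of_le k hr), map_zero]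
  lie r s := by rw [fieldB, fieldB, ← LieHom.map_lie, borelField_bracket, map_zsmul]; rfl

theorem isRestrictedBorel_fieldB : IsRestrictedBorel p (fieldB k p) := by
  intro n
  rw [fieldB, RestrictedEnvelope.ι_pow, pMapBorel_borelField]
  split_ifs
  · rfl
  · rw [map_zero]

theorem borelMap_fieldB (r : ℕ) : borelMap k p (fieldB k p r) = fieldU k p (r + 1) :=
  RestrictedEnvelope.lift_ι k p _ _ _ _

theorem weightCharacter_fieldB (lam : ZMod p) (r : ℕ) :
    weightCharacter k lam (fieldB k p r) = if r = 0 then ZMod.castHom (dvd_refl p) k lam else 0 := by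
  refine (RestrictedEnvelope.lift_ι k p _ _ _ _).trans ?_
  change _ * field k p (r + 1) (idxZero p) = _
  by_cases hr : p ≤ r + 1
  · rw [field_of_le k hr, zero_apply, mul_zero, if_neg]
    have := hp.out.two_le
    omega
  · rw [field_of_lt k (not_le.1 hr), e_apply]
    by_cases h : r = 0
    · subst h
      rw [if_pos (Subtype.ext (by simp [idxZero])), mul_one, if_pos rfl]
    · rw [if_neg, if_neg h, mul_zero]
      intro h2
      have := congrArg Subtype.val h2
      simp [idxZero] at this
      omega

/-- Induction on elements of `u(𝔤)` over the generators. -/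
theorem induction_fieldU {P : RestrictedU k p → Prop} (halg : ∀ c, P (algebraMap k _ c))
    (hfield : ∀ n, P (fieldU k p n)) (hmul : ∀ a b, P a → P b → P (a * b))
    (hadd : ∀ a b, P a → P b → P (a + b)) (a : RestrictedU k p) : P a := by
  refine RestrictedEnvelope.induction halg (fun x => ?_) hmul hadd a
  have hx : x ∈ Submodule.span k (Set.range (field k p)) := span_field (p := p) k ▸ Submodule.mem_top
  induction hx using Submodule.span_induction with
  | zero => rw [map_zero, ← map_zero (algebraMap k _)]; exact halg 0
  | mem x hx => obtain ⟨n, rfl⟩ := hx; exact hfield n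
  | add x y _ _ hx hy => rw [map_add]; exact hadd _ _ hx hy
  | smul c x _ hx => rw [map_smul, Algebra.smul_def]; exact hmul _ _ (halg c) hx

/-- Induction on elements of `u(𝔟⁺)` over the generators. -/
theorem induction_fieldB {P : RestrictedUBorel k p → Prop} (halg : ∀ c, P (algebraMap k _ c))
    (hfield : ∀ n, P (fieldB k p n)) (hmul : ∀ a b, P a → P b → P (a * b))
    (hadd : ∀ a b, P a → P b → P (a + b)) (a : RestrictedUBorel k p) : P a := by
  refine RestrictedEnvelope.induction halg (fun x => ?_) hmul hadd a
  have hx : x ∈ Submodule.span k (Set.range (borelField k p)) :=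
    span_borelField (p := p) k ▸ Submodule.mem_top
  induction hx using Submodule.span_induction with
  | zero => rw [map_zero, ← map_zero (algebraMap k _)]; exact halg 0
  | mem x hx => obtain ⟨n, rfl⟩ := hx; exact hfield n
  | add x y _ _ hx hy => rw [map_add]; exact hadd _ _ hx hy
  | smul c x _ hx => rw [map_smul, Algebra.smul_def]; exact hmul _ _ (halg c) hx

end Families

/-! ### A faithful family of modules -/

section CharPBracket

variable {p : ℕ} [hp : Fact p.Prime] {R : Type*} [Ring R]

theorem add_pow_of_commute_of_cast_eq_zero (hpR : (p : R) = 0) {a b : R} (h : Commute a b) :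
    (a + b) ^ p = a ^ p + b ^ p := by
  obtain ⟨c, hc⟩ := h.exists_add_pow_prime_eq hp.out
  rw [hc, hpR, zero_mul, zero_mul, zero_mul, add_zero]

theorem sub_pow_of_commute_of_cast_eq_zero (hpR : (p : R) = 0) {a b : R} (h : Commute a b) :
    (a - b) ^ p = a ^ p - b ^ p := by
  have h1 := add_pow_of_commute_of_cast_eq_zero hpR (h.sub_left (Commute.refl b))
  rw [sub_add_cancel] at h1
  rw [h1, add_sub_cancel_right]

/-- For a Lie homomorphism `F` on `W(1,1)`, the elements `F x ^ p` and `F (x^[p])` act in the same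
way on the image of `F` by commutators. -/
theorem lieHom_pow_bracket {k : Type u} [Field k] [CharP k p] [Algebra k R] (F : W k p →ₗ⁅k⁆ R)
    (x w : W k p) : ⁅F x ^ p, F w⁆ = ⁅F (pMap x), F w⁆ := by
  have hpE : ((p : ℕ) : Module.End k R) = 0 := by
    rw [← map_natCast (algebraMap k (Module.End k R)), CharP.cast_eq_zero, map_zero]
  have hit : ∀ n : ℕ, ((LinearMap.mulLeft k (F x) - LinearMap.mulRight k (F x)) ^ n) (F w)
      = F ((LieAlgebra.ad k (W k p) x ^ n) w) := by
    intro n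
    induction n with
    | zero => simp
    | succ n ih =>
      rw [pow_succ', Module.End.mul_apply, ih, pow_succ', Module.End.mul_apply, LieAlgebra.ad_apply,
        LieHom.map_lie]
      rfl
  have h := hit p
  -- Left and right multiplication commute, so in characteristic `p` the `p`-th power of the
  -- commutator with `F x` is the commutator with `F x ^ p`.
  rw [sub_pow_of_commute_of_cast_eq_zero hpE (LinearMap.commute_mulLeft_right (R := k) (F x) (F x)),
    LinearMap.pow_mulLeft, LinearMap.pow_mulRight, ← ad_pMap, LieAlgebra.ad_apply,
    LieHom.map_lie] at h
  exact h

end CharPBracket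

/-! ### Tensor fields `k[x]/(x ^ p) ⊗ Q` as matrices over `Q` -/

section TensorModule

open Matrix

variable (p : ℕ) {Q : Type*} [Ring Q]

/-- The vector `x ^ t ⊗ q` in `k[x]/(x ^ p) ⊗ Q`, the latter identified with `Fin p → Q`. -/
def monom (t : ℕ) (q : Q) : Fin p → Q := fun i => if (i : ℕ) = t then q else 0

variable (Q) in
/-- Multiplication by `x` on `k[x]/(x ^ p) ⊗ Q`. -/
def xMat : Matrix (Fin p) (Fin p) Q := Matrix.of fun i j => if (i : ℕ) = j + 1 then 1 else 0

variable (Q) in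
/-- The derivation `d/dx` on `k[x]/(x ^ p) ⊗ Q`. -/
def dMat : Matrix (Fin p) (Fin p) Q := Matrix.of fun i j => if (i : ℕ) + 1 = j then ((j : ℕ) : Q) else 0

variable {p}

theorem monom_of_le {t : ℕ} (ht : p ≤ t) (q : Q) : monom p t q = 0 := by
  funext i
  exact if_neg (by omega)

theorem monom_zero (t : ℕ) : monom p t (0 : Q) = 0 := by
  funext i
  exact ite_self 0

theorem monom_add (t : ℕ) (a b : Q) : monom p t (a + b) = monom p t a + monom p t b := by
  funext i
  simp only [monom, Pi.add_apply]
  split_ifs <;> simp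

theorem monom_eq_single (t : Fin p) (q : Q) : monom p t q = Pi.single t q := by
  funext i
  rw [Pi.single_apply]
  simp only [monom, Fin.ext_iff]

theorem monom_apply_self (t : Fin p) (q : Q) : monom p t q t = q := if_pos rfl

theorem sum_monom (u : Fin p → Q) : ∑ t : Fin p, monom p t (u t) = u := by
  simp only [monom_eq_single]
  exact Finset.univ_sum_single u

theorem matrix_ext_monom {M N : Matrix (Fin p) (Fin p) Q}
    (h : ∀ t : ℕ, t < p → M *ᵥ monom p t 1 = N *ᵥ monom p t 1) : M = N := by
  ext i j
  have h1 := congrFun (h j j.2) i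
  rw [monom_eq_single, mulVec_single_one, mulVec_single_one] at h1
  exact h1

theorem xMat_mulVec_monom (t : ℕ) (q : Q) : xMat p Q *ᵥ monom p t q = monom p (t + 1) q := by
  by_cases ht : p ≤ t
  · rw [monom_of_le ht, monom_of_le (by omega), mulVec_zero]
  · funext i
    rw [← Fin.val_mk (not_le.1 ht), monom_eq_single, mulVec_single]
    simp [xMat, monom]

theorem xMat_pow_mulVec_monom (a t : ℕ) (q : Q) :
    xMat p Q ^ a *ᵥ monom p t q = monom p (t + a) q := by
  induction a with
  | zero => simp
  | succ a ih => rw [pow_succ', ← mulVec_mulVec, ih, xMat_mulVec_monom, add_assoc]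

theorem dMat_mulVec_monom (hp : (p : Q) = 0) (t : ℕ) (q : Q) :
    dMat p Q *ᵥ monom p t q = monom p (t - 1) (t * q) := by
  by_cases ht : p ≤ t
  · rw [monom_of_le ht, mulVec_zero]
    rcases ht.lt_or_eq with h | rfl
    · rw [monom_of_le (by omega)]
    · rw [hp, zero_mul, monom_zero]
  · funext i
    rw [← Fin.val_mk (not_le.1 ht), monom_eq_single, mulVec_single]
    rcases t with _ | t
    · simp [dMat, monom]
    · simp [dMat, monom, add_mul]

theorem scalar_mulVec_monom (y : Q) (t : ℕ) (q : Q) :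
    (Matrix.scalar (Fin p) y) *ᵥ monom p t q = monom p t (y * q) := by
  funext i
  rw [scalar_apply, mulVec_diagonal, monom, monom]
  split_ifs <;> simp

theorem dMat_mul_xMat (hp : (p : Q) = 0) : dMat p Q * xMat p Q = xMat p Q * dMat p Q + 1 := by
  refine matrix_ext_monom fun t _ => ?_
  rw [add_mulVec, ← mulVec_mulVec, ← mulVec_mulVec, one_mulVec, xMat_mulVec_monom,
    dMat_mulVec_monom hp, dMat_mulVec_monom hp, xMat_mulVec_monom]
  rcases t with _ | t
  · simp [monom_zero]
  · simp only [add_tsub_cancel_right, ← monom_add]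
    congr 1
    push_cast
    rw [mul_one, mul_one]

theorem xMat_pow_eq_zero : xMat p Q ^ p = 0 := by
  refine matrix_ext_monom fun t _ => ?_
  rw [xMat_pow_mulVec_monom, zero_mulVec, monom_of_le (by omega)]

theorem dMat_pow_mulVec_monom (hp : (p : Q) = 0) (a t : ℕ) (q : Q) :
    dMat p Q ^ a *ᵥ monom p t q = monom p (t - a) (t.descFactorial a * q) := by
  induction a with
  | zero => simp
  | succ a ih =>
    rw [pow_succ', ← mulVec_mulVec, ih, dMat_mulVec_monom hp, Nat.descFactorial_succ, Nat.sub_sub,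
      Nat.cast_mul, mul_assoc]

theorem dMat_pow_eq_zero (hp : (p : Q) = 0) : dMat p Q ^ p = 0 := by
  refine matrix_ext_monom fun t ht => ?_
  rw [dMat_pow_mulVec_monom hp, zero_mulVec, Nat.descFactorial_of_lt ht, Nat.cast_zero, zero_mul,
    monom_zero]

theorem commute_xMat_scalar (y : Q) : Commute (xMat p Q) (Matrix.scalar (Fin p) y) := by
  refine matrix_ext_monom fun t _ => ?_
  rw [← mulVec_mulVec, ← mulVec_mulVec, xMat_mulVec_monom, scalar_mulVec_monom, scalar_mulVec_monom,
    xMat_mulVec_monom]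

theorem commute_dMat_scalar (hp : (p : Q) = 0) (y : Q) :
    Commute (dMat p Q) (Matrix.scalar (Fin p) y) := by
  refine matrix_ext_monom fun t _ => ?_
  rw [← mulVec_mulVec, ← mulVec_mulVec, dMat_mulVec_monom hp, scalar_mulVec_monom,
    scalar_mulVec_monom, dMat_mulVec_monom hp, mul_one, mul_one, (Nat.cast_commute t y).eq]

/-- The scalar matrices by which `e r` acts on the coefficients of a tensor field: the action is
twisted by the character of weight `1`. -/
def coeffMat (p : ℕ) (y : ℕ → Q) (r : ℕ) : Matrix (Fin p) (Fin p) Q :=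
  Matrix.scalar (Fin p) (y r + if r = 0 then 1 else 0)

/-- The action of `x ^ n ∂` on the module of tensor fields `k[x]/(x ^ p) ⊗ Q`. -/
def tensorMat (p : ℕ) (y : ℕ → Q) (n : ℕ) : Matrix (Fin p) (Fin p) Q :=
  tensorField (xMat p Q) (dMat p Q) (coeffMat p y) n

theorem tensorMat_zero (y : ℕ → Q) : tensorMat p y 0 = dMat p Q := by
  simp [tensorMat, tensorField]

theorem tensorMat_mulVec_monom (hp : (p : Q) = 0) (y : ℕ → Q) (n t : ℕ) (q : Q) :
    tensorMat p y n *ᵥ monom p t q = monom p (t - 1 + n) (t * q) +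
      ∑ r ∈ Finset.range n, n.choose (r + 1) •
        monom p (t + (n - 1 - r)) ((y r + if r = 0 then 1 else 0) * q) := by
  rw [tensorMat, tensorField, add_mulVec, sum_mulVec, ← mulVec_mulVec, dMat_mulVec_monom hp,
    xMat_pow_mulVec_monom]
  congr 1
  refine Finset.sum_congr rfl fun r _ => ?_
  rw [smul_mulVec, ← mulVec_mulVec, coeffMat, scalar_mulVec_monom, xMat_pow_mulVec_monom]

/-- On the top power `x ^ (p - 1)`, the algebra `𝔟⁺` acts through the coefficients. -/
theorem tensorMat_mulVec_monom_top [hp : Fact p.Prime] (hpQ : (p : Q) = 0) (y : ℕ → Q) (r : ℕ) (q : Q) :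
    tensorMat p y (r + 1) *ᵥ monom p (p - 1) q = monom p (p - 1) (y r * q) := by
  have hp2 := hp.out.two_le
  -- On `x ^ (p - 1)` the operator `x ∂` contributes `p - 1 = -1`; the twist by `1` in `coeffMat` is
  -- there to cancel it.
  have hcast : ((p - 1 : ℕ) : Q) = -1 := by
    rw [Nat.cast_sub (by omega), hpQ]
    simp
  rw [tensorMat_mulVec_monom hpQ, Finset.sum_range_succ, Finset.sum_eq_zero, zero_add]
  · rcases r with _ | r
    · simp only [Nat.choose_self, one_smul, if_true]
      rw [show p - 1 - 1 + (0 + 1) = p - 1 by omega, show p - 1 + (0 + 1 - 1 - 0) = p - 1 by omega,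
        ← monom_add, hcast]
      congr 1
      noncomm_ring
    · rw [monom_of_le (by omega), zero_add, if_neg (by omega), add_zero, Nat.choose_self, one_smul]
      congr 1
      omega
  · intro s hs
    have := Finset.mem_range.1 hs
    rw [monom_of_le (by omega), smul_zero]

/-! ### Tensor fields as a restricted representation of `W(1,1)` -/

section Relations

variable [hp : Fact p.Prime] {y : ℕ → Q}

theorem isWittFamily_tensorMat
    (hpQ : (p : Q) = 0) (hy : IsBorelFamily p y) : IsWittFamily p (tensorMat p y) where
  zero n hn := by
    refine tensorField_eq_zero p ?_ xMat_pow_eq_zero (fun r hr => ?_) hn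
    · refine matrix_ext_monom fun t _ => ?_
      rw [← map_natCast (Matrix.scalar (Fin p)), scalar_mulVec_monom, hpQ, zero_mul, monom_zero,
        zero_mulVec]
    · rw [coeffMat, hy.zero r hr, if_neg, add_zero, map_zero]
      have := hp.out.two_le
      omega
  lie n m := by
    refine tensorField_bracket (E := coeffMat p y) (dMat_mul_xMat hpQ) (fun r => commute_dMat_scalar hpQ _)
      (fun r => commute_xMat_scalar _) (fun r s => ?_) n m
    have h1 : ∀ a : Q, ⁅a, (1 : Q)⁆ = 0 := fun a => by
      rw [LieRing.of_associative_ring_bracket, mul_one, one_mul, sub_self]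
    have h2 : ∀ a : Q, ⁅(1 : Q), a⁆ = 0 := fun a => by
      rw [LieRing.of_associative_ring_bracket, mul_one, one_mul, sub_self]
    have h : ⁅y r + (if r = 0 then 1 else 0), y s + (if s = 0 then 1 else 0)⁆
        = ((s : ℤ) - r) • (y (r + s) + if r + s = 0 then 1 else 0) := by
      rw [add_lie, lie_add, lie_add, hy.lie, smul_add]
      have e1 : ⁅y r, if s = 0 then (1 : Q) else 0⁆ = 0 := by split_ifs <;> simp [h1]
      have e2 : ⁅if r = 0 then (1 : Q) else 0, y s⁆ = 0 := by split_ifs <;> simp [h2]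
      have e3 : ⁅if r = 0 then (1 : Q) else 0, if s = 0 then (1 : Q) else 0⁆ = 0 := by
        split_ifs <;> simp
      have e4 : ((s : ℤ) - r) • (if r + s = 0 then (1 : Q) else 0) = 0 := by
        split_ifs with h
        · rw [show (s : ℤ) - r = 0 by omega, zero_smul]
        · rw [smul_zero]
      rw [e1, e2, e3, e4]
      abel
    simp only [coeffMat]
    rw [LieRing.of_associative_ring_bracket, ← map_mul, ← map_mul,
      ← map_sub, ← LieRing.of_associative_ring_bracket, h, map_zsmul]

/-- The fields `x ^ (r + 1) ∂` vanish at the origin, so evaluation at `x = 0` is equivariant for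
`𝔟⁺`, which acts on the value through the twisted coefficients. -/
theorem tensorMat_succ_mulVec_zero (r : ℕ) (u : Fin p → Q) :
    (tensorMat p y (r + 1) *ᵥ u) ⟨0, hp.out.pos⟩
      = (y r + if r = 0 then 1 else 0) * u ⟨0, hp.out.pos⟩ := by
  have hx : ∀ (a : ℕ) (w : Fin p → Q), a ≠ 0 → (xMat p Q ^ a *ᵥ w) ⟨0, hp.out.pos⟩ = 0 := by
    intro a w ha
    obtain ⟨a, rfl⟩ := Nat.exists_eq_succ_of_ne_zero ha
    rw [pow_succ', ← mulVec_mulVec]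
    simp [mulVec, dotProduct, xMat]
  rw [tensorMat, tensorField, add_mulVec, sum_mulVec, ← mulVec_mulVec, Pi.add_apply,
    hx _ _ (by omega), zero_add, Finset.sum_range_succ, Pi.add_apply, Finset.sum_apply,
    Finset.sum_eq_zero, zero_add]
  · rw [Nat.choose_self, one_smul, show r + 1 - 1 - r = 0 by omega, pow_zero, one_mul, coeffMat,
      scalar_apply, mulVec_diagonal]
  · intro s hs
    have := Finset.mem_range.1 hs
    rw [smul_mulVec, ← mulVec_mulVec, Pi.smul_apply, hx _ _ (by omega), smul_zero]

/-- Let `T` be the defect of restrictedness of `x ^ (r + 1) ∂`. It commutes with `d/dx`, by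
`lieHom_pow_bracket` applied to `∂`, and `T u` has zero constant term, by evaluation at the origin.
Applying this to the derivatives of `u` kills every Taylor coefficient of `T u`, since `1, …, p - 1`
are invertible. -/
theorem isRestrictedWitt_tensorMat
    (hpQ : (p : Q) = 0) (hy : IsBorelFamily p y) (k : Type u) [Field k] [CharP k p] [Algebra k Q]
    (hr : IsRestrictedBorel p y) : IsRestrictedWitt p (tensorMat p y) := by
  intro n
  rcases n with _ | r
  · rw [tensorMat_zero, dMat_pow_eq_zero hpQ, if_neg (by omega)]
  have hW := isWittFamily_tensorMat hpQ hy
  have hz : (y r + if r = 0 then 1 else 0) ^ p = if r = 0 then y 0 + 1 else 0 := by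
    split_ifs with h
    · subst h
      rw [add_pow_of_commute_of_cast_eq_zero hpQ (Commute.one_right _), hr, if_pos rfl, one_pow]
    · rw [add_zero, hr, if_neg h]
  set T := tensorMat p y (r + 1) ^ p - if r + 1 = 1 then tensorMat p y 1 else 0 with hT
  have hcomm : T * dMat p Q = dMat p Q * T := by
    have h := lieHom_pow_bracket (hW.lieHom k) (field k p (r + 1)) (field k p 0)
    rw [hW.lieHom_field k, hW.lieHom_field k, pMap_field, ← sub_eq_zero, ← sub_lie] at h
    have h1 : hW.lieHom k (if r + 1 = 1 then field k p 1 else 0)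
        = if r + 1 = 1 then tensorMat p y 1 else 0 := by
      split_ifs
      · rw [hW.lieHom_field k]
      · rw [map_zero]
    rw [h1, ← hT, tensorMat_zero] at h
    exact sub_eq_zero.1 h
  have hT0 : ∀ u, (T *ᵥ u) ⟨0, hp.out.pos⟩ = 0 := by
    have hpow : ∀ (a : ℕ) (u : Fin p → Q), ((tensorMat p y (r + 1) ^ a) *ᵥ u) ⟨0, hp.out.pos⟩
        = (y r + if r = 0 then 1 else 0) ^ a * u ⟨0, hp.out.pos⟩ := by
      intro a
      induction a with
      | zero => simp
      | succ a ih =>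
        intro u
        rw [pow_succ', ← mulVec_mulVec, tensorMat_succ_mulVec_zero, ih, pow_succ', mul_assoc]
    intro u
    rw [hT, sub_mulVec, Pi.sub_apply, hpow, hz]
    by_cases h : r = 0
    · subst h
      rw [if_pos rfl, if_pos (by rfl)]
      have h1 := tensorMat_succ_mulVec_zero (y := y) 0 u
      rw [if_pos rfl] at h1
      rw [h1, sub_self]
    · rw [if_neg h, if_neg (by omega)]
      simp
  have hTi : ∀ (i : ℕ) (hi : i < p) (u : Fin p → Q), (T *ᵥ u) ⟨i, hi⟩ = 0 := by
    intro i
    induction i with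
    | zero => exact fun _ u => hT0 u
    | succ i ih =>
      intro hi u
      have h1 := ih (by omega) (dMat p Q *ᵥ u)
      rw [mulVec_mulVec, hcomm, ← mulVec_mulVec] at h1
      have h2 : ∀ w : Fin p → Q, (dMat p Q *ᵥ w) ⟨i, by omega⟩ = ((i + 1 : ℕ) : Q) * w ⟨i + 1, hi⟩ := by
        intro w
        rw [mulVec, dotProduct, Finset.sum_eq_single ⟨i + 1, hi⟩]
        · simp [dMat]
        · intro j _ hj
          have : i + 1 ≠ j := fun h => hj (Fin.ext h.symm)
          simp [dMat, this]
        · simp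
      rw [h2] at h1
      have h3 : ((i + 1 : ℕ) : k) ≠ 0 := by
        rw [Ne, CharP.cast_eq_zero_iff k p]
        exact fun h => absurd (Nat.le_of_dvd (by omega) h) (by omega)
      rw [← map_natCast (algebraMap k Q), ← Algebra.smul_def] at h1
      exact (smul_eq_zero.1 h1).resolve_left h3
  have hT0 : T = 0 := by
    refine matrix_ext_monom fun t _ => ?_
    funext i
    rw [hTi i i.2, zero_mulVec]
    rfl
  exact sub_eq_zero.1 hT0

end Relations

end TensorModule

/-! ### Bases of the restricted envelopes -/

section PBW

open Matrix

variable (k : Type u) [Field k] (p : ℕ) [hp : Fact p.Prime] [CharP k p]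

theorem natCast_algebra_eq_zero (Q : Type*) [Ring Q] [Algebra k Q] : (p : Q) = 0 := by
  rw [← map_natCast (algebraMap k Q), CharP.cast_eq_zero, map_zero]

/-- The action of `u(𝔤)` on the tensor fields with coefficients in `u(𝔟⁺)`. -/
def regularRep : RestrictedU k p →ₐ[k] Matrix (Fin p) (Fin p) (RestrictedUBorel k p) :=
  (isWittFamily_tensorMat (natCast_algebra_eq_zero k p _) (isBorelFamily_fieldB k)).lift k
    (isRestrictedWitt_tensorMat (natCast_algebra_eq_zero k p _) (isBorelFamily_fieldB k) k
      (isRestrictedBorel_fieldB k))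

theorem regularRep_fieldU (n : ℕ) : regularRep k p (fieldU k p n) = tensorMat p (fieldB k p) n :=
  IsWittFamily.lift_fieldU k _ _ n

variable {k p}

theorem regularRep_borelMap (b q : RestrictedUBorel k p) :
    regularRep k p (borelMap k p b) *ᵥ monom p (p - 1) q = monom p (p - 1) (b * q) := by
  induction b using induction_fieldB generalizing q with
  | halg c =>
    rw [AlgHom.commutes, AlgHom.commutes, Algebra.algebraMap_eq_smul_one, smul_mulVec, one_mulVec,
      ← Algebra.smul_def]
    funext i
    simp only [monom, Pi.smul_apply]
    split_ifs <;> simp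
  | hfield n =>
    rw [borelMap_fieldB, regularRep_fieldU, tensorMat_mulVec_monom_top
      (natCast_algebra_eq_zero k p _)]
  | hmul a b ha hb => rw [map_mul, map_mul, ← mulVec_mulVec, hb, ha, mul_assoc]
  | hadd a b ha hb => rw [map_add, map_add, add_mulVec, ha, hb, add_mul, monom_add]

/-- This is the independence half of the decomposition of `u(𝔤)`: acting on `x ^ (p - 1)` displays
`b` in the coefficient of `x ^ (p - 1 - j)`, up to a scalar that is invertible for `j < p`. -/
theorem regularRep_pow_mul (j : ℕ) (b : RestrictedUBorel k p) :
    regularRep k p (fieldU k p 0 ^ j * borelMap k p b) *ᵥ monom p (p - 1) 1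
      = monom p (p - 1 - j) ((p - 1).descFactorial j * b) := by
  rw [map_mul, map_pow, ← mulVec_mulVec, regularRep_borelMap, mul_one, regularRep_fieldU,
    tensorMat_zero, dMat_pow_mulVec_monom (natCast_algebra_eq_zero k p _)]

variable (k) in
theorem descFactorial_ne_zero (j : ℕ) (hj : j < p) : ((p - 1).descFactorial j : k) ≠ 0 := by
  rw [Ne, CharP.cast_eq_zero_iff k p]
  intro h
  have h1 : p ∣ (p - 1).factorial :=
    h.trans (Dvd.intro_left _ (Nat.factorial_mul_descFactorial (show j ≤ p - 1 by omega)))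
  have h2 := (Nat.Prime.dvd_factorial hp.out).1 h1
  have := hp.out.pos
  omega

theorem fieldU_zero_pow_eq_zero {j : ℕ} (hj : p ≤ j) : fieldU k p 0 ^ j = 0 := by
  refine pow_eq_zero_of_le hj ?_
  rw [isRestrictedWitt_fieldU k 0, if_neg (by omega)]

/-- The span contains `1`, so it suffices that it is a left ideal. A generator `x ^ n ∂` is moved
past `e (-1) ^ j` by induction on `j`, each commutator with `e (-1)` being a multiple of another
generator. -/
theorem pbw_mem_span (a : RestrictedU k p) : a ∈ Submodule.span k
    {a | ∃ (j : ℕ) (b : RestrictedUBorel k p), a = fieldU k p 0 ^ j * borelMap k p b} := by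
  set S := Submodule.span k
    {a | ∃ (j : ℕ) (b : RestrictedUBorel k p), a = fieldU k p 0 ^ j * borelMap k p b} with hS
  have hmem : ∀ j b, fieldU k p 0 ^ j * borelMap k p b ∈ S := fun j b =>
    Submodule.subset_span ⟨j, b, rfl⟩
  have hclosed : ∀ x : RestrictedU k p, (∀ j b, x * (fieldU k p 0 ^ j * borelMap k p b) ∈ S) →
      ∀ s ∈ S, x * s ∈ S := by
    intro x hx s hs
    induction hs using Submodule.span_induction with
    | zero => rw [mul_zero]; exact S.zero_mem
    | mem s hs => obtain ⟨j, b, rfl⟩ := hs; exact hx j b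
    | add s t _ _ hs ht => rw [mul_add]; exact S.add_mem hs ht
    | smul c s _ hs => rw [mul_smul_comm]; exact S.smul_mem c hs
  have h0 : ∀ s ∈ S, fieldU k p 0 * s ∈ S := hclosed _ fun j b => by
    rw [← mul_assoc, ← pow_succ']
    exact hmem _ _
  have hfield : ∀ (j n : ℕ) (b : RestrictedUBorel k p),
      fieldU k p n * (fieldU k p 0 ^ j * borelMap k p b) ∈ S := by
    intro j
    induction j with
    | zero =>
      intro n b
      rw [pow_zero, one_mul]
      rcases n with _ | n
      · have := hmem 1 b
        rwa [pow_one] at this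
      · rw [← borelMap_fieldB, ← map_mul]
        have := hmem 0 (fieldB k p n * b)
        rwa [pow_zero, one_mul] at this
    | succ j ih =>
      intro n b
      have h := (isWittFamily_fieldU (p := p) k).lie n 0
      rw [LieRing.of_associative_ring_bracket, sub_eq_iff_eq_add] at h
      rw [pow_succ', mul_assoc, ← mul_assoc, h, add_mul, smul_mul_assoc, mul_assoc]
      exact S.add_mem (S.toAddSubgroup.zsmul_mem (ih _ b) _) (h0 _ (ih n b))
  have hall : ∀ a : RestrictedU k p, ∀ s ∈ S, a * s ∈ S := by
    intro a
    induction a using induction_fieldU with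
    | halg c => intro s hs; rw [← Algebra.smul_def]; exact S.smul_mem c hs
    | hfield n => exact hclosed _ fun j b => hfield j n b
    | hmul a b ha hb => intro s hs; rw [mul_assoc]; exact ha _ (hb s hs)
    | hadd a b ha hb => intro s hs; rw [add_mul]; exact S.add_mem (ha s hs) (hb s hs)
  have h1 := hall a 1 (by simpa using hmem 0 1)
  rwa [mul_one] at h1

/-- `u(𝔤)` is spanned by the products of a power of `e (-1)` with an element of `u(𝔟⁺)`. -/
theorem induction_pbw {P : RestrictedU k p → Prop}
    (h : ∀ j < p, ∀ b, P (fieldU k p 0 ^ j * borelMap k p b))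
    (hadd : ∀ a b, P a → P b → P (a + b)) (a : RestrictedU k p) : P a := by
  have h0 : P 0 := by
    have := h 0 hp.out.pos 0
    rwa [map_zero, mul_zero] at this
  have hs : ∀ a (c : k), P (c • a) := by
    intro a
    have ha := pbw_mem_span a
    induction ha using Submodule.span_induction with
    | zero => intro c; rwa [smul_zero]
    | mem s hs =>
      obtain ⟨j, b, rfl⟩ := hs
      intro c
      rw [← mul_smul_comm, ← map_smul]
      by_cases hj : j < p
      · exact h j hj _
      · rwa [fieldU_zero_pow_eq_zero (not_lt.1 hj), zero_mul]
    | add s t _ _ hs ht => intro c; rw [smul_add]; exact hadd _ _ (hs c) (ht c)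
    | smul d s _ hs => intro c; rw [smul_smul]; exact hs _
  simpa using hs a 1

/-- The linear map on `u(𝔤)` with `e (-1) ^ j * b ↦ e (-1) ^ j • f b` for `j < p` and
`b ∈ u(𝔟⁺)`. -/
def pbwExtend {M : Type*} [AddCommGroup M] [Module k M] [Module (RestrictedU k p) M]
    [IsScalarTower k (RestrictedU k p) M] (f : RestrictedUBorel k p →ₗ[k] M) :
    RestrictedU k p →ₗ[k] M where
  -- The coefficient of `x ^ i` in `a • x ^ (p - 1)` records the `e (-1) ^ (p - 1 - i)` part of `a`;
  -- the inverse removes the scalar of `regularRep_pow_mul`.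
  toFun a := ∑ i : Fin p, ((p - 1).descFactorial (p - 1 - i) : k)⁻¹ •
    (fieldU k p 0 ^ (p - 1 - i) • f ((regularRep k p a *ᵥ monom p (p - 1) 1) i))
  map_add' a b := by
    simp only [map_add, add_mulVec, Pi.add_apply, smul_add, Finset.sum_add_distrib]
  map_smul' c a := by
    simp only [map_smul, smul_mulVec, Pi.smul_apply, Finset.smul_sum, RingHom.id_apply]
    refine Finset.sum_congr rfl fun i _ => ?_
    rw [smul_comm c, ← algebraMap_smul (RestrictedU k p) c (f _),
      ← algebraMap_smul (RestrictedU k p) c (fieldU k p 0 ^ _ • _), smul_smul, smul_smul,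
      Algebra.commutes]

theorem pbwExtend_apply {M : Type*} [AddCommGroup M] [Module k M] [Module (RestrictedU k p) M]
    [IsScalarTower k (RestrictedU k p) M] (f : RestrictedUBorel k p →ₗ[k] M) {j : ℕ} (hj : j < p)
    (b : RestrictedUBorel k p) :
    pbwExtend f (fieldU k p 0 ^ j * borelMap k p b) = fieldU k p 0 ^ j • f b := by
  change ∑ i : Fin p, _ = _
  have hj' : p - 1 - j < p := by have := hp.out.pos; omega
  simp only [regularRep_pow_mul]
  rw [Finset.sum_eq_single ⟨p - 1 - j, hj'⟩]
  · simp only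
    rw [show p - 1 - (p - 1 - j) = j by omega, monom, if_pos rfl,
      ← map_natCast (algebraMap k (RestrictedUBorel k p)), ← Algebra.smul_def, map_smul,
      ← algebraMap_smul (RestrictedU k p) _ (f b), smul_smul, ← Algebra.commutes, ← smul_smul,
      algebraMap_smul, inv_smul_smul₀ (descFactorial_ne_zero k j hj)]
  · intro i _ hi
    rw [monom, if_neg (fun h => hi (Fin.ext h)), map_zero, smul_zero, smul_zero]
  · simp

end PBW

/-! ### The Verma modules in coordinates -/

section VermaModel

open Matrix TensorProduct

variable (k : Type u) [Field k] {p : ℕ} [hp : Fact p.Prime] [CharP k p]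

/-- The image in `k` of a weight in `𝔽_p`. -/
abbrev wt (lam : ZMod p) : k := ZMod.castHom (dvd_refl p) k lam

/-- The character of `𝔟⁺` of weight `lam`, as a family of scalars. -/
def weightFamily (lam : ZMod p) (r : ℕ) : k := if r = 0 then wt k lam else 0

theorem isBorelFamily_weightFamily (lam : ZMod p) : IsBorelFamily p (weightFamily k lam) where
  zero r hr := if_neg (by have := hp.out.two_le; omega)
  lie r s := by
    rw [LieRing.of_associative_ring_bracket, mul_comm, sub_self, weightFamily]
    split_ifs with h
    · rw [show (s : ℤ) - r = 0 by omega, zero_smul]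
    · rw [smul_zero]

theorem isRestrictedBorel_weightFamily (lam : ZMod p) :
    IsRestrictedBorel p (weightFamily k lam) := by
  intro r
  simp only [weightFamily, if_true]
  split_ifs
  · rw [← map_pow, ZMod.pow_card]
  · rw [zero_pow hp.out.ne_zero]

/-- The action of `u(𝔤)` on `k[x]/(x ^ p)` with highest weight `lam`. -/
def vermaRep (lam : ZMod p) : RestrictedU k p →ₐ[k] Matrix (Fin p) (Fin p) k :=
  (isWittFamily_tensorMat (natCast_algebra_eq_zero k p _) (isBorelFamily_weightFamily k lam)).lift k
    (isRestrictedWitt_tensorMat (natCast_algebra_eq_zero k p _) (isBorelFamily_weightFamily k lam) k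
      (isRestrictedBorel_weightFamily k lam))

/-- The module `k[x]/(x ^ p)` on which `x ^ n ∂` acts as `x ^ n ∂ + (lam + 1) n x ^ (n - 1)`. -/
def VermaModel (_lam : ZMod p) : Type u := Fin p → k

variable (lam : ZMod p)

instance : AddCommGroup (VermaModel k lam) := inferInstanceAs (AddCommGroup (Fin p → k))

instance : Module k (VermaModel k lam) := inferInstanceAs (Module k (Fin p → k))

instance : Module (RestrictedU k p) (VermaModel k lam) :=
  (Module.compHom (Fin p → k)
    ((Matrix.toLinAlgEquiv' (R := k) (n := Fin p)).toAlgHom.comp (vermaRep k lam)).toRingHom :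
    Module (RestrictedU k p) (Fin p → k))

theorem smul_vermaModel (a : RestrictedU k p) (u : VermaModel k lam) :
    a • u = (vermaRep k lam a *ᵥ (u : Fin p → k) : Fin p → k) := rfl

instance : IsScalarTower k (RestrictedU k p) (VermaModel k lam) where
  smul_assoc c a u := by
    rw [smul_vermaModel, map_smul]
    exact smul_mulVec c (vermaRep k lam a) u

/-- The vector `x ^ t` times a scalar. -/
def vmon (t : ℕ) (q : k) : VermaModel k lam := monom p t q

theorem vmon_smul (t : ℕ) (c q : k) : c • vmon k lam t q = vmon k lam t (c * q) := by
  funext i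
  change c * monom p t q i = monom p t (c * q) i
  simp only [monom]
  split_ifs <;> simp

theorem vmon_zero (t : ℕ) : vmon k lam t 0 = 0 := monom_zero t

theorem vmon_of_le {t : ℕ} (ht : p ≤ t) (q : k) : vmon k lam t q = 0 := monom_of_le ht q

/-- The weight character kills `e r` for `r > 0`, so only the term `r = 0` of `tensorField` remains:
the action on densities of weight `lam + 1`. For `t = n = 0` the truncated exponent is harmless, as
the coefficient is zero. -/
theorem fieldU_smul_vmon (n t : ℕ) (q : k) : fieldU k p n • vmon k lam t q =
    vmon k lam (t + n - 1) ((t + (wt k lam + 1) * n) * q) := by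
  rw [smul_vermaModel, vermaRep, IsWittFamily.lift_fieldU, vmon,
    tensorMat_mulVec_monom (natCast_algebra_eq_zero k p _), vmon, add_mul, monom_add]
  congr 1
  · rcases t with _ | t
    · simp [monom_zero]
    · rw [show t + 1 - 1 + n = t + 1 + n - 1 by omega]
  · rcases n with _ | n
    · simp [monom_zero]
    · rw [Finset.sum_range_succ', Finset.sum_eq_zero, zero_add]
      · rw [zero_add, Nat.choose_one_right, weightFamily, if_pos rfl, if_pos rfl]
        funext i
        simp only [monom, Pi.smul_apply, nsmul_eq_mul]
        rw [show t + (n + 1 - 1 - 0) = t + (n + 1) - 1 by omega]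
        split_ifs
        · ring
        · rw [mul_zero]
      · intro r _
        rw [weightFamily, if_neg (by omega), if_neg (by omega), add_zero, zero_mul, monom_zero,
          smul_zero]

theorem fieldU_zero_pow_smul_top (j : ℕ) (q : k) : fieldU k p 0 ^ j • vmon k lam (p - 1) q =
    vmon k lam (p - 1 - j) ((p - 1).descFactorial j * q) := by
  rw [smul_vermaModel, map_pow, vermaRep, IsWittFamily.lift_fieldU, tensorMat_zero, vmon,
    dMat_pow_mulVec_monom (natCast_algebra_eq_zero k p _), vmon]

theorem borelMap_smul_top (b : RestrictedUBorel k p) (q : k) :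
    borelMap k p b • vmon k lam (p - 1) q = vmon k lam (p - 1) (weightCharacter k lam b * q) := by
  induction b using induction_fieldB generalizing q with
  | halg c => rw [AlgHom.commutes, AlgHom.commutes, algebraMap_smul, vmon_smul]; rfl
  | hfield n =>
    rw [borelMap_fieldB, smul_vermaModel, vermaRep, IsWittFamily.lift_fieldU, vmon,
      tensorMat_mulVec_monom_top (natCast_algebra_eq_zero k p _), weightCharacter_fieldB]
    rfl
  | hmul a b ha hb => rw [map_mul, map_mul, mul_smul, hb, ha, mul_assoc]
  | hadd a b ha hb =>
    rw [map_add, map_add, add_smul, ha, hb, add_mul]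
    exact (monom_add _ _ _).symm

/-- The surjection `u(𝔤) ⊗ k → k[x]/(x ^ p)` sending `1 ⊗ 1` to `x ^ (p - 1)`. -/
def vermaCover : RestrictedU k p ⊗[k] k →ₗ[RestrictedU k p] VermaModel k lam :=
  LinearMap.toSpanSingleton _ _ (vmon k lam (p - 1) 1) ∘ₗ
    (AlgebraTensorModule.rid k (RestrictedU k p) (RestrictedU k p)).toLinearMap

theorem vermaCover_tmul (a : RestrictedU k p) (t : k) :
    vermaCover k lam (a ⊗ₜ t) = a • vmon k lam (p - 1) t := by
  rw [vermaCover, LinearMap.comp_apply, LinearEquiv.coe_coe, AlgebraTensorModule.rid_tmul,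
    LinearMap.toSpanSingleton_apply, smul_assoc, ← algebraMap_smul (RestrictedU k p) t, smul_smul,
    Algebra.commutes, ← smul_smul, algebraMap_smul, vmon_smul, mul_one]

/-- The relations of the Verma module of weight `lam`. -/
abbrev vermaRel : Submodule (RestrictedU k p) (RestrictedU k p ⊗[k] k) :=
  balancedRel (borelMap k p) k ((Algebra.lmul k k).comp (weightCharacter k lam))

theorem vermaRel_le_ker : vermaRel k lam ≤ LinearMap.ker (vermaCover k lam) := by
  refine Submodule.span_le.2 ?_
  rintro _ ⟨a, b, v, rfl⟩
  rw [SetLike.mem_coe, LinearMap.mem_ker, map_sub, vermaCover_tmul, vermaCover_tmul, mul_smul,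
    borelMap_smul_top]
  exact sub_self _

theorem mk_mul_borelMap_tmul (a : RestrictedU k p) (b : RestrictedUBorel k p) (t : k) :
    (vermaRel k lam).mkQ ((a * borelMap k p b) ⊗ₜ t)
      = (vermaRel k lam).mkQ (a ⊗ₜ (weightCharacter k lam b * t)) := by
  rw [← sub_eq_zero, ← map_sub, Submodule.mkQ_apply, Submodule.Quotient.mk_eq_zero]
  exact Submodule.subset_span ⟨a, b, t, rfl⟩

/-- The candidate for the inverse of the surjection `Z⁺(lam) → k[x]/(x ^ p)`. -/
def vermaSection (u : VermaModel k lam) : Verma k lam :=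
  (vermaRel k lam).mkQ (∑ i : Fin p, (fieldU k p 0 ^ (p - 1 - i)) ⊗ₜ[k]
    (((p - 1).descFactorial (p - 1 - i) : k)⁻¹ * (u : Fin p → k) i))

/-- This gives the injectivity of `Z⁺(lam) → k[x]/(x ^ p)` without a dimension count: modulo the
relations, `e (-1) ^ j b ⊗ t` depends only on its image in the model. -/
theorem vermaSection_vermaCover (z : RestrictedU k p ⊗[k] k) :
    vermaSection k lam (vermaCover k lam z) = (vermaRel k lam).mkQ z := by
  have hadd : ∀ u v : VermaModel k lam,
      vermaSection k lam (u + v) = vermaSection k lam u + vermaSection k lam v := by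
    intro u v
    rw [vermaSection, vermaSection, vermaSection, ← map_add, ← Finset.sum_add_distrib]
    congr 1
    refine Finset.sum_congr rfl fun i _ => ?_
    rw [← tmul_add, ← mul_add]
    rfl
  induction z with
  | zero =>
    have h := hadd 0 0
    rw [add_zero, left_eq_add] at h
    rw [map_zero, map_zero, h]
  | add x y hx hy => rw [map_add, hadd, hx, hy, map_add]
  | tmul a t =>
    induction a using induction_pbw with
    | hadd a b ha hb => rw [add_tmul, map_add, hadd, ha, hb, map_add]
    | h j hj b =>
      rw [mk_mul_borelMap_tmul, vermaCover_tmul, mul_smul, borelMap_smul_top,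
        fieldU_zero_pow_smul_top, vermaSection]
      congr 1
      have hj' : p - 1 - j < p := by omega
      rw [Finset.sum_eq_single ⟨p - 1 - j, hj'⟩]
      · rw [vmon, monom, if_pos rfl]
        simp only
        rw [show p - 1 - (p - 1 - j) = j by omega,
          inv_mul_cancel_left₀ (descFactorial_ne_zero k j hj)]
      · intro i _ hi
        rw [vmon, monom, if_neg (fun h => hi (Fin.ext h)), mul_zero, tmul_zero]
      · simp

/-- The Verma module `Z⁺(lam)` is the module `k[x]/(x ^ p)` of tensor densities. -/
def vermaEquiv : Verma k lam ≃ₗ[RestrictedU k p] VermaModel k lam :=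
  LinearEquiv.ofBijective ((vermaRel k lam).liftQ (vermaCover k lam) (vermaRel_le_ker k lam)) (by
    constructor
    · refine (injective_iff_map_eq_zero _).2 fun z hz => ?_
      obtain ⟨z, rfl⟩ := (vermaRel k lam).mkQ_surjective z
      have h : vermaCover k lam z = 0 := hz
      rw [← vermaSection_vermaCover, h, ← map_zero (vermaCover k lam), vermaSection_vermaCover,
        map_zero]
    · intro u
      refine ⟨(vermaRel k lam).mkQ (∑ i : Fin p, (fieldU k p 0 ^ (p - 1 - i)) ⊗ₜ[k]
        (((p - 1).descFactorial (p - 1 - i) : k)⁻¹ * (u : Fin p → k) i)), ?_⟩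
      change vermaCover k lam _ = u
      rw [map_sum]
      refine Eq.trans ?_ (sum_monom (u : Fin p → k))
      refine Finset.sum_congr rfl fun i _ => ?_
      rw [vermaCover_tmul, fieldU_zero_pow_smul_top, mul_inv_cancel_left₀
        (descFactorial_ne_zero k _ (by omega)), show p - 1 - (p - 1 - (i : ℕ)) = i by omega]
      rfl)

end VermaModel

/-! ### Cocycles and homomorphisms -/

section Cocycles

open Matrix TensorProduct

variable {k : Type u} [Field k] {p : ℕ} [hp : Fact p.Prime] [CharP k p] {mu : ZMod p}
  {M : Type u} [AddCommGroup M] [Module k M] [Module (RestrictedU k p) M]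
  [IsScalarTower k (RestrictedU k p) M]

instance : Module.Projective (RestrictedU k p) (RestrictedU k p ⊗[k] k) :=
  Module.Projective.of_equiv (AlgebraTensorModule.rid k (RestrictedU k p) (RestrictedU k p)).symm

theorem smul_comm_restrictedU (c : k) (a : RestrictedU k p) (m : M) : a • c • m = c • a • m := by
  rw [← algebraMap_smul (RestrictedU k p) c m, ← algebraMap_smul (RestrictedU k p) c (a • m),
    smul_smul, smul_smul, Algebra.commutes]

variable (mu) in
/-- The generator `b ⊗ 1 - 1 ⊗ b` of the relations of the Verma module. -/
def relGen (b : RestrictedUBorel k p) : vermaRel k mu :=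
  ⟨borelMap k p b ⊗ₜ 1 - 1 ⊗ₜ weightCharacter k mu b, by
    refine Submodule.subset_span ⟨1, b, 1, ?_⟩
    rw [one_mul]
    simp⟩

theorem coe_relGen (b : RestrictedUBorel k p) : (relGen mu b : RestrictedU k p ⊗[k] k) =
    borelMap k p b ⊗ₜ 1 - 1 ⊗ₜ weightCharacter k mu b := rfl

variable (mu) in
/-- A cocycle of `u(𝔟⁺)` with values in `Hom(k_mu, M)`. -/
def IsBorelCocycle (φ : RestrictedUBorel k p →ₗ[k] M) : Prop :=
  ∀ a b, φ (a * b) = borelMap k p a • φ b + weightCharacter k mu b • φ a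

theorem tmul_eq_smul (a : RestrictedU k p) (t : k) : a ⊗ₜ[k] t = t • (a ⊗ₜ[k] (1 : k)) := by
  rw [← tmul_smul, smul_eq_mul, mul_one]

/-- The cocycle of a homomorphism on the relations of the Verma module. -/
def cocycleOf (f : vermaRel k mu →ₗ[RestrictedU k p] M) : RestrictedUBorel k p →ₗ[k] M where
  toFun b := f (relGen mu b)
  map_add' a b := by
    rw [← map_add]
    congr 1
    apply Subtype.ext
    rw [Submodule.coe_add, coe_relGen, coe_relGen, coe_relGen, map_add, map_add, add_tmul, tmul_add]
    abel
  map_smul' c a := by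
    rw [RingHom.id_apply, ← algebraMap_smul (RestrictedU k p) c (f _), ← map_smul]
    congr 1
    apply Subtype.ext
    rw [Submodule.coe_smul, coe_relGen, coe_relGen, map_smul, map_smul, algebraMap_smul, smul_sub,
      smul_tmul', tmul_smul]

theorem cocycleOf_apply (f : vermaRel k mu →ₗ[RestrictedU k p] M) (b : RestrictedUBorel k p) :
    cocycleOf f b = f (relGen mu b) := rfl

theorem isBorelCocycle_cocycleOf (f : vermaRel k mu →ₗ[RestrictedU k p] M) :
    IsBorelCocycle mu (cocycleOf f) := by
  intro a b
  rw [cocycleOf_apply, cocycleOf_apply, cocycleOf_apply, ← map_smul,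
    ← algebraMap_smul (RestrictedU k p) (weightCharacter k mu b), ← map_smul, ← map_add]
  congr 1
  apply Subtype.ext
  rw [Submodule.coe_add, Submodule.coe_smul, Submodule.coe_smul, coe_relGen, coe_relGen, coe_relGen,
    map_mul, map_mul, algebraMap_smul, smul_sub, smul_sub, smul_tmul', smul_tmul', smul_eq_mul,
    smul_eq_mul, mul_one, tmul_eq_smul (borelMap k p a) (weightCharacter k mu b), ← tmul_smul,
    ← tmul_smul (weightCharacter k mu b) (1 : RestrictedU k p)]
  simp only [smul_eq_mul, mul_comm (weightCharacter k mu b)]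
  abel

/-- The relation attached to `(a, b, v)` is `v a` times `relGen mu b`, so these elements generate
the relations over `u(𝔤)`. -/
theorem hom_eq_of_relGen {f g : vermaRel k mu →ₗ[RestrictedU k p] M}
    (h : ∀ b, f (relGen mu b) = g (relGen mu b)) : f = g := by
  ext x
  obtain ⟨x, hx⟩ := x
  have hx' := hx
  induction hx using Submodule.span_induction with
  | zero => exact (map_zero f).trans (map_zero g).symm
  | mem x hx =>
    obtain ⟨a, b, v, rfl⟩ := hx
    have e : (⟨_, hx'⟩ : vermaRel k mu) = (algebraMap k (RestrictedU k p) v * a) • relGen mu b := by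
      apply Subtype.ext
      rw [Submodule.coe_smul, coe_relGen, mul_smul, algebraMap_smul, smul_sub, smul_tmul' a,
        smul_tmul' a, smul_eq_mul, smul_eq_mul, mul_one, smul_sub, ← tmul_smul v, ← tmul_smul v,
        smul_eq_mul, smul_eq_mul, mul_one, mul_comm v]
      rfl
    rw [e, map_smul, map_smul, h]
  | add x y hx1 hy1 hx hy =>
    have e : (⟨x + y, hx'⟩ : vermaRel k mu) = ⟨x, hx1⟩ + ⟨y, hy1⟩ := rfl
    rw [e, map_add, map_add, hx hx1, hy hy1]
  | smul a x hx1 hx =>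
    have e : (⟨a • x, hx'⟩ : vermaRel k mu) = a • ⟨x, hx1⟩ := rfl
    rw [e, map_smul, map_smul, hx hx1]

theorem IsBorelCocycle.apply_one {φ : RestrictedUBorel k p →ₗ[k] M} (hφ : IsBorelCocycle mu φ) :
    φ 1 = 0 := by
  have h := hφ 1 1
  rw [mul_one, map_one (borelMap k p), map_one (weightCharacter k mu), one_smul, one_smul,
    left_eq_add] at h
  exact h

theorem IsBorelCocycle.ext_fieldB {φ ψ : RestrictedUBorel k p →ₗ[k] M} (hφ : IsBorelCocycle mu φ)
    (hψ : IsBorelCocycle mu ψ) (h : ∀ r, φ (fieldB k p r) = ψ (fieldB k p r)) : φ = ψ := by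
  ext b
  induction b using induction_fieldB with
  | halg c =>
    rw [Algebra.algebraMap_eq_smul_one, map_smul, map_smul, hφ.apply_one, hψ.apply_one]
  | hfield n => exact h n
  | hmul a b ha hb => rw [hφ, hψ, ha, hb]
  | hadd a b ha hb => rw [map_add, map_add, ha, hb]

/-- The formula computes `pbwExtend φ` on a relation `a b ⊗ 1 - a ⊗ χ_mu(b)` as `a • φ b`, the value
forced by `u(𝔤)`-linearity. -/
theorem IsBorelCocycle.pbwExtend_mul {φ : RestrictedUBorel k p →ₗ[k] M}
    (hφ : IsBorelCocycle mu φ) (a : RestrictedU k p) (b : RestrictedUBorel k p) :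
    pbwExtend φ (a * borelMap k p b) = a • φ b + weightCharacter k mu b • pbwExtend φ a := by
  induction a using induction_pbw with
  | h j hj β =>
    rw [mul_assoc, ← map_mul, pbwExtend_apply φ hj, pbwExtend_apply φ hj, hφ, smul_add, smul_smul,
      smul_comm_restrictedU]
  | hadd a a' ha ha' => rw [add_mul, map_add, ha, ha', add_smul, map_add, smul_add]; abel

/-- Every cocycle of `u(𝔟⁺)` comes from a homomorphism on the relations of the Verma module. -/
theorem IsBorelCocycle.exists_hom {φ : RestrictedUBorel k p →ₗ[k] M} (hφ : IsBorelCocycle mu φ) :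
    ∃ f : vermaRel k mu →ₗ[RestrictedU k p] M, cocycleOf f = φ := by
  -- `F` is `k`-linear on all of `u(𝔤) ⊗ k`; only its restriction to the relations has to be
  -- `u(𝔤)`-linear.
  let F : RestrictedU k p ⊗[k] k →ₗ[k] M := pbwExtend φ ∘ₗ
    ((AlgebraTensorModule.rid k (RestrictedU k p) (RestrictedU k p)).toLinearMap.restrictScalars k)
  have hF : ∀ a t, F (a ⊗ₜ t) = t • pbwExtend φ a := by
    intro a t
    change pbwExtend φ (AlgebraTensorModule.rid k _ _ (a ⊗ₜ t)) = _
    rw [AlgebraTensorModule.rid_tmul, map_smul]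
  have hrel : ∀ a b v, F ((a * borelMap k p b) ⊗ₜ v - a ⊗ₜ (weightCharacter k mu b * v))
      = v • a • φ b := by
    intro a b v
    rw [map_sub, hF, hF, hφ.pbwExtend_mul, smul_add, mul_comm, mul_smul, add_sub_cancel_right]
  have hlin : ∀ x ∈ vermaRel k mu, ∀ a : RestrictedU k p, F (a • x) = a • F x := by
    intro x hx
    induction hx using Submodule.span_induction with
    | zero => intro a; rw [smul_zero, map_zero, smul_zero]
    | mem x hx =>
      obtain ⟨a, b, v, rfl⟩ := hx
      intro a'
      change F (a' • ((a * borelMap k p b) ⊗ₜ v - a ⊗ₜ (weightCharacter k mu b * v)))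
        = a' • F ((a * borelMap k p b) ⊗ₜ v - a ⊗ₜ (weightCharacter k mu b * v))
      rw [smul_sub, smul_tmul', smul_tmul', smul_eq_mul, smul_eq_mul, ← mul_assoc, hrel, hrel,
        smul_comm_restrictedU, smul_smul a' a]
    | add x y _ _ hx hy => intro a; rw [smul_add, map_add, map_add, hx, hy, smul_add]
    | smul a x _ hx => intro a'; rw [smul_smul, hx, hx, smul_smul]
  refine ⟨{ toFun := fun x => F x
            map_add' := fun x y => map_add F _ _
            map_smul' := fun a x => hlin x x.2 a }, ?_⟩
  ext b
  change F (relGen mu b) = φ b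
  have h := hrel 1 b 1
  rw [one_mul, mul_one, one_smul, one_smul] at h
  exact h

theorem IsBorelCocycle.bracket {φ : RestrictedUBorel k p →ₗ[k] M} (hφ : IsBorelCocycle mu φ)
    {i j : ℕ} (hi : i ≠ 0) (hj : j ≠ 0) :
    fieldU k p (i + 1) • φ (fieldB k p j) - fieldU k p (j + 1) • φ (fieldB k p i)
      = ((j : k) - i) • φ (fieldB k p (i + j)) := by
  have h := congrArg φ ((isBorelFamily_fieldB (p := p) k).lie i j)
  rw [LieRing.of_associative_ring_bracket, map_sub, hφ, hφ, weightCharacter_fieldB, if_neg hj,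
    weightCharacter_fieldB, if_neg hi, zero_smul, zero_smul, add_zero, add_zero, borelMap_fieldB,
    borelMap_fieldB, map_zsmul, ← Int.cast_smul_eq_zsmul k] at h
  rw [h]
  push_cast
  rfl

theorem IsBorelCocycle.bracket_zero {φ : RestrictedUBorel k p →ₗ[k] M} (hφ : IsBorelCocycle mu φ)
    {j : ℕ} (hj : j ≠ 0) :
    fieldU k p 1 • φ (fieldB k p j) - fieldU k p (j + 1) • φ (fieldB k p 0)
      = (wt k mu + j) • φ (fieldB k p j) := by
  have h := congrArg φ ((isBorelFamily_fieldB (p := p) k).lie 0 j)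
  rw [LieRing.of_associative_ring_bracket, map_sub, hφ, hφ, weightCharacter_fieldB, if_neg hj,
    weightCharacter_fieldB, if_pos rfl, zero_smul, add_zero, borelMap_fieldB,
    borelMap_fieldB, map_zsmul, ← Int.cast_smul_eq_zsmul k, zero_add j] at h
  push_cast at h
  rw [sub_zero] at h
  rw [add_smul, ← h]
  abel

/-- Through this formula the relations `e 0 ^ p = e 0` and `e 1 ^ p = 0` become conditions on `φ (e
0)` and `φ (e 1)`. -/
theorem IsBorelCocycle.pow {φ : RestrictedUBorel k p →ₗ[k] M} (hφ : IsBorelCocycle mu φ)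
    (b : RestrictedUBorel k p) (n : ℕ) :
    φ (b ^ n) = ∑ i ∈ Finset.range n, weightCharacter k mu b ^ (n - 1 - i) • borelMap k p b ^ i • φ b := by
  induction n with
  | zero => simp [hφ.apply_one]
  | succ n ih =>
    rw [pow_succ, hφ, ih, Finset.sum_range_succ, add_comm, Finset.smul_sum, map_pow]
    congr 1
    · refine Finset.sum_congr rfl fun i hi => ?_
      have := Finset.mem_range.1 hi
      rw [smul_smul, ← pow_succ']
      congr 2
      omega
    · rw [show n + 1 - 1 - n = 0 by omega, pow_zero, one_smul]

/-- A cocycle vanishes if it vanishes on `e 0`, `e 1` and `e 2`. -/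
theorem IsBorelCocycle.eq_zero {φ : RestrictedUBorel k p →ₗ[k] M} (hφ : IsBorelCocycle mu φ)
    (h0 : φ (fieldB k p 0) = 0) (h1 : φ (fieldB k p 1) = 0) (h2 : φ (fieldB k p 2) = 0) : φ = 0 := by
  refine hφ.ext_fieldB (ψ := 0) (fun a b => by simp) fun r => ?_
  rw [LinearMap.zero_apply]
  induction r with
  | zero => exact h0
  | succ r ih =>
    rcases r with _ | _ | r
    · exact h1
    · exact h2
    by_cases hr : p ≤ r + 2 + 2
    · rw [(isBorelFamily_fieldB (p := p) k).zero _ hr, map_zero]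
    -- `e 1` and `e 2` generate the nilradical: `[e 1, e (r + 2)] = (r + 1) e (r + 3)` with an
    -- invertible coefficient.
    · have h := hφ.bracket (i := 1) (j := r + 2) one_ne_zero (by omega)
      rw [ih, h1, smul_zero, smul_zero, sub_zero] at h
      have h3 : ((r + 2 : ℕ) : k) - (1 : ℕ) ≠ 0 := by
        rw [← Nat.cast_sub (by omega), Ne, CharP.cast_eq_zero_iff k p]
        exact fun h => absurd (Nat.le_of_dvd (by omega) h) (by omega)
      have h4 := (smul_eq_zero.1 h.symm).resolve_left h3
      rwa [add_comm 1] at h4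

end Cocycles

/-! ### Existence of cocycles -/

section TriangularRep

variable {k : Type u} [Field k] {p : ℕ} [hp : Fact p.Prime] [CharP k p] {mu : ZMod p}
  {M : Type u} [AddCommGroup M] [Module k M] [Module (RestrictedU k p) M]
  [IsScalarTower k (RestrictedU k p) M]

/-- The values of a restricted cocycle of `𝔟⁺` with coefficients in `Hom(k_mu, M)` on the basis
vectors `e r`, normalized to vanish on `e 0`. -/
structure IsNormalizedCocycle (mu : ZMod p) (m : ℕ → M) : Prop where
  zero : ∀ r, p ≤ r + 1 → m r = 0
  at_zero : m 0 = 0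
  weight : ∀ s, s ≠ 0 → fieldU k p 1 • m s = (wt k mu + s) • m s
  lie : ∀ i j, i ≠ 0 → j ≠ 0 →
    fieldU k p (i + 1) • m j - fieldU k p (j + 1) • m i = ((j : k) - i) • m (i + j)
  pow : ∀ r, r ≠ 0 → fieldU k p (r + 1) ^ (p - 1) • m r = 0

variable (mu) in
/-- The action of `e r` on the extension `M × k` of `k_mu` by `M` given by a cocycle. -/
def extensionOp (m : ℕ → M) (r : ℕ) : Module.End k (M × k) where
  toFun x := (fieldU k p (r + 1) • x.1 + x.2 • m r, weightFamily k mu r * x.2)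
  map_add' x y := by
    ext
    · simp only [Prod.fst_add, Prod.snd_add, smul_add, add_smul]
      abel
    · simp only [Prod.snd_add, mul_add]
  map_smul' c x := by
    ext
    · simp only [Prod.smul_fst, Prod.smul_snd, RingHom.id_apply, smul_add, smul_comm_restrictedU,
        smul_eq_mul, mul_smul]
    · simp only [Prod.smul_snd, RingHom.id_apply, smul_eq_mul]
      ring

theorem extensionOp_apply (m : ℕ → M) (r : ℕ) (v : M) (t : k) : extensionOp mu m r (v, t) =
    (fieldU k p (r + 1) • v + t • m r, weightFamily k mu r * t) := rfl

variable {m : ℕ → M}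

theorem isBorelFamily_extensionOp
    (hm : IsNormalizedCocycle (k := k) mu m) : IsBorelFamily p (extensionOp (k := k) mu m) where
  zero r hr := by
    refine LinearMap.ext fun ⟨v, t⟩ => ?_
    rw [extensionOp_apply, (isWittFamily_fieldU (p := p) k).zero _ hr, hm.zero r hr, zero_smul,
      smul_zero, add_zero, (isBorelFamily_weightFamily k mu).zero r hr, zero_mul]
    rfl
  lie r s := by
    refine LinearMap.ext fun ⟨v, t⟩ => ?_
    have hX := (isWittFamily_fieldU (p := p) k).lie (r + 1) (s + 1)
    rw [show r + 1 + (s + 1) - 1 = r + s + 1 by omega] at hX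
    push_cast at hX
    rw [add_sub_add_right_eq_sub, LieRing.of_associative_ring_bracket] at hX
    have hχ := (isBorelFamily_weightFamily k mu).lie r s
    rw [LieRing.of_associative_ring_bracket, mul_comm, sub_self] at hχ
    have hm' : fieldU k p (r + 1) • m s + weightFamily k mu s • m r
        - (fieldU k p (s + 1) • m r + weightFamily k mu r • m s) = ((s : ℤ) - r) • m (r + s) := by
      rw [← Int.cast_smul_eq_zsmul k]
      push_cast
      by_cases hr : r = 0
      · subst hr
        by_cases hs : s = 0
        · subst hs
          simp
        · rw [hm.at_zero, zero_add 1, zero_add s, hm.weight s hs, weightFamily, weightFamily,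
            if_pos rfl, if_neg hs]
          simp [add_smul]
      · by_cases hs : s = 0
        · subst hs
          rw [hm.at_zero, zero_add 1, hm.weight r hr, weightFamily, weightFamily, if_pos rfl,
            if_neg hr]
          simp [add_smul]
        · rw [← hm.lie r s hr hs, weightFamily, weightFamily, if_neg hr, if_neg hs]
          simp
    rw [LieRing.of_associative_ring_bracket, LinearMap.sub_apply, Module.End.mul_apply,
      Module.End.mul_apply, LinearMap.smul_apply, extensionOp_apply, extensionOp_apply,
      extensionOp_apply, extensionOp_apply, extensionOp_apply]
    ext
    · simp only [Prod.fst_sub, Prod.smul_fst, smul_add]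
      have hv : ((s : ℤ) - r) • fieldU k p (r + s + 1) • v
          = fieldU k p (r + 1) • fieldU k p (s + 1) • v
            - fieldU k p (s + 1) • fieldU k p (r + 1) • v := by
        rw [← smul_assoc ((s : ℤ) - r), ← hX, sub_smul, mul_smul, mul_smul]
      rw [hv, smul_comm ((s : ℤ) - r) t, ← hm',
        smul_comm_restrictedU, smul_comm_restrictedU, mul_comm _ t, mul_comm _ t, mul_smul, mul_smul,
        smul_sub, smul_add, smul_add]
      abel
    · simp only [Prod.snd_sub, Prod.smul_snd]
      rw [← smul_mul_assoc, ← hχ]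
      ring

/-- In the block triangular operator of `e r`, `r ≠ 0`, the block acting on `k` is zero, so the
off-diagonal block of its `p`-th power is the single term `e r ^ (p - 1) • m r`. -/
theorem isRestrictedBorel_extensionOp
    (hm : IsNormalizedCocycle (k := k) mu m) : IsRestrictedBorel p (extensionOp (k := k) mu m) := by
  intro r
  have hp1 : p - 1 + 1 = p := by have := hp.out.pos; omega
  by_cases hr : r = 0
  · subst hr
    have h : ∀ (n : ℕ) (v : M) (t : k), (extensionOp mu m 0 ^ n) (v, t) =
        (fieldU k p 1 ^ n • v, weightFamily k mu 0 ^ n * t) := by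
      intro n
      induction n with
      | zero => simp
      | succ n ih =>
        intro v t
        rw [pow_succ', Module.End.mul_apply, ih, extensionOp_apply, hm.at_zero, smul_zero, add_zero,
          smul_smul, zero_add, ← pow_succ', ← mul_assoc, ← pow_succ']
    refine LinearMap.ext fun ⟨v, t⟩ => ?_
    rw [h, if_pos rfl, extensionOp_apply, hm.at_zero, smul_zero, add_zero, zero_add,
      isRestrictedWitt_fieldU, if_pos rfl, isRestrictedBorel_weightFamily, if_pos rfl]
  · have h : ∀ (n : ℕ) (v : M) (t : k), (extensionOp mu m r ^ (n + 1)) (v, t) =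
        (fieldU k p (r + 1) ^ (n + 1) • v + t • fieldU k p (r + 1) ^ n • m r, 0) := by
      intro n
      induction n with
      | zero =>
        intro v t
        rw [zero_add, pow_one, extensionOp_apply, weightFamily, if_neg hr]
        simp
      | succ n ih =>
        intro v t
        rw [pow_succ', Module.End.mul_apply, ih, extensionOp_apply, zero_smul, add_zero, mul_zero,
          smul_add, smul_smul, ← pow_succ', smul_comm_restrictedU, smul_smul, ← pow_succ']
    refine LinearMap.ext fun ⟨v, t⟩ => ?_
    have h1 := h (p - 1) v t
    rw [hp1, isRestrictedWitt_fieldU, if_neg (by omega), hm.pow r hr, zero_smul, smul_zero,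
      add_zero] at h1
    rw [h1, if_neg hr]
    rfl

/-- A normalized cocycle on the basis extends to a cocycle of `u(𝔟⁺)`. -/
theorem IsNormalizedCocycle.exists_cocycle (hm : IsNormalizedCocycle (k := k) mu m) :
    ∃ φ : RestrictedUBorel k p →ₗ[k] M, IsBorelCocycle mu φ ∧ ∀ r, φ (fieldB k p r) = m r := by
  set T := (isBorelFamily_extensionOp hm).lift k (isRestrictedBorel_extensionOp hm) with hT
  have hTf : ∀ r, T (fieldB k p r) = extensionOp mu m r := fun r =>
    IsBorelFamily.lift_fieldB k _ _ r
  -- `T` is block triangular, with the actions on `M` and `k_mu` on the diagonal. The cocycle is its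
  -- off-diagonal block, and multiplicativity of `T` is the cocycle identity.
  have h1 : ∀ b v, T b (v, 0) = (borelMap k p b • v, 0) := by
    intro b
    induction b using induction_fieldB with
    | halg c =>
      intro v
      rw [AlgHom.commutes, AlgHom.commutes, algebraMap_smul, Module.algebraMap_end_apply]
      simp
    | hfield n =>
      intro v
      rw [hTf, extensionOp_apply, borelMap_fieldB]
      simp
    | hmul a b ha hb =>
      intro v
      rw [map_mul, Module.End.mul_apply, hb, ha, map_mul, mul_smul]
    | hadd a b ha hb =>
      intro v
      rw [map_add, LinearMap.add_apply, hb, ha, map_add, add_smul]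
      simp
  have h2 : ∀ b v t, (T b (v, t)).2 = weightCharacter k mu b * t := by
    intro b
    induction b using induction_fieldB with
    | halg c =>
      intro v t
      rw [AlgHom.commutes, AlgHom.commutes, Module.algebraMap_end_apply]
      rfl
    | hfield n =>
      intro v t
      rw [hTf, extensionOp_apply, weightCharacter_fieldB]
      rfl
    | hmul a b ha hb =>
      intro v t
      rw [map_mul, Module.End.mul_apply, map_mul, mul_assoc, ← hb v, ← ha (T b (v, t)).1]
    | hadd a b ha hb =>
      intro v t
      rw [map_add, LinearMap.add_apply, map_add, add_mul, ← hb v, ← ha v]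
      rfl
  let φ : RestrictedUBorel k p →ₗ[k] M :=
    { toFun := fun b => (T b (0, 1)).1
      map_add' := fun a b => by rw [map_add]; rfl
      map_smul' := fun c a => by rw [map_smul]; rfl }
  refine ⟨φ, fun a b => ?_, fun r => ?_⟩
  · change (T (a * b) (0, 1)).1 = borelMap k p a • (T b (0, 1)).1 + weightCharacter k mu b • (T a (0, 1)).1
    have e : T b (0, 1) = ((T b (0, 1)).1, 0) + weightCharacter k mu b • ((0 : M), (1 : k)) := by
      ext
      · simp
      · rw [h2]; simp
    have e' := congrArg (T a) e
    rw [map_add, map_smul, h1] at e'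
    rw [map_mul, Module.End.mul_apply, e']
    rfl
  · change (T (fieldB k p r) (0, 1)).1 = m r
    rw [hTf, extensionOp_apply]
    simp

end TriangularRep

/-! ### Cocycles in coordinates -/

section Coordinates

open TensorProduct

variable {k : Type u} [Field k] {p : ℕ} [hp : Fact p.Prime] [CharP k p] {mu lam : ZMod p}

/-- The exponent of the monomial of weight `s + i`. -/
def weightIdx (p : ℕ) [hp : Fact p.Prime] (s i : ℕ) : Fin p := ⟨(s + i) % p, Nat.mod_lt _ hp.out.pos⟩

/-- The equations on scalars `C r`, `1 ≤ r ≤ p - 2`, under which `e r ↦ C r x ^ ((s + r) mod p)` is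
a restricted cocycle of the nilradical of `𝔟⁺`, where `e i` acts on monomials by
`x ^ t ↦ (t + c (i + 1)) x ^ (t + i)`. -/
structure IsSolution (p : ℕ) (s : ℕ) (c : k) (C : ℕ → k) : Prop where
  zero : ∀ r, p ≤ r + 1 → C r = 0
  lie : ∀ i j, i ≠ 0 → j ≠ 0 →
    (if (s + j) % p + i < p then (((s + j) % p : ℕ) + c * (i + 1)) * C j else 0)
      - (if (s + i) % p + j < p then (((s + i) % p : ℕ) + c * (j + 1)) * C i else 0)
      = ((j : k) - i) * C (i + j)
  -- Only `e 1 ^ (p - 1)` applied to `x ^ 0` can be nonzero; in all other cases `e r ^ (p - 1)`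
  -- pushes the monomial past `x ^ (p - 1)`.
  pow : s + 1 = p → (∏ j ∈ Finset.range (p - 1), ((j : k) + 2 * c)) * C 1 = 0

/-- The coordinates of a vector of the model of the Verma module. -/
def coord (t : Fin p) : VermaModel k lam →ₗ[k] k := (LinearMap.proj t : (Fin p → k) →ₗ[k] k)

theorem coord_vmon (t : Fin p) (n : ℕ) (q : k) :
    coord t (vmon k lam n q) = if (t : ℕ) = n then q else 0 := rfl

theorem vermaModel_ext {u v : VermaModel k lam} (h : ∀ t : Fin p, coord t u = coord t v) : u = v :=
  funext h

theorem sum_vmon (u : VermaModel k lam) : ∑ t : Fin p, vmon k lam t (coord t u) = u :=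
  sum_monom (u : Fin p → k)

theorem natCast_inj_of_lt {a b : ℕ} (ha : a < p) (hb : b < p) (h : (a : k) = b) : a = b :=
  CharP.natCast_injOn_Iio k p ha hb h

theorem coord_fieldU_smul (u : VermaModel k lam) {s : ℕ} (hs : s < p) (i : ℕ) :
    coord (weightIdx p s i) (fieldU k p (i + 1) • u)
      = if s + i < p then ((s : k) + (wt k lam + 1) * (i + 1)) * coord ⟨s, hs⟩ u else 0 := by
  conv_lhs => rw [← sum_vmon u, Finset.smul_sum, map_sum]
  have hterm : ∀ t : Fin p, coord (weightIdx p s i) (fieldU k p (i + 1) • vmon k lam t (coord t u))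
      = if (s + i) % p = (t : ℕ) + i then (((t : ℕ) : k) + (wt k lam + 1) * (i + 1)) * coord t u else 0 := by
    intro t
    rw [fieldU_smul_vmon, coord_vmon]
    push_cast
    rfl
  simp only [hterm]
  by_cases h : s + i < p
  · rw [if_pos h, Nat.mod_eq_of_lt h, Finset.sum_eq_single ⟨s, hs⟩, if_pos rfl]
    · intro t _ ht
      rw [if_neg]
      intro h2
      exact ht (Fin.ext (by simp only; omega))
    · simp
  · rw [if_neg h]
    refine Finset.sum_eq_zero fun t _ => if_neg fun h2 => ?_
    have h3 : (s + i) % p ≡ s + i [MOD p] := Nat.mod_modEq _ _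
    rw [h2] at h3
    have h4 : (t : ℕ) = s := (Nat.ModEq.add_right_cancel' i h3).eq_of_lt_of_lt t.2 hs
    have := (weightIdx p s i).2
    simp only [weightIdx] at this
    omega

theorem coord_fieldU_one_smul (u : VermaModel k lam) (t : Fin p) :
    coord t (fieldU k p 1 • u) = (((t : ℕ) : k) + (wt k lam + 1)) * coord t u := by
  have h := coord_fieldU_smul u t.2 0
  have ht : weightIdx p t 0 = t := Fin.ext (Nat.mod_eq_of_lt t.2)
  rw [ht, add_zero, if_pos t.2] at h
  rw [zero_add] at h
  rw [h]
  push_cast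
  ring

theorem fieldU_smul_vmon_weightIdx (s i j : ℕ) (q : k) :
    fieldU k p (i + 1) • vmon k lam ((s + j) % p) q = vmon k lam ((s + (i + j)) % p)
      (if (s + j) % p + i < p then (((s + j) % p : ℕ) + (wt k lam + 1) * (i + 1)) * q else 0) := by
  rw [fieldU_smul_vmon, show (s + j) % p + (i + 1) - 1 = (s + j) % p + i by omega]
  push_cast
  split_ifs with h
  · congr 1
    rw [← Nat.mod_eq_of_lt h, Nat.mod_add_mod]
    congr 1
    omega
  · rw [vmon_of_le k lam (not_lt.1 h), vmon_zero]

theorem vmon_inj {t : ℕ} (ht : t < p) {a b : k} : vmon k lam t a = vmon k lam t b ↔ a = b := by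
  refine ⟨fun h => ?_, fun h => by rw [h]⟩
  have h2 := congrArg (coord ⟨t, ht⟩) h
  rwa [coord_vmon, coord_vmon, if_pos rfl, if_pos rfl] at h2

theorem vmon_sub (t : ℕ) (a b : k) : vmon k lam t a - vmon k lam t b = vmon k lam t (a - b) := by
  refine vermaModel_ext fun i => ?_
  rw [map_sub, coord_vmon, coord_vmon, coord_vmon]
  split_ifs <;> simp

theorem fieldU_two_pow_smul (n : ℕ) (q : k) : fieldU k p 2 ^ n • vmon k lam 0 q =
    vmon k lam n ((∏ j ∈ Finset.range n, ((j : k) + 2 * (wt k lam + 1))) * q) := by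
  induction n with
  | zero => simp
  | succ n ih =>
    rw [pow_succ', mul_smul, ih, fieldU_smul_vmon, Finset.prod_range_succ]
    congr 1
    push_cast
    ring

theorem fieldU_pow_smul_eq_zero {r : ℕ} (n t : ℕ) (q : k) (h : p ≤ t + r * n) :
    fieldU k p (r + 1) ^ n • vmon k lam t q = 0 := by
  have key : ∀ n, ∃ q', fieldU k p (r + 1) ^ n • vmon k lam t q = vmon k lam (t + r * n) q' := by
    intro n
    induction n with
    | zero => exact ⟨q, by simp⟩
    | succ n ih =>
      obtain ⟨q', hq'⟩ := ih
      exact ⟨_, by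
        rw [pow_succ', mul_smul, hq', fieldU_smul_vmon,
          show t + r * n + (r + 1) - 1 = t + r * (n + 1) by rw [mul_add]; omega]⟩
  obtain ⟨q', hq'⟩ := key n
  rw [hq', vmon_of_le k lam h]

variable {s : ℕ}

theorem IsSolution.isNormalizedCocycle
    (hs : s < p) (hw : (s : k) + (wt k lam + 1) = wt k mu)
    {C : ℕ → k} (hC : IsSolution p s (wt k lam + 1) C) :
    IsNormalizedCocycle (k := k) mu fun r => if r = 0 then 0 else vmon k lam ((s + r) % p) (C r) := by
  have hmod : ∀ r, (s + r) % p < p := fun r => Nat.mod_lt _ hp.out.pos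
  refine ⟨fun r hr => ?_, if_pos rfl, fun r hr => ?_, fun i j hi hj => ?_, fun r hr => ?_⟩
  · by_cases h : r = 0
    · rw [if_pos h]
    · rw [if_neg h, hC.zero r hr, vmon_zero]
  · rw [if_neg hr, fieldU_smul_vmon, vmon_smul, add_tsub_cancel_right]
    congr 2
    rw [Nat.cast_one, mul_one, ← hw]
    have h1 : (((s + r) % p : ℕ) : k) = ((s + r : ℕ) : k) := by rw [CharP.cast_eq_mod k p (s + r)]
    rw [h1]
    push_cast
    ring
  · rw [if_neg hi, if_neg hj, if_neg (by omega), fieldU_smul_vmon_weightIdx,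
      fieldU_smul_vmon_weightIdx, add_comm j i, vmon_sub, hC.lie i j hi hj, vmon_smul]
  · rw [if_neg hr]
    have hp2 := hp.out.two_le
    by_cases h : p ≤ (s + r) % p + r * (p - 1)
    · exact fieldU_pow_smul_eq_zero _ _ _ h
    · have hr1 : r = 1 := by
        by_contra hr1
        have : 2 * (p - 1) ≤ r * (p - 1) := Nat.mul_le_mul_right _ (by omega)
        omega
      subst hr1
      have h0 : (s + 1) % p = 0 := by omega
      have hsp : s + 1 = p := by
        rcases Nat.lt_or_ge (s + 1) p with h1 | h1
        · rw [Nat.mod_eq_of_lt h1] at h0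
          omega
        · omega
      rw [h0, fieldU_two_pow_smul, hC.pow hsp, vmon_zero]

/-- If `φ (e 0) = 0`, then `[e 0, e r] = r e r` makes `φ (e r)` an eigenvector of `e 0` of weight
`mu + r`, and the weights of the monomials are distinct. -/
theorem IsBorelCocycle.eq_vmon
    (hw : (s : k) + (wt k lam + 1) = wt k mu)
    {φ : RestrictedUBorel k p →ₗ[k] VermaModel k lam}
    (hφ : IsBorelCocycle mu φ) (h0 : φ (fieldB k p 0) = 0) {r : ℕ} (hr : r ≠ 0) :
    φ (fieldB k p r) = vmon k lam ((s + r) % p) (coord (weightIdx p s r) (φ (fieldB k p r))) := by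
  refine vermaModel_ext fun t => ?_
  rw [coord_vmon]
  split_ifs with ht
  · congr 1
    exact congrArg coord (Fin.ext ht)
  · have h := hφ.bracket_zero hr
    rw [h0, smul_zero, sub_zero] at h
    have h1 := congrArg (coord t) h
    rw [coord_fieldU_one_smul, map_smul, smul_eq_mul, ← hw, ← sub_eq_zero, ← sub_mul] at h1
    refine (mul_eq_zero.1 h1).resolve_left fun h2 => ht ?_
    refine natCast_inj_of_lt (k := k) t.2 (Nat.mod_lt _ hp.out.pos) ?_
    rw [← CharP.cast_eq_mod k p (s + r)]
    push_cast
    linear_combination h2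

theorem IsBorelCocycle.isSolution
    (hw : (s : k) + (wt k lam + 1) = wt k mu)
    {φ : RestrictedUBorel k p →ₗ[k] VermaModel k lam}
    (hφ : IsBorelCocycle mu φ) (h0 : φ (fieldB k p 0) = 0) :
    IsSolution p s (wt k lam + 1) fun r => coord (weightIdx p s r) (φ (fieldB k p r)) := by
  refine ⟨fun r hr => ?_, fun i j hi hj => ?_, fun hsp => ?_⟩
  · rw [(isBorelFamily_fieldB (p := p) k).zero r hr, map_zero, map_zero]
  · have h := hφ.bracket hi hj
    rw [hφ.eq_vmon hw h0 hi, hφ.eq_vmon hw h0 hj, fieldU_smul_vmon_weightIdx,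
      fieldU_smul_vmon_weightIdx, add_comm j i, vmon_sub,
      hφ.eq_vmon hw h0 (r := i + j) (by omega), vmon_smul,
      vmon_inj (Nat.mod_lt _ hp.out.pos)] at h
    exact h
  · have hp2 := hp.out.two_le
    have h := hφ.pow (fieldB k p 1) p
    have hsum : ∑ i ∈ Finset.range p, weightCharacter k mu (fieldB k p 1) ^ (p - 1 - i) •
        borelMap k p (fieldB k p 1) ^ i • φ (fieldB k p 1)
        = fieldU k p 2 ^ (p - 1) • φ (fieldB k p 1) := by
      rw [Finset.sum_eq_single (p - 1), borelMap_fieldB, tsub_self, pow_zero, one_smul]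
      · intro i hi hi'
        have := Finset.mem_range.1 hi
        rw [weightCharacter_fieldB, if_neg one_ne_zero, zero_pow (by omega), zero_smul]
      · intro hn
        exact absurd (Finset.mem_range.2 (by omega)) hn
    rw [hsum, isRestrictedBorel_fieldB k 1, if_neg one_ne_zero, map_zero,
      hφ.eq_vmon hw h0 one_ne_zero, hsp, Nat.mod_self, fieldU_two_pow_smul, ← vmon_zero k lam (p - 1),
      vmon_inj (by omega)] at h
    exact h.symm

/-- Every cocycle is cohomologous to one that vanishes on `e 0`. -/
theorem IsBorelCocycle.exists_normalizing
    (hs : s < p) (hw : (s : k) + (wt k lam + 1) = wt k mu)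
    {φ : RestrictedUBorel k p →ₗ[k] VermaModel k lam}
    (hφ : IsBorelCocycle mu φ) : ∃ n : VermaModel k lam, coord ⟨s, hs⟩ n = 0 ∧
      fieldU k p 1 • n - wt k mu • n = φ (fieldB k p 0) := by
  -- On `x ^ s` the operator `e 0 - mu` is zero, so no coboundary could remove this coordinate. It
  -- vanishes because `e 0 ^ p = e 0` writes it as a sum of `p` equal terms.
  have hcoef : coord ⟨s, hs⟩ (φ (fieldB k p 0)) = 0 := by
    have hit : ∀ (i : ℕ) (u : VermaModel k lam), coord ⟨s, hs⟩ (fieldU k p 1 ^ i • u)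
        = wt k mu ^ i * coord ⟨s, hs⟩ u := by
      intro i
      induction i with
      | zero => simp
      | succ i ih => intro u; rw [pow_succ', mul_smul, coord_fieldU_one_smul, ih, hw, pow_succ',
        mul_assoc]
    have h := congrArg (coord ⟨s, hs⟩) (hφ.pow (fieldB k p 0) p)
    rw [isRestrictedBorel_fieldB k 0, if_pos rfl, map_sum, Finset.sum_congr rfl (g := fun _ =>
      wt k mu ^ (p - 1) * coord ⟨s, hs⟩ (φ (fieldB k p 0))), Finset.sum_const, Finset.card_range,
      nsmul_eq_mul, CharP.cast_eq_zero, zero_mul] at h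
    · exact h
    · intro i hi
      have := Finset.mem_range.1 hi
      rw [map_smul, weightCharacter_fieldB, if_pos rfl, borelMap_fieldB, zero_add, hit, smul_eq_mul,
        ← mul_assoc, ← pow_add, Nat.sub_add_cancel (by omega)]
  -- `e 0 - mu` multiplies `x ^ t` by `t - s`; at `t = s` the convention `0⁻¹ = 0` gives the
  -- coordinate `0`.
  obtain ⟨n, hn⟩ : ∃ n : VermaModel k lam, ∀ t : Fin p,
      coord t n = (((t : ℕ) : k) - s)⁻¹ * coord t (φ (fieldB k p 0)) := ⟨fun t => _, fun t => rfl⟩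
  refine ⟨n, ?_, ?_⟩
  · rw [hn, hcoef, mul_zero]
  · refine vermaModel_ext fun t => ?_
    rw [map_sub, coord_fieldU_one_smul, map_smul, smul_eq_mul, ← hw, ← sub_mul, hn]
    by_cases ht : (t : ℕ) = s
    · have : t = ⟨s, hs⟩ := Fin.ext ht
      rw [this, hcoef, mul_zero, mul_zero]
    · have h1 : ((t : ℕ) : k) - s ≠ 0 := fun h =>
        ht (natCast_inj_of_lt (k := k) t.2 hs (sub_eq_zero.1 h))
      rw [add_sub_add_right_eq_sub, mul_inv_cancel_left₀ h1]

end Coordinates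

/-! ### Extensions and solutions -/

section Dictionary

open TensorProduct

variable {k : Type u} [Field k] {p : ℕ} [hp : Fact p.Prime] [CharP k p] {mu lam : ZMod p}

/-- The homomorphism on `u(𝔤) ⊗ k` with `1 ⊗ 1 ↦ n`. -/
def coverHom {M : Type u} [AddCommGroup M] [Module (RestrictedU k p) M] (n : M) :
    RestrictedU k p ⊗[k] k →ₗ[RestrictedU k p] M :=
  LinearMap.toSpanSingleton _ _ n ∘ₗ
    (AlgebraTensorModule.rid k (RestrictedU k p) (RestrictedU k p)).toLinearMap

theorem eq_coverHom {M : Type u} [AddCommGroup M] [Module k M] [Module (RestrictedU k p) M]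
    [IsScalarTower k (RestrictedU k p) M]
    (g : RestrictedU k p ⊗[k] k →ₗ[RestrictedU k p] M) : g = coverHom (g (1 ⊗ₜ 1)) := by
  apply AlgebraTensorModule.curry_injective
  ext
  simp [coverHom]

variable (mu) in
/-- The coboundary of a vector. -/
def coboundary (n : VermaModel k lam) : RestrictedUBorel k p →ₗ[k] VermaModel k lam :=
  cocycleOf (coverHom n ∘ₗ (vermaRel k mu).subtype)

theorem coboundary_apply (n : VermaModel k lam) (b : RestrictedUBorel k p) :
    coboundary mu n b = borelMap k p b • n - weightCharacter k mu b • n := by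
  rw [coboundary, cocycleOf_apply, LinearMap.comp_apply, Submodule.subtype_apply, coe_relGen,
    map_sub,
    coverHom]
  simp only [LinearMap.comp_apply, LinearEquiv.coe_coe, AlgebraTensorModule.rid_tmul, one_smul,
    LinearMap.toSpanSingleton_apply, smul_assoc]

/-- The value at `e i`, in weight `mu + i`, of the cocycle of a homomorphism. -/
def leadingCoeff (s i : ℕ) : (vermaRel k mu →ₗ[RestrictedU k p] VermaModel k lam) →+ k where
  toFun f := coord (weightIdx p s i) (cocycleOf f (fieldB k p i))
  map_zero' := by rw [cocycleOf_apply, LinearMap.zero_apply, map_zero]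
  map_add' f g := by
    rw [cocycleOf_apply, LinearMap.add_apply, map_add]
    rfl

/-- The coefficient of `x ^ (s + i)` in the coboundary of `x ^ s` at `e i`. -/
def cobCoeff (p s : ℕ) (c : k) (i : ℕ) : k := if s + i < p then (s : k) + c * (i + 1) else 0

variable {s : ℕ}

theorem coord_coboundary (hs : s < p) (n : VermaModel k lam) {i : ℕ} (hi : i ≠ 0) :
    coord (weightIdx p s i) (coboundary mu n (fieldB k p i))
      = coord ⟨s, hs⟩ n * cobCoeff p s (wt k lam + 1) i := by
  rw [coboundary_apply, borelMap_fieldB, weightCharacter_fieldB, if_neg hi, zero_smul, sub_zero,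
    coord_fieldU_smul n hs, cobCoeff]
  split_ifs
  · rw [mul_comm]
  · rw [mul_zero]

/-- The normalizing vector has no `x ^ s` coordinate, so subtracting its coboundary leaves the
leading coefficients at `e i`, `i ≠ 0`, unchanged. They can thus be read off `f` before
normalization. -/
theorem exists_solution
    (hs : s < p) (hw : (s : k) + (wt k lam + 1) = wt k mu)
    (f : vermaRel k mu →ₗ[RestrictedU k p] VermaModel k lam) :
    ∃ C, IsSolution p s (wt k lam + 1) C ∧ ∀ i, i ≠ 0 → C i = leadingCoeff s i f := by
  obtain ⟨n, hn, h0⟩ := (isBorelCocycle_cocycleOf f).exists_normalizing hs hw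
  have hf' : cocycleOf (f - coverHom n ∘ₗ (vermaRel k mu).subtype) = cocycleOf f - coboundary mu n :=
    rfl
  have hc := isBorelCocycle_cocycleOf (f - coverHom n ∘ₗ (vermaRel k mu).subtype)
  have hc0 : cocycleOf (f - coverHom n ∘ₗ (vermaRel k mu).subtype) (fieldB k p 0) = 0 := by
    rw [hf', LinearMap.sub_apply, coboundary_apply, borelMap_fieldB, weightCharacter_fieldB,
      if_pos rfl, ← h0, sub_self]
  refine ⟨_, hc.isSolution hw hc0, fun i hi => ?_⟩
  rw [hf', LinearMap.sub_apply, map_sub, coord_coboundary hs n hi, hn, zero_mul, sub_zero]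
  rfl

theorem exists_hom_of_solution
    (hs : s < p) (hw : (s : k) + (wt k lam + 1) = wt k mu)
    {C : ℕ → k} (hC : IsSolution p s (wt k lam + 1) C) :
    ∃ f : vermaRel k mu →ₗ[RestrictedU k p] VermaModel k lam,
      ∀ i, i ≠ 0 → leadingCoeff s i f = C i := by
  obtain ⟨φ, hφ, hφm⟩ := (hC.isNormalizedCocycle hs hw).exists_cocycle
  obtain ⟨f, rfl⟩ := hφ.exists_hom
  refine ⟨f, fun i hi => ?_⟩
  change coord (weightIdx p s i) (cocycleOf f (fieldB k p i)) = C i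
  rw [hφm, if_neg hi, coord_vmon]
  exact if_pos rfl

/-- A coboundary enters the leading coefficients only through the `x ^ s` coordinate `t` of its
vector. Conversely, once `e 0`, `e 1` and `e 2` are matched, `IsBorelCocycle.eq_zero` matches the
rest. -/
theorem extends_iff
    (hs : s < p) (hw : (s : k) + (wt k lam + 1) = wt k mu)
    (f : vermaRel k mu →ₗ[RestrictedU k p] VermaModel k lam) :
    (∃ g : RestrictedU k p ⊗[k] k →ₗ[RestrictedU k p] VermaModel k lam,
      g ∘ₗ (vermaRel k mu).subtype = f) ↔
    ∃ t, leadingCoeff s 1 f = t * cobCoeff p s (wt k lam + 1) 1 ∧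
      leadingCoeff s 2 f = t * cobCoeff p s (wt k lam + 1) 2 := by
  constructor
  · rintro ⟨g, rfl⟩
    refine ⟨coord ⟨s, hs⟩ (g (1 ⊗ₜ 1)), ?_, ?_⟩
    · rw [eq_coverHom g]
      exact (coord_coboundary hs _ one_ne_zero).trans (by rw [← eq_coverHom])
    · rw [eq_coverHom g]
      exact (coord_coboundary hs _ two_ne_zero).trans (by rw [← eq_coverHom])
  · rintro ⟨t, h1, h2⟩
    obtain ⟨n, hn, h0⟩ := (isBorelCocycle_cocycleOf f).exists_normalizing hs hw
    set v := n + vmon k lam s t with hv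
    refine ⟨coverHom v, ?_⟩
    have hcv : coord ⟨s, hs⟩ v = t := by
      rw [hv, map_add, hn, zero_add, coord_vmon, if_pos rfl]
    have hf' : cocycleOf (f - coverHom v ∘ₗ (vermaRel k mu).subtype) = cocycleOf f - coboundary mu v :=
      rfl
    have hc := isBorelCocycle_cocycleOf (f - coverHom v ∘ₗ (vermaRel k mu).subtype)
    have hc0 : cocycleOf (f - coverHom v ∘ₗ (vermaRel k mu).subtype) (fieldB k p 0) = 0 := by
      rw [hf', LinearMap.sub_apply, coboundary_apply, borelMap_fieldB, weightCharacter_fieldB,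
        if_pos rfl, ← h0, hv, smul_add, smul_add, zero_add, fieldU_smul_vmon, vmon_smul,
        add_tsub_cancel_right, Nat.cast_one, mul_one, hw]
      abel
    have hci : ∀ i, i ≠ 0 → leadingCoeff s i f = t * cobCoeff p s (wt k lam + 1) i →
        cocycleOf (f - coverHom v ∘ₗ (vermaRel k mu).subtype) (fieldB k p i) = 0 := by
      intro i hi h
      rw [hc.eq_vmon hw hc0 hi, hf', LinearMap.sub_apply, map_sub, coord_coboundary hs v hi, hcv,
        ← h]
      exact (congrArg _ (sub_self _)).trans (vmon_zero _ _ _)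
    have hz := hc.eq_zero hc0 (hci 1 one_ne_zero h1) (hci 2 two_ne_zero h2)
    refine hom_eq_of_relGen fun b => ?_
    have h3 := LinearMap.congr_fun hz b
    rw [hf'] at h3
    exact (sub_eq_zero.1 h3).symm

/-- `Ext¹` vanishes if all solutions come from coboundaries. -/
theorem subsingleton_extVerma
    (hs : s < p) (hw : (s : k) + (wt k lam + 1) = wt k mu)
    (h : ∀ C, IsSolution p s (wt k lam + 1) C →
    ∃ t, C 1 = t * cobCoeff p s (wt k lam + 1) 1 ∧ C 2 = t * cobCoeff p s (wt k lam + 1) 2) :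
    Subsingleton (ExtVerma k mu lam) := by
  refine subsingleton_ext_of_extends (vermaRel k mu) k fun f => ?_
  obtain ⟨C, hC, hCf⟩ := exists_solution hs hw ((vermaEquiv k lam).toLinearMap ∘ₗ f)
  obtain ⟨t, h1, h2⟩ := h C hC
  obtain ⟨g, hg⟩ := (extends_iff hs hw ((vermaEquiv k lam).toLinearMap ∘ₗ f)).2
    ⟨t, (hCf 1 one_ne_zero).symm.trans h1, (hCf 2 two_ne_zero).symm.trans h2⟩
  refine ⟨(vermaEquiv k lam).symm.toLinearMap ∘ₗ g, ?_⟩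
  ext x
  have h3 := LinearMap.congr_fun hg x
  change (vermaEquiv k lam).symm (g x) = f x
  rw [LinearEquiv.symm_apply_eq]
  exact h3

/-- `Ext¹` is one-dimensional if a linear functional on the pairs `(C 1, C 2)` of solutions is
non-zero and its kernel consists of the coboundaries. -/
theorem extVerma_equiv (hs : s < p) (hw : (s : k) + (wt k lam + 1) = wt k mu) (α β : k)
    (hcob : α * cobCoeff p s (wt k lam + 1) 1 + β * cobCoeff p s (wt k lam + 1) 2 = 0)
    (hex : ∃ C, IsSolution p s (wt k lam + 1) C ∧ α * C 1 + β * C 2 ≠ 0)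
    (h : ∀ C, IsSolution p s (wt k lam + 1) C → α * C 1 + β * C 2 = 0 →
      ∃ t, C 1 = t * cobCoeff p s (wt k lam + 1) 1 ∧ C 2 = t * cobCoeff p s (wt k lam + 1) 2) :
    Nonempty (ExtVerma k mu lam ≃ₗ[k] k) := by
  let T : (vermaRel k mu →ₗ[RestrictedU k p] Verma k lam) →+ k :=
    { toFun := fun f => α * leadingCoeff s 1 ((vermaEquiv k lam).toLinearMap ∘ₗ f)
        + β * leadingCoeff s 2 ((vermaEquiv k lam).toLinearMap ∘ₗ f)
      map_zero' := by rw [LinearMap.comp_zero, map_zero, map_zero, mul_zero, mul_zero, add_zero]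
      map_add' := fun f g => by rw [LinearMap.comp_add, map_add, map_add]; ring }
  have hT : ∀ f, T f = α * leadingCoeff s 1 ((vermaEquiv k lam).toLinearMap ∘ₗ f)
        + β * leadingCoeff s 2 ((vermaEquiv k lam).toLinearMap ∘ₗ f) := fun _ => rfl
  refine ext_equiv_of_functional (vermaRel k mu) T ?_ ?_ ?_
  · intro c f g hfg
    have key : ∀ i, leadingCoeff s i ((vermaEquiv k lam).toLinearMap ∘ₗ g)
        = c * leadingCoeff s i ((vermaEquiv k lam).toLinearMap ∘ₗ f) := by
      intro i
      change coord _ (vermaEquiv k lam (g _)) = c * coord _ (vermaEquiv k lam (f _))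
      rw [hfg, map_smul, algebraMap_smul, map_smul, smul_eq_mul]
    rw [hT, hT, key, key]
    ring
  · obtain ⟨C, hC, hne⟩ := hex
    obtain ⟨f, hf⟩ := exists_hom_of_solution hs hw hC
    refine ⟨(vermaEquiv k lam).symm.toLinearMap ∘ₗ f, ?_⟩
    have e : (vermaEquiv k lam).toLinearMap ∘ₗ ((vermaEquiv k lam).symm.toLinearMap ∘ₗ f) = f := by
      ext x
      exact (vermaEquiv k lam).apply_symm_apply _
    rw [hT, e, hf 1 one_ne_zero, hf 2 two_ne_zero]
    exact hne
  · intro f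
    have e : (∃ g : RestrictedU k p ⊗[k] k →ₗ[RestrictedU k p] Verma k lam,
        g ∘ₗ (vermaRel k mu).subtype = f) ↔
        ∃ g : RestrictedU k p ⊗[k] k →ₗ[RestrictedU k p] VermaModel k lam,
          g ∘ₗ (vermaRel k mu).subtype = (vermaEquiv k lam).toLinearMap ∘ₗ f := by
      constructor
      · rintro ⟨g, rfl⟩
        exact ⟨(vermaEquiv k lam).toLinearMap ∘ₗ g, rfl⟩
      · rintro ⟨g, hg⟩
        refine ⟨(vermaEquiv k lam).symm.toLinearMap ∘ₗ g, ?_⟩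
        ext x
        change (vermaEquiv k lam).symm (g x) = f x
        rw [LinearEquiv.symm_apply_eq]
        exact LinearMap.congr_fun hg x
    rw [e, extends_iff hs hw, hT]
    obtain ⟨C, hC, hCf⟩ := exists_solution hs hw ((vermaEquiv k lam).toLinearMap ∘ₗ f)
    rw [← hCf 1 one_ne_zero, ← hCf 2 two_ne_zero]
    refine ⟨h C hC, ?_⟩
    rintro ⟨t, h1, h2⟩
    rw [h1, h2]
    linear_combination t * hcob

end Dictionary

/-! ### The linear equations -/

section Solutions

variable {k : Type u} [Field k] {p : ℕ} [hp : Fact p.Prime] [CharP k p]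

variable (k p) in
theorem natCast_ne_zero_of_lt {n : ℕ} (h0 : n ≠ 0) (hn : n < p) : (n : k) ≠ 0 := fun h =>
  h0 (natCast_inj_of_lt (k := k) hn hp.out.pos (by rw [h, Nat.cast_zero]))

variable {s d : ℕ} {c : k}

variable (k) in
theorem cast_start (hd : s + d + 1 = p) : (s : k) = -1 - d := by
  have h : ((s + d + 1 : ℕ) : k) = 0 := by rw [hd, CharP.cast_eq_zero]
  push_cast at h
  linear_combination h

variable (k) in
theorem cast_start_add_mod (hd : s + d + 1 = p) (j : ℕ) : (((s + j) % p : ℕ) : k) = j - 1 - d := by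
  rw [← CharP.cast_eq_mod k p, Nat.cast_add, cast_start k hd]
  ring

theorem start_add_mod (hd : s + d + 1 = p) {j : ℕ} (h1 : d < j) (h2 : j ≤ p + d) :
    (s + j) % p = j - 1 - d := by
  rw [show s + j = j - 1 - d + p by omega, Nat.add_mod_right, Nat.mod_eq_of_lt (by omega)]

namespace IsSolution

variable {C : ℕ → k}

/-- Exponents `s + r` wrap around exactly when `r > d`, and a product that crosses `x ^ (p - 1)` is
zero. So the cocycle equation has three shapes, according to which of `i`, `j` exceed `d`: `low`,
`mixed` and `high`. The bound `n ≤ p + d` keeps the wrapped products below `x ^ p`. -/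
theorem low (hC : IsSolution p s c C) (hd : s + d + 1 = p) (i j n : ℕ) (hi : i ≠ 0) (hj : j ≠ 0)
    (hn : i + j = n) (hnd : n ≤ d) :
    C j * (j - 1 - d + c * (i + 1)) - C i * (i - 1 - d + c * (j + 1)) = ((j : k) - i) * C n := by
  have h := hC.lie i j hi hj
  rw [cast_start_add_mod k hd, cast_start_add_mod k hd, Nat.mod_eq_of_lt (a := s + j) (by omega),
    Nat.mod_eq_of_lt (a := s + i) (by omega), if_pos (by omega), if_pos (by omega), hn] at h
  rw [← h]
  ring

theorem mixed (hC : IsSolution p s c C) (hd : s + d + 1 = p) (i j n : ℕ) (hi : i ≠ 0) (hid : i ≤ d)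
    (hj : d < j) (hn : i + j = n) (hnd : n ≤ p + d) :
    C j * (j - 1 - d + c * (i + 1)) = ((j : k) - i) * C n := by
  have h := hC.lie i j hi (by omega)
  rw [cast_start_add_mod k hd, cast_start_add_mod k hd, start_add_mod hd hj (by omega),
    Nat.mod_eq_of_lt (a := s + i) (by omega), if_pos (by omega), if_neg (by omega), hn] at h
  rw [← h]
  ring

theorem high (hC : IsSolution p s c C) (hd : s + d + 1 = p) (i j n : ℕ) (hi : d < i) (hj : d < j)
    (hn : i + j = n) (hnd : n ≤ p + d) :
    C j * (j - 1 - d + c * (i + 1)) - C i * (i - 1 - d + c * (j + 1)) = ((j : k) - i) * C n := by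
  have h := hC.lie i j (by omega) (by omega)
  rw [cast_start_add_mod k hd, cast_start_add_mod k hd, start_add_mod hd hj (by omega),
    start_add_mod hd hi (by omega), if_pos (by omega), if_pos (by omega), hn] at h
  rw [← h]
  ring

theorem of_lt (hzero : ∀ r, p ≤ r + 1 → C r = 0) (hpow : s + 1 = p →
      (∏ j ∈ Finset.range (p - 1), ((j : k) + 2 * c)) * C 1 = 0)
    (h : ∀ i j, i ≠ 0 → i < j →
      (if (s + j) % p + i < p then (((s + j) % p : ℕ) + c * (i + 1)) * C j else 0)
        - (if (s + i) % p + j < p then (((s + i) % p : ℕ) + c * (j + 1)) * C i else 0)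
        = ((j : k) - i) * C (i + j)) : IsSolution p s c C := by
  refine ⟨hzero, fun i j hi hj => ?_, hpow⟩
  rcases lt_trichotomy i j with hij | rfl | hij
  · exact h i j hi hij
  · rw [sub_self, sub_self, zero_mul]
  · have := h j i hj hij
    rw [add_comm i j]
    linear_combination -this

/-- When `C` is supported on `r ≤ d`, every term with `i + j > d` vanishes, so only the unwrapped
equations need checking. -/
theorem of_low (hd : s + d + 1 = p) (hd0 : d ≠ 0) (hzero : ∀ r, p ≤ r + 1 → C r = 0)
    (hlow : ∀ r, d < r → C r = 0)
    (h : ∀ i j, i ≠ 0 → i < j → i + j ≤ d →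
      C j * (j - 1 - d + c * (i + 1)) - C i * (i - 1 - d + c * (j + 1)) = ((j : k) - i) * C (i + j)) :
    IsSolution p s c C := by
  refine of_lt hzero (fun _ => by omega) fun i j hi hij => ?_
  rw [cast_start_add_mod k hd, cast_start_add_mod k hd]
  by_cases hj : j ≤ d
  · rw [Nat.mod_eq_of_lt (a := s + j) (by omega), Nat.mod_eq_of_lt (a := s + i) (by omega)]
    by_cases hijd : i + j ≤ d
    · rw [if_pos (by omega), if_pos (by omega), ← h i j hi hij hijd]
      ring
    · rw [if_neg (by omega), if_neg (by omega), hlow _ (not_le.1 hijd), mul_zero, sub_zero]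
  · rw [hlow j (by omega), hlow (i + j) (by omega), mul_zero, ite_self, mul_zero, zero_sub,
      neg_eq_zero]
    by_cases hid : i ≤ d
    · rw [Nat.mod_eq_of_lt (a := s + i) (by omega), if_neg (by omega)]
    · rw [hlow i (by omega), mul_zero, ite_self]

/-- When `C` vanishes for `1 ≤ r ≤ d`, all monomials that occur are wrapped, and one uniform
equation with exponents `r - 1 - d` covers every case. -/
theorem of_high (hd : s + d + 1 = p) (hd1 : d ≤ 1) (hzero : ∀ r, p ≤ r + 1 → C r = 0)
    (hlow : ∀ r, r ≠ 0 → r ≤ d → C r = 0)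
    (hpow : s + 1 = p → (∏ j ∈ Finset.range (p - 1), ((j : k) + 2 * c)) * C 1 = 0)
    (h : ∀ i j, i ≠ 0 → i < j → i + j ≤ p + d →
      C j * (j - 1 - d + c * (i + 1)) - C i * (i - 1 - d + c * (j + 1)) = ((j : k) - i) * C (i + j)) :
    IsSolution p s c C := by
  refine of_lt hzero hpow fun i j hi hij => ?_
  by_cases hijd : i + j ≤ p + d
  · rw [cast_start_add_mod k hd, cast_start_add_mod k hd,
      start_add_mod hd (j := j) (by omega) (by omega),
      if_pos (by omega), ← h i j hi hij hijd]
    by_cases hid : i ≤ d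
    · rw [hlow i hi hid]
      simp only [mul_zero, ite_self, zero_mul]
      ring
    · rw [start_add_mod hd (j := i) (by omega) (by omega), if_pos (by omega)]
      ring
  · rw [hzero (i + j) (by omega), mul_zero]
    have h1 : (if (s + j) % p + i < p then (((s + j) % p : ℕ) + c * (i + 1)) * C j else 0) = 0 := by
      by_cases hj : p ≤ j + 1
      · rw [hzero j hj, mul_zero, ite_self]
      · rw [start_add_mod hd (j := j) (by omega) (by omega), if_neg (by omega)]
    have h2 : (if (s + i) % p + j < p then (((s + i) % p : ℕ) + c * (j + 1)) * C i else 0) = 0 := by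
      by_cases hi' : p ≤ i + 1
      · rw [hzero i hi', mul_zero, ite_self]
      · by_cases hid : i ≤ d
        · rw [hlow i hi hid, mul_zero, ite_self]
        · rw [start_add_mod hd (j := i) (by omega) (by omega), if_neg (by omega)]
    rw [h1, h2, sub_zero]

end IsSolution

theorem cobCoeff_of_le (hd : s + d + 1 = p) {i : ℕ} (hi : i ≤ d) :
    cobCoeff p s c i = -1 - d + c * (i + 1) := by
  rw [cobCoeff, if_pos (by omega), cast_start k hd]

theorem cobCoeff_of_lt (hd : s + d + 1 = p) {i : ℕ} (hi : d < i) : cobCoeff p s c i = 0 := by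
  rw [cobCoeff, if_neg (by omega)]

theorem exists_eq_mul {x y a b : k} (h : a ≠ 0 ∨ b ≠ 0) (hdet : b * x - a * y = 0) :
    ∃ t, x = t * a ∧ y = t * b := by
  rcases h with h | h
  · refine ⟨x / a, by field_simp, ?_⟩
    field_simp
    linear_combination -hdet
  · refine ⟨y / b, ?_, by field_simp⟩
    field_simp
    linear_combination hdet

theorem cobCoeff_ne_zero (hd : s + d + 1 = p) (hd2 : 2 ≤ d) (h : s ≠ 0 ∨ c ≠ 0) :
    cobCoeff p s c 1 ≠ 0 ∨ cobCoeff p s c 2 ≠ 0 := by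
  by_contra! h0
  obtain ⟨h1, h2⟩ := h0
  rw [cobCoeff, if_pos (by omega)] at h1 h2
  push_cast at h1 h2
  have hc : c = 0 := by linear_combination h2 - h1
  have hs : (s : k) = 0 := by linear_combination 3 * h1 - 2 * h2
  rcases h with h | h
  · exact natCast_ne_zero_of_lt k p h (by omega) hs
  · exact h hc

/-- The sequence with the given first six terms, and zero afterwards. -/
def ofCoeffs (a b x y z w : k) : ℕ → k
  | 1 => a
  | 2 => b
  | 3 => x
  | 4 => y
  | 5 => z
  | 6 => w
  | _ => 0

theorem ofCoeffs_of_lt (a b x y z w : k) {r : ℕ} (hr : 6 < r) : ofCoeffs a b x y z w r = 0 := by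
  obtain ⟨n, rfl⟩ := Nat.exists_eq_add_of_lt hr
  rw [show 6 + n + 1 = n + 7 by ring]
  rfl

/-- A sequence solving `(j - 1) C (j + 1) = (j - 1 + e) C j` from `j = 2` on is determined by `C 2`. -/
theorem eq_of_recurrence {C f : ℕ → k} {e : k} {m : ℕ} (hm : m ≤ p)
    (hC : ∀ j, 2 ≤ j → j + 1 ≤ m → C j * (j - 1 + e) = (j - 1) * C (j + 1))
    (hf : ∀ j, 2 ≤ j → f j * (j - 1 + e) = (j - 1) * f (j + 1)) (hf2 : f 2 = 1)
    {j : ℕ} (hj : 2 ≤ j) (hjm : j ≤ m) : C j = C 2 * f j := by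
  induction j, hj using Nat.le_induction with
  | base => rw [hf2, mul_one]
  | succ j hj ih =>
    have h1 : ((j - 1 : ℕ) : k) ≠ 0 := natCast_ne_zero_of_lt k p (by omega) (by omega)
    rw [Nat.cast_sub (by omega), Nat.cast_one] at h1
    refine mul_left_cancel₀ h1 ?_
    rw [← hC j hj hjm, ih (by omega), mul_left_comm, ← hf j hj]
    ring

end Solutions

/-! ### The solution spaces -/

section SolutionSpaces

variable {k : Type u} [Field k] {p : ℕ} [hp : Fact p.Prime] [CharP k p] {s d : ℕ} {c : k} {C : ℕ → k}

namespace IsSolution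

/-- `C 5` can be computed from `[e 2, e 3] = e 5` and from `[e 1, e 4] = 3 e 5`; comparing the two
and eliminating `C 3`, `C 4` gives one equation on `(C 1, C 2)`. Its linear factor is the
determinant against the coboundary pair, as it must vanish on coboundaries. -/
theorem quadratic_mul_det (hC : IsSolution p s c C) (hd : s + d + 1 = p) (h5 : 5 ≤ d) :
    ((2 * c - 2 - d) ^ 2 + 2 * (2 * c - 2 - d) - 3 * d) *
      ((3 * c - 1 - d) * C 1 - (2 * c - 1 - d) * C 2) = 0 := by
  have h12 := hC.low hd 1 2 3 (by simp) (by simp) rfl (by omega)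
  have h13 := hC.low hd 1 3 4 (by simp) (by simp) rfl (by omega)
  have h14 := hC.low hd 1 4 5 (by simp) (by simp) rfl (by omega)
  have h23 := hC.low hd 2 3 5 (by simp) (by simp) rfl (by omega)
  push_cast at h12 h13 h14 h23
  linear_combination 6 * h23 - 2 * h14 - (3 - d + 2 * c) * h13
    + (6 * (2 - d + 3 * c) - (3 - d + 2 * c) * (2 - d + 2 * c)) * h12

/-- `C 7` is computed from `[e 3, e 4] = e 7` and from `[e 1, e 6] = 5 e 7`. Modulo the relation of
degree 5, the difference reduces to `9 d (d - 1)` times the determinant, and `7 ≤ d < p` makes this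
factor invertible. -/
theorem det_eq_zero (hC : IsSolution p s c C) (hd : s + d + 1 = p) (h7 : 7 ≤ d) :
    (3 * c - 1 - d) * C 1 - (2 * c - 1 - d) * C 2 = 0 := by
  have h12 := hC.low hd 1 2 3 (by simp) (by simp) rfl (by omega)
  have h13 := hC.low hd 1 3 4 (by simp) (by simp) rfl (by omega)
  have h14 := hC.low hd 1 4 5 (by simp) (by simp) rfl (by omega)
  have h15 := hC.low hd 1 5 6 (by simp) (by simp) rfl (by omega)
  have h16 := hC.low hd 1 6 7 (by simp) (by simp) rfl (by omega)
  have h34 := hC.low hd 3 4 7 (by simp) (by simp) rfl (by omega)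
  have hq := hC.quadratic_mul_det hd (by omega)
  push_cast at h12 h13 h14 h15 h16 h34
  set D : k := (d : k) with hD
  have key : 9 * (D * (D - 1)) * ((3 * c - 1 - D) * C 1 - (2 * c - 1 - D) * C 2) = 0 := by
    linear_combination 120 * h34 - 24 * h16 - 6 * (5 - D + 2 * c) * h15
      - 2 * (5 - D + 2 * c) * (4 - D + 2 * c) * h14
      + (60 * (3 - D + 4 * c) - (5 - D + 2 * c) * (4 - D + 2 * c) * (3 - D + 2 * c)) * h13
      + (-120 * (2 - D + 5 * c) + (60 * (3 - D + 4 * c)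
        - (5 - D + 2 * c) * (4 - D + 2 * c) * (3 - D + 2 * c)) * (2 - D + 2 * c)) * h12
      - ((2 * c - 2 - D) ^ 2 + 22 * (2 * c - 2 - D) + 3 * D + 57) * hq
  have h3 : (3 : k) ≠ 0 := by exact_mod_cast natCast_ne_zero_of_lt k p (n := 3) (by simp) (by omega)
  have h0 : D ≠ 0 := natCast_ne_zero_of_lt k p (by omega) (by omega)
  have h1 : D - 1 ≠ 0 := by
    have := natCast_ne_zero_of_lt k p (n := d - 1) (by omega) (by omega)
    rwa [Nat.cast_sub (by omega), Nat.cast_one] at this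
  refine (mul_eq_zero.1 key).resolve_left (mul_ne_zero ?_ (mul_ne_zero h0 h1))
  rw [show (9 : k) = 3 * 3 by norm_num]
  exact mul_ne_zero h3 h3

/-- Here `s ≡ -1`, and generically a solution is forced to be `C j = t (c (j + 1) - 1)`, the formal
coboundary of `t x⁻¹`. The condition `C (p - 1) = 0` then reads `t = 0`. -/
theorem top_eq_zero (hC : IsSolution p s c C) (hd : s + 0 + 1 = p) (h5 : 5 ≤ p) (hc0 : c ≠ 0)
    (hc1 : c ≠ 1) : C 1 = 0 ∧ C 2 = 0 := by
  have n2 : (2 : k) ≠ 0 := by exact_mod_cast natCast_ne_zero_of_lt k p (n := 2) (by simp) (by omega)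
  have hp1 : C (p - 1) = 0 := hC.zero _ (by omega)
  have cp1 : ((p - 1 : ℕ) : k) = -1 := by
    rw [Nat.cast_sub (by omega), CharP.cast_eq_zero, Nat.cast_one, zero_sub]
  have hrec : ∀ j, 2 ≤ j → j + 1 ≤ p →
      C j * (j - 1 + 2 * c) - C 1 * (c * (j + 1)) = (j - 1) * C (j + 1) := by
    intro j hj hjp
    have h := hC.high (d := 0) hd 1 j (j + 1) (by omega) (by omega) (add_comm _ _) (by omega)
    push_cast at h
    linear_combination h
  -- If `2 c = 1`, the parameter `t` cannot be read off `C 1`; but then the product in the `p`-th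
  -- power condition is `(p - 1)!`, which forces `C 1 = 0`.
  by_cases h2c : 2 * c = 1
  · have hpw := hC.pow (by omega)
    rw [h2c] at hpw
    have h1 : C 1 = 0 := by
      refine (mul_eq_zero.1 hpw).resolve_left (Finset.prod_ne_zero_iff.2 fun j hj => ?_)
      have := Finset.mem_range.1 hj
      exact_mod_cast natCast_ne_zero_of_lt k p (n := j + 1) (by omega) (by omega)
    refine ⟨h1, ?_⟩
    have h := eq_of_recurrence (C := C) (f := fun j => (j : k) - 1) (e := 1) le_rfl
      (fun j hj hjp => by rw [← hrec j hj hjp, h1, h2c, zero_mul, sub_zero])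
      (fun j _ => by push_cast; ring) (by norm_num) (j := p - 1) (by omega) (by omega)
    rw [hp1, cp1] at h
    refine (mul_eq_zero.1 h.symm).resolve_right ?_
    rw [show (-1 - 1 : k) = -2 by norm_num]
    exact neg_ne_zero.2 n2
  · have hne : 2 * c - 1 ≠ 0 := fun h => h2c (sub_eq_zero.1 h)
    obtain ⟨t, ht⟩ : ∃ t, C 1 = t * (2 * c - 1) := ⟨C 1 / (2 * c - 1), by field_simp⟩
    have h12 := hrec 2 le_rfl (by omega)
    have h13 := hrec 3 (by omega) (by omega)
    have h14 := hrec 4 (by omega) (by omega)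
    have h23 := hC.high (d := 0) hd 2 3 5 (by omega) (by omega) rfl (by omega)
    push_cast at h12 h13 h14 h23
    rw [ht] at h12 h13 h14
    have key : (2 * 2) * (c * (c - 1) * (2 * c - 1)) * (C 2 - t * (3 * c - 1)) = 0 := by
      linear_combination 2 * h14 - 6 * h23 + (3 + 2 * c) * h13
        + ((3 + 2 * c) * (2 + 2 * c) - 6 * (2 + 3 * c)) * h12
    have hC2 : C 2 = t * (3 * c - 1) := sub_eq_zero.1 ((mul_eq_zero.1 key).resolve_left
      (mul_ne_zero (mul_ne_zero n2 n2) (mul_ne_zero (mul_ne_zero hc0 (sub_ne_zero.2 hc1)) hne)))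
    have hall : ∀ j, 2 ≤ j → j ≤ p → C j = t * (c * (j + 1) - 1) := by
      intro j hj
      induction j, hj using Nat.le_induction with
      | base =>
        intro
        rw [hC2]
        push_cast
        ring
      | succ j hj ih =>
        intro hjp
        have h1 : ((j - 1 : ℕ) : k) ≠ 0 := natCast_ne_zero_of_lt k p (by omega) (by omega)
        rw [Nat.cast_sub (by omega), Nat.cast_one] at h1
        refine mul_left_cancel₀ h1 ?_
        rw [← hrec j hj hjp, ih (by omega), ht]
        push_cast
        ring
    have h := hall (p - 1) (by omega) (by omega)
    rw [hp1, cp1] at h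
    have ht0 : t = 0 := by linear_combination h
    rw [ht, hC2, ht0, zero_mul, zero_mul]
    exact ⟨rfl, rfl⟩

/-- With `C 1 = 0` the recurrence gives `C j = C 2` for `c = 0` and `C j = C 2 · j (j - 1) / 2` for
`c = 1`. Neither factor vanishes at `j = p - 1`, whereas `C (p - 1) = 0`. -/
theorem top_eq_zero_of_apply_one (hC : IsSolution p s c C) (hd : s + 0 + 1 = p) (h5 : 5 ≤ p)
    (hc : c = 0 ∨ c = 1) (h1 : C 1 = 0) : C 2 = 0 := by
  have n2 : (2 : k) ≠ 0 := by exact_mod_cast natCast_ne_zero_of_lt k p (n := 2) (by simp) (by omega)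
  have hp1 : C (p - 1) = 0 := hC.zero _ (by omega)
  have cp1 : ((p - 1 : ℕ) : k) = -1 := by
    rw [Nat.cast_sub (by omega), CharP.cast_eq_zero, Nat.cast_one, zero_sub]
  have hrec : ∀ j, 2 ≤ j → j + 1 ≤ p → C j * (j - 1 + 2 * c) = (j - 1) * C (j + 1) := by
    intro j hj hjp
    have h := hC.high (d := 0) hd 1 j (j + 1) (by omega) (by omega) (add_comm _ _) (by omega)
    rw [h1] at h
    push_cast at h
    linear_combination h
  rcases hc with rfl | rfl
  · have h := eq_of_recurrence (C := C) (f := fun _ => 1) le_rfl hrec (fun j _ => by ring) rfl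
      (j := p - 1) (by omega) (by omega)
    rw [← mul_one (C 2), ← h, hp1]
  · have h := eq_of_recurrence (C := C) (f := fun j => (j : k) * (j - 1) / 2) le_rfl hrec
      (fun j _ => by push_cast; ring) (by push_cast; field_simp; ring) (j := p - 1) (by omega) (by omega)
    rw [hp1, cp1] at h
    field_simp at h
    refine (mul_eq_zero.1 (?_ : (2 : k) * C 2 = 0)).resolve_left n2
    linear_combination -h

/-- This is the relation of degree 5 again, free of `C 1` because `e j` sends `x ^ (p - 1)` to zero.
-/
theorem subtop_mul_eq_zero (hC : IsSolution p s c C) (hd : s + 1 + 1 = p) (h5 : 5 ≤ p) :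
    c * (c - 1) * (c - 2) * C 2 = 0 := by
  have n2 : (2 : k) ≠ 0 := by exact_mod_cast natCast_ne_zero_of_lt k p (n := 2) (by simp) (by omega)
  have h12 := hC.mixed hd 1 2 3 (by simp) (by simp) (by simp) rfl (by omega)
  have h13 := hC.mixed hd 1 3 4 (by simp) (by simp) (by simp) rfl (by omega)
  have h14 := hC.mixed hd 1 4 5 (by simp) (by simp) (by simp) rfl (by omega)
  have h23 := hC.high hd 2 3 5 (by simp) (by simp) rfl (by omega)
  push_cast at h12 h13 h14 h23
  have key : (2 * (2 * 2)) * (c * (c - 1) * (c - 2) * C 2) = 0 := by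
    linear_combination 2 * h14 - 6 * h23 + (2 + 2 * c) * h13
      + ((2 + 2 * c) * (1 + 2 * c) - 6 * (1 + 3 * c)) * h12
  exact (mul_eq_zero.1 key).resolve_left (mul_ne_zero n2 (mul_ne_zero n2 n2))

/-- For `c = 1` degree 5 gives nothing; instead the recurrence `C j = (j - 1) C 2` runs up to `C (p
- 1) = 0`. -/
theorem subtop_eq_zero (hC : IsSolution p s (1 : k) C) (hd : s + 1 + 1 = p) (h5 : 5 ≤ p) :
    C 2 = 0 := by
  have n2 : (2 : k) ≠ 0 := by exact_mod_cast natCast_ne_zero_of_lt k p (n := 2) (by simp) (by omega)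
  have h := eq_of_recurrence (C := C) (f := fun j => (j : k) - 1) (e := 1) le_rfl
    (fun j hj hjp => by
      have h := hC.mixed hd 1 j (j + 1) (by simp) (by simp) (by omega) (add_comm _ _) (by omega)
      push_cast at h
      linear_combination h)
    (fun j _ => by push_cast; ring) (by norm_num) (j := p - 1) (by omega) (by omega)
  rw [hC.zero _ (by omega), Nat.cast_sub (by omega), CharP.cast_eq_zero] at h
  push_cast at h
  refine (mul_eq_zero.1 h.symm).resolve_right ?_
  rw [show (0 - 1 - 1 : k) = -2 by norm_num]
  exact neg_ne_zero.2 n2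

theorem bottom_eq_zero (hC : IsSolution p 0 (0 : k) C) (h5 : 5 ≤ p) (h1 : C 1 = 0) : C 2 = 0 := by
  have n2 : (2 : k) ≠ 0 := by exact_mod_cast natCast_ne_zero_of_lt k p (n := 2) (by simp) (by omega)
  have cp1 : ((p - 1 : ℕ) : k) = -1 := by
    rw [Nat.cast_sub (by omega), CharP.cast_eq_zero, Nat.cast_one, zero_sub]
  have h := eq_of_recurrence (C := C) (f := fun j => (j : k) - 1) (e := 1) (m := p - 1) (by omega)
    (fun j hj hjp => by
      have h := hC.low (d := p - 1) (by omega) 1 j (j + 1) (by simp) (by omega) (add_comm _ _) hjp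
      rw [cp1, h1] at h
      push_cast at h
      linear_combination h)
    (fun j _ => by push_cast; ring) (by norm_num) (j := p - 1) (by omega) le_rfl
  rw [hC.zero _ (by omega), cp1] at h
  refine (mul_eq_zero.1 h.symm).resolve_right ?_
  rw [show (-1 - 1 : k) = -2 by norm_num]
  exact neg_ne_zero.2 n2

/-- For `p = 5` one has `e 4 = 0`, so `[e 1, e 3] = 0` is already a relation in degree 4. The last
summand of the combination collects multiples of `5`. -/
theorem det_of_five (hC : IsSolution p 0 c C) (h5 : p = 5) : (c ^ 2 - 1) * (C 1 + C 2) = 0 := by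
  have h12 := hC.low (d := 4) (by omega) 1 2 3 (by simp) (by simp) rfl (by omega)
  have h13 := hC.low (d := 4) (by omega) 1 3 4 (by simp) (by simp) rfl (by omega)
  have h4 : C 4 = 0 := hC.zero _ (by omega)
  have n5 : (5 : k) = 0 := by exact_mod_cast h5 ▸ CharP.cast_eq_zero k p
  rw [h4] at h13
  push_cast at h12 h13
  linear_combination -h13 - (-2 + 2 * c) * h12
    + (C 1 * (c ^ 2 - 1) + 2 * c * C 1 - 2 * c * C 2 - 2 * c ^ 2 * C 1 + c ^ 2 * C 2 + C 2) * n5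

end IsSolution

/-! ### Explicit cocycles -/

section Existence

theorem ofCoeffs_eq_zero {a b x y z w : k} (r : ℕ)
    (h : ∀ r, r ≤ 6 → d < r → ofCoeffs a b x y z w r = 0) (hr : d < r) :
    ofCoeffs a b x y z w r = 0 := by
  rcases le_or_gt r 6 with h6 | h6
  · exact h r h6 hr
  · exact ofCoeffs_of_lt _ _ _ _ _ _ h6

theorem isSolution_ofCoeffs {a b x y z w : k} (hd : s + d + 1 = p) (hs : s ≠ 0) (hd0 : d ≠ 0)
    (h0 : ∀ r, r ≤ 6 → d < r → ofCoeffs a b x y z w r = 0)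
    (h : ∀ i j, i ≠ 0 → i < j → i + j ≤ d →
      ofCoeffs a b x y z w j * (j - 1 - d + c * (i + 1))
        - ofCoeffs a b x y z w i * (i - 1 - d + c * (j + 1))
        = ((j : k) - i) * ofCoeffs a b x y z w (i + j)) :
    IsSolution p s c (ofCoeffs a b x y z w) :=
  .of_low hd hd0 (fun r hr => ofCoeffs_eq_zero r h0 (by omega)) (fun r => ofCoeffs_eq_zero r h0) h

theorem exists_isSolution_two (hd : s + 2 + 1 = p) (hs : s ≠ 0) (a b : k) :
    ∃ C, IsSolution p s c C ∧ C 1 = a ∧ C 2 = b := by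
  refine ⟨ofCoeffs a b 0 0 0 0, isSolution_ofCoeffs hd hs (by simp) ?_ ?_, rfl, rfl⟩
  · intro r h6 hr
    interval_cases r <;> rfl
  · intro i j hi hij hijd
    omega

theorem exists_isSolution_three (hd : s + 3 + 1 = p) (hs : s ≠ 0) (a b : k) :
    ∃ C, IsSolution p s c C ∧ C 1 = a ∧ C 2 = b := by
  refine ⟨ofCoeffs a b (b * (-2 + 2 * c) - a * (-3 + 3 * c)) 0 0 0,
    isSolution_ofCoeffs hd hs (by simp) ?_ ?_, rfl, rfl⟩
  · intro r h6 hr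
    interval_cases r <;> rfl
  · intro i j hi hij hijd
    obtain ⟨rfl, rfl⟩ : i = 1 ∧ j = 2 := by omega
    simp only [ofCoeffs]
    push_cast
    ring

/-- Up to degree 4 there is one bracket in each degree, so `C 3` and `C 4` are simply defined by `[e
1, e 2]` and `[e 1, e 3]`. -/
theorem exists_isSolution_four (hd : s + 4 + 1 = p) (hs : s ≠ 0) (h7 : 7 ≤ p) (a b : k) :
    ∃ C, IsSolution p s c C ∧ C 1 = a ∧ C 2 = b := by
  have n2 : (2 : k) ≠ 0 := by exact_mod_cast natCast_ne_zero_of_lt k p (n := 2) (by simp) (by omega)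
  obtain ⟨x, hx⟩ : ∃ x, b * (-3 + 2 * c) - a * (-4 + 3 * c) = x := ⟨_, rfl⟩
  obtain ⟨y, hy⟩ : ∃ y, x * (-2 + 2 * c) - a * (-4 + 4 * c) = 2 * y :=
    ⟨(x * (-2 + 2 * c) - a * (-4 + 4 * c)) / 2, by field_simp⟩
  refine ⟨ofCoeffs a b x y 0 0, isSolution_ofCoeffs hd hs (by simp) ?_ ?_, rfl, rfl⟩
  · intro r h6 hr
    interval_cases r <;> rfl
  · intro i j hi hij hijd
    obtain ⟨rfl, rfl⟩ | ⟨rfl, rfl⟩ : i = 1 ∧ j = 2 ∨ i = 1 ∧ j = 3 := by omega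
    all_goals
      simp only [ofCoeffs]
      push_cast
    · linear_combination hx
    · linear_combination hy

theorem exists_isSolution_five (hd : s + 5 + 1 = p) (hs : s ≠ 0) (h7 : 7 ≤ p)
    (hc : c = 1 ∨ c = 5) (a b : k) : ∃ C, IsSolution p s c C ∧ C 1 = a ∧ C 2 = b := by
  have n2 : (2 : k) ≠ 0 := by exact_mod_cast natCast_ne_zero_of_lt k p (n := 2) (by simp) (by omega)
  have hq : (c - 1) * (c - 5) = 0 := by
    rcases hc with rfl | rfl <;> ring
  obtain ⟨x, hx⟩ : ∃ x, b * (-4 + 2 * c) - a * (-5 + 3 * c) = x := ⟨_, rfl⟩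
  obtain ⟨y, hy⟩ : ∃ y, x * (-3 + 2 * c) - a * (-5 + 4 * c) = 2 * y :=
    ⟨(x * (-3 + 2 * c) - a * (-5 + 4 * c)) / 2, by field_simp⟩
  obtain ⟨z, hz⟩ : ∃ z, x * (-3 + 3 * c) - b * (-4 + 4 * c) = z := ⟨_, rfl⟩
  refine ⟨ofCoeffs a b x y z 0, isSolution_ofCoeffs hd hs (by simp) ?_ ?_, rfl, rfl⟩
  · intro r h6 hr
    obtain rfl : r = 6 := by omega
    rfl
  · intro i j hi hij hijd
    obtain ⟨rfl, rfl⟩ | ⟨rfl, rfl⟩ | ⟨rfl, rfl⟩ | ⟨rfl, rfl⟩ :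
      i = 1 ∧ j = 2 ∨ i = 1 ∧ j = 3 ∨ i = 1 ∧ j = 4 ∨ i = 2 ∧ j = 3 := by omega
    all_goals
      simp only [ofCoeffs]
      push_cast
    · linear_combination hx
    · linear_combination hy
    -- `C 5` was defined by `[e 2, e 3]`; its compatibility with `[e 1, e 4]` is the relation of
    -- degree 5, which holds by `hq`.
    · refine mul_left_cancel₀ n2 ?_
      linear_combination 6 * hz - (-2 + 2 * c) * hy + (6 * (-3 + 3 * c) - (-2 + 2 * c) * (-3 + 2 * c)) * hx
        - 4 * ((3 * c - 6) * a - (2 * c - 6) * b) * hq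
    · linear_combination hz

/-- The hypothesis `hq` is half the quadratic factor of `quadratic_mul_det` at `d = 6`. It is needed
only for `[e 1, e 4]`: with `C 6` defined by `[e 2, e 4]`, the equation for `[e 1, e 5]` follows
from the others. -/
theorem exists_isSolution_six (hd : s + 6 + 1 = p) (hs : s ≠ 0)
    (hq : 2 * (c - 1) ^ 2 - 10 * (c - 1) + 3 = 0) (a b : k) :
    ∃ C, IsSolution p s c C ∧ C 1 = a ∧ C 2 = b := by
  have n2 : (2 : k) ≠ 0 := by exact_mod_cast natCast_ne_zero_of_lt k p (n := 2) (by simp) (by omega)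
  obtain ⟨x, hx⟩ : ∃ x, b * (-5 + 2 * c) - a * (-6 + 3 * c) = x := ⟨_, rfl⟩
  obtain ⟨y, hy⟩ : ∃ y, x * (-4 + 2 * c) - a * (-6 + 4 * c) = 2 * y :=
    ⟨(x * (-4 + 2 * c) - a * (-6 + 4 * c)) / 2, by field_simp⟩
  obtain ⟨z, hz⟩ : ∃ z, x * (-4 + 3 * c) - b * (-5 + 4 * c) = z := ⟨_, rfl⟩
  obtain ⟨w, hw⟩ : ∃ w, y * (-3 + 3 * c) - b * (-5 + 5 * c) = 2 * w :=
    ⟨(y * (-3 + 3 * c) - b * (-5 + 5 * c)) / 2, by field_simp⟩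
  refine ⟨ofCoeffs a b x y z w, isSolution_ofCoeffs hd hs (by simp) ?_ ?_, rfl, rfl⟩
  · intro r h6 hr
    omega
  · intro i j hi hij hijd
    obtain ⟨rfl, rfl⟩ | ⟨rfl, rfl⟩ | ⟨rfl, rfl⟩ | ⟨rfl, rfl⟩ | ⟨rfl, rfl⟩ | ⟨rfl, rfl⟩ :
      i = 1 ∧ j = 2 ∨ i = 1 ∧ j = 3 ∨ i = 1 ∧ j = 4 ∨ i = 1 ∧ j = 5 ∨ i = 2 ∧ j = 3 ∨ i = 2 ∧ j = 4 := by
      omega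
    all_goals
      simp only [ofCoeffs]
      push_cast
    · linear_combination hx
    · linear_combination hy
    · refine mul_left_cancel₀ n2 ?_
      linear_combination 6 * hz - (-3 + 2 * c) * hy + (6 * (-4 + 3 * c) - (-3 + 2 * c) * (-4 + 2 * c)) * hx
        - 2 * ((3 * c - 7) * a - (2 * c - 7) * b) * hq
    · linear_combination 2 * hw + (3 * c - 3) * hy - (2 * c - 2) * hz
        + ((3 * c - 3) * (2 * c - 4) - (2 * c - 2) * (3 * c - 4)) * hx
    · linear_combination hz
    · linear_combination hw

/-- For `c = 0` the constants are invariant, and `e 1` is not in the derived algebra of the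
nilradical, so `e 1 ↦ 1` is a cocycle. -/
theorem exists_isSolution_top_zero (hd : s + 0 + 1 = p) (h5 : 5 ≤ p) :
    ∃ C, IsSolution p s (0 : k) C ∧ C 1 = 1 := by
  refine ⟨ofCoeffs 1 0 0 0 0 0, ?_, rfl⟩
  have h0 : ∀ r, 1 < r → ofCoeffs (1 : k) 0 0 0 0 0 r = 0 := fun r hr =>
    ofCoeffs_eq_zero (d := 1) r (fun r h6 hr => by interval_cases r <;> rfl) hr
  refine .of_high (d := 0) hd (by simp) (fun r hr => h0 r (by omega)) (fun r hr hr0 => by omega) ?_ ?_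
  · intro
    rw [Finset.prod_eq_zero (Finset.mem_range.2 (by omega : 0 < p - 1)) (by simp), zero_mul]
  · intro i j hi hij _
    rw [h0 (i + j) (by omega), h0 j (by omega)]
    by_cases hi1 : i = 1
    · subst hi1
      push_cast
      ring
    · rw [h0 i (by omega)]
      ring

/-- The sequence `f` cut off at `p - 1`. -/
def truncated (p : ℕ) (f : ℕ → k) (r : ℕ) : k := if p ≤ r + 1 then 0 else f r

theorem truncated_of_le {f : ℕ → k} {r : ℕ} (hr : p ≤ r + 1) : truncated p f r = 0 := if_pos hr

/-- The polynomials used below vanish modulo `p` at the indices just past the cut-off, so the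
cocycle equations reduce to polynomial identities. -/
theorem truncated_eq {f : ℕ → k} {m : ℕ} (hf : ∀ r, p ≤ r + 1 → r ≤ m → f r = 0) {r : ℕ}
    (hr : r ≤ m) : truncated p f r = f r := by
  rw [truncated]
  split_ifs with h
  · exact (hf r h hr).symm
  · rfl

theorem cast_sub_one : ((p - 1 : ℕ) : k) = -1 := by
  rw [Nat.cast_sub hp.out.one_le, CharP.cast_eq_zero, Nat.cast_one, zero_sub]

/-- The cocycle is `f ∂ ↦ f'' dx` with values in densities of weight 1, evaluated at `f = x ^ (r +
1)`. -/
theorem exists_isSolution_top_one (hd : s + 0 + 1 = p) (h5 : 5 ≤ p) :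
    ∃ C, IsSolution p s (1 : k) C ∧ C 1 = 2 := by
  have hf : ∀ {r}, r ≤ p → truncated p (fun r => (r : k) * (r + 1)) r = r * (r + 1) :=
    truncated_eq fun r h1 h2 => by
      obtain rfl | rfl : r = p - 1 ∨ r = p := by omega
      · rw [cast_sub_one]; ring
      · rw [CharP.cast_eq_zero, zero_mul]
  refine ⟨truncated p (fun r => (r : k) * (r + 1)), .of_high (d := 0) hd (by simp) (fun r hr => truncated_of_le hr) (fun r hr hr0 => by omega) ?_ ?_, ?_⟩
  · intro
    rw [Finset.prod_eq_zero (Finset.mem_range.2 (by omega : p - 2 < p - 1)), zero_mul]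
    rw [Nat.cast_sub hp.out.two_le, CharP.cast_eq_zero]
    push_cast
    ring
  · intro i j hi hij hijp
    rw [hf (by omega), hf (by omega), hf (by omega)]
    push_cast
    ring
  · rw [hf (by omega)]
    push_cast
    ring

/-- The cocycle is `e 1 ↦ x ^ (p - 1)`, whose value is killed by the nilradical for every `c`. -/
theorem exists_isSolution_subtop_one (hd : s + 1 + 1 = p) (h5 : 5 ≤ p) :
    ∃ C, IsSolution p s c C ∧ C 1 = 1 := by
  have h0 : ∀ r, 1 < r → ofCoeffs (1 : k) 0 0 0 0 0 r = 0 := fun r hr =>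
    ofCoeffs_eq_zero (d := 1) r (fun r h6 hr => by interval_cases r <;> rfl) hr
  exact ⟨ofCoeffs 1 0 0 0 0 0, .of_low hd (by simp) (fun r hr => h0 r (by omega)) h0
    (fun i j hi hij hijd => by omega), rfl⟩

/-- The cocycle is `e 2 ↦ 1`: the constants are invariant for `c = 0`, and `e 2` is not a bracket of
elements of the nilradical. -/
theorem exists_isSolution_subtop_zero (hd : s + 1 + 1 = p) (h5 : 5 ≤ p) :
    ∃ C, IsSolution p s (0 : k) C ∧ C 2 = 1 := by
  have h0 : ∀ r, 2 < r → ofCoeffs (0 : k) 1 0 0 0 0 r = 0 := fun r hr =>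
    ofCoeffs_eq_zero (d := 2) r (fun r h6 hr => by interval_cases r <;> rfl) hr
  have h1 : ∀ r : ℕ, r ≠ 0 → ofCoeffs (0 : k) 1 0 0 0 0 r * (r - 2) = 0 := by
    intro r hr
    rcases lt_or_ge 2 r with h | h
    · rw [h0 r h, zero_mul]
    · obtain rfl | rfl : r = 1 ∨ r = 2 := by omega
      · exact zero_mul _
      · rw [Nat.cast_ofNat, sub_self, mul_zero]
  refine ⟨ofCoeffs 0 1 0 0 0 0, .of_high hd le_rfl (fun r hr => h0 r (by omega)) ?_ (by omega) ?_, rfl⟩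
  · intro r hr hr1
    obtain rfl : r = 1 := by omega
    rfl
  · intro i j hi hij hijp
    rw [h0 (i + j) (by omega)]
    push_cast
    linear_combination h1 j (by omega) - h1 i hi

/-- The cocycle is `f ∂ ↦ f''' dx²` with values in quadratic differentials, since `(r + 1) r (r - 1)
= r³ - r`. -/
theorem exists_isSolution_subtop_two (hd : s + 1 + 1 = p) (h5 : 5 ≤ p) :
    ∃ C, IsSolution p s (2 : k) C ∧ C 2 = 6 := by
  have hf : ∀ {r}, r ≤ p + 1 → truncated p (fun r => (r : k) ^ 3 - r) r = r ^ 3 - r :=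
    truncated_eq fun r h1 h2 => by
      obtain rfl | rfl | rfl : r = p - 1 ∨ r = p ∨ r = p + 1 := by omega
      · rw [cast_sub_one]; ring
      · rw [CharP.cast_eq_zero]; ring
      · rw [Nat.cast_add, CharP.cast_eq_zero]; push_cast; ring
  refine ⟨truncated p (fun r => (r : k) ^ 3 - r), .of_high hd le_rfl (fun r hr => truncated_of_le hr) ?_ (by omega) ?_, ?_⟩
  · intro r hr hr1
    obtain rfl : r = 1 := by omega
    rw [hf (by omega)]
    push_cast
    ring
  · intro i j hi hij hijp
    rw [hf (by omega), hf (by omega), hf (by omega)]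
    push_cast
    ring
  · rw [hf (by omega)]
    push_cast
    norm_num

/-- The cocycle is the divergence `f ∂ ↦ f'` with values in functions. -/
theorem exists_isSolution_bottom (h5 : 5 ≤ p) : ∃ C, IsSolution p 0 (0 : k) C ∧ C 1 = 2 := by
  have hf : ∀ {r}, r ≤ p - 1 → truncated p (fun r => (r : k) + 1) r = r + 1 :=
    truncated_eq fun r h1 h2 => by
      obtain rfl : r = p - 1 := by omega
      rw [cast_sub_one]; ring
  refine ⟨truncated p (fun r => (r : k) + 1), .of_low (d := p - 1) (by omega) (by omega) (fun r hr => truncated_of_le hr)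
    (fun r hr => truncated_of_le (by omega)) ?_, ?_⟩
  · intro i j hi hij hijp
    rw [hf (by omega), hf (by omega), hf (by omega), cast_sub_one]
    push_cast
    ring
  · rw [hf (by omega)]
    push_cast
    norm_num

theorem exists_isSolution_of_five (h5 : p = 5) (hc : c ^ 2 = 1) (a b : k) :
    ∃ C, IsSolution p 0 c C ∧ C 1 = a ∧ C 2 = b := by
  have n5 : (5 : k) = 0 := by exact_mod_cast h5 ▸ CharP.cast_eq_zero k p
  have h0 : ∀ x : k, ∀ r, 3 < r → ofCoeffs a b x 0 0 0 r = 0 := fun x r hr =>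
    ofCoeffs_eq_zero (d := 3) r (fun r h6 hr => by interval_cases r <;> rfl) hr
  refine ⟨ofCoeffs a b (b * (-3 + 2 * c) - a * (-4 + 3 * c)) 0 0 0, .of_low (d := 4) (by omega) (by simp)
    (fun r hr => h0 _ r (by omega)) (fun r hr => h0 _ r (by omega)) ?_, rfl, rfl⟩
  intro i j hi hij hijd
  obtain ⟨rfl, rfl⟩ | ⟨rfl, rfl⟩ : i = 1 ∧ j = 2 ∨ i = 1 ∧ j = 3 := by omega
  all_goals
    simp only [ofCoeffs]
    push_cast
  · ring
  · linear_combination (-a - b) * hc + (b - 2 * b * c + b * c ^ 2 + 2 * c * a - c ^ 2 * a - a) * n5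

end Existence

end SolutionSpaces

/-! ### Extensions by difference of weights -/

section Classification

variable {k : Type u} [Field k] {p : ℕ} [hp : Fact p.Prime] [CharP k p] {mu lam : ZMod p} {s d : ℕ}

theorem subsingleton_extVerma_of_det (hd : s + d + 1 = p) (hw : (s : k) + (wt k lam + 1) = wt k mu)
    (hd2 : 2 ≤ d) (hne : s ≠ 0 ∨ wt k lam + 1 ≠ 0)
    (h : ∀ C, IsSolution p s (wt k lam + 1) C →
      (3 * (wt k lam + 1) - 1 - d) * C 1 - (2 * (wt k lam + 1) - 1 - d) * C 2 = 0) :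
    Subsingleton (ExtVerma k mu lam) := by
  refine subsingleton_extVerma (by omega) hw fun C hC =>
    exists_eq_mul (cobCoeff_ne_zero hd hd2 hne) ?_
  rw [cobCoeff_of_le hd (i := 1) (by omega), cobCoeff_of_le hd hd2, ← h C hC]
  push_cast
  ring

/-- The whole plane of pairs is admissible and the coboundaries form a line in it; the functional is
the determinant against the coboundary pair. -/
theorem extVerma_equiv_of_forall (hd : s + d + 1 = p) (hw : (s : k) + (wt k lam + 1) = wt k mu)
    (hd2 : 2 ≤ d) (hne : s ≠ 0 ∨ wt k lam + 1 ≠ 0)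
    (h : ∀ a b, ∃ C, IsSolution p s (wt k lam + 1) C ∧ C 1 = a ∧ C 2 = b) :
    Nonempty (ExtVerma k mu lam ≃ₗ[k] k) := by
  have hcob := cobCoeff_ne_zero hd hd2 hne
  refine extVerma_equiv (by omega) hw (cobCoeff p s (wt k lam + 1) 2)
    (-cobCoeff p s (wt k lam + 1) 1) (by ring) ?_ fun C hC hC0 => exists_eq_mul hcob ?_
  · rcases hcob with h0 | h0
    · obtain ⟨C, hC, h1, h2⟩ := h 0 1
      refine ⟨C, hC, ?_⟩
      rw [h1, h2, mul_zero, zero_add, mul_one]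
      exact neg_ne_zero.2 h0
    · obtain ⟨C, hC, h1, h2⟩ := h 1 0
      refine ⟨C, hC, ?_⟩
      rwa [h1, h2, mul_zero, add_zero, mul_one]
  · rw [← hC0]
    ring

theorem extVerma_top (hd : s + 0 + 1 = p) (hw : (s : k) + (wt k lam + 1) = wt k mu) (h5 : 5 ≤ p) :
    ((wt k lam + 1 = 0 ∨ wt k lam + 1 = 1) → Nonempty (ExtVerma k mu lam ≃ₗ[k] k)) ∧
      (¬(wt k lam + 1 = 0 ∨ wt k lam + 1 = 1) → Subsingleton (ExtVerma k mu lam)) := by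
  have n2 : (2 : k) ≠ 0 := by exact_mod_cast natCast_ne_zero_of_lt k p (n := 2) (by simp) (by omega)
  constructor
  · intro hc
    refine extVerma_equiv (by omega) hw 1 0 ?_ ?_ fun C hC h => ⟨0, ?_, ?_⟩
    · rw [cobCoeff_of_lt (d := 0) hd (by omega), mul_zero, zero_mul, zero_add]
    · rcases hc with hc | hc
      · obtain ⟨C, hC, h1⟩ := exists_isSolution_top_zero (k := k) hd h5
        rw [hc]
        exact ⟨C, hC, by rw [h1, mul_one, zero_mul, add_zero]; exact one_ne_zero⟩
      · obtain ⟨C, hC, h1⟩ := exists_isSolution_top_one (k := k) hd h5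
        rw [hc]
        exact ⟨C, hC, by rw [h1, one_mul, zero_mul, add_zero]; exact n2⟩
    · rw [zero_mul, ← h]
      ring
    · rw [zero_mul, hC.top_eq_zero_of_apply_one hd h5 hc]
      rw [← h]
      ring
  · intro hc
    rw [not_or] at hc
    refine subsingleton_extVerma (by omega) hw fun C hC => ⟨0, ?_⟩
    rw [zero_mul, zero_mul]
    exact hC.top_eq_zero hd h5 hc.1 hc.2

/-- The coboundary pair is `(2 (c - 1), 0)`, where `c = lam + 1`. So `C 2` measures `Ext¹` unless `c
= 1`, when there are no coboundaries, `C 2` vanishes and `C 1` takes over. -/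
theorem extVerma_subtop (hd : s + 1 + 1 = p) (hw : (s : k) + (wt k lam + 1) = wt k mu) (h5 : 5 ≤ p) :
    ((wt k lam + 1 = 0 ∨ wt k lam + 1 = 1 ∨ wt k lam + 1 = 2) →
      Nonempty (ExtVerma k mu lam ≃ₗ[k] k)) ∧
    (¬(wt k lam + 1 = 0 ∨ wt k lam + 1 = 1 ∨ wt k lam + 1 = 2) →
      Subsingleton (ExtVerma k mu lam)) := by
  have n2 : (2 : k) ≠ 0 := by exact_mod_cast natCast_ne_zero_of_lt k p (n := 2) (by simp) (by omega)
  have n3 : (3 : k) ≠ 0 := by exact_mod_cast natCast_ne_zero_of_lt k p (n := 3) (by simp) (by omega)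
  have hcob2 : cobCoeff p s (wt k lam + 1) 2 = 0 := cobCoeff_of_lt hd (by omega)
  have hcob1 : cobCoeff p s (wt k lam + 1) 1 = 2 * (wt k lam + 1 - 1) := by
    rw [cobCoeff_of_le hd le_rfl]
    push_cast
    ring
  have hmem : wt k lam + 1 ≠ 1 → ∀ x : k, ∃ t, x = t * (2 * (wt k lam + 1 - 1)) := fun h x => by
    have := sub_ne_zero.2 h
    exact ⟨x / (2 * (wt k lam + 1 - 1)), by field_simp⟩
  constructor
  · intro hc
    by_cases h1 : wt k lam + 1 = 1
    · refine extVerma_equiv (by omega) hw 1 0 ?_ ?_ fun C hC h => ⟨0, ?_, ?_⟩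
      · rw [hcob1, hcob2, h1]
        ring
      · obtain ⟨C, hC, hC1⟩ := exists_isSolution_subtop_one (c := wt k lam + 1) hd h5
        exact ⟨C, hC, by rw [hC1, mul_one, zero_mul, add_zero]; exact one_ne_zero⟩
      · rw [zero_mul, ← h]
        ring
      · rw [h1] at hC
        rw [hC.subtop_eq_zero hd h5, zero_mul]
    · refine extVerma_equiv (by omega) hw 0 1 ?_ ?_ fun C hC h => ?_
      · rw [hcob2]
        ring
      · rcases hc with hc | hc | hc
        · obtain ⟨C, hC, hC2⟩ := exists_isSolution_subtop_zero (k := k) hd h5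
          rw [hc]
          exact ⟨C, hC, by rw [hC2, mul_one, zero_mul, zero_add]; exact one_ne_zero⟩
        · exact absurd hc h1
        · obtain ⟨C, hC, hC2⟩ := exists_isSolution_subtop_two (k := k) hd h5
          rw [hc]
          refine ⟨C, hC, ?_⟩
          rw [hC2, zero_mul, zero_add, one_mul, show (6 : k) = 2 * 3 by norm_num]
          exact mul_ne_zero n2 n3
      · obtain ⟨t, ht⟩ := hmem h1 (C 1)
        refine ⟨t, by rw [hcob1, ht], ?_⟩
        rw [hcob2, mul_zero, ← h]
        ring
  · intro hc
    rw [not_or, not_or] at hc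
    refine subsingleton_extVerma (by omega) hw fun C hC => ?_
    obtain ⟨t, ht⟩ := hmem hc.2.1 (C 1)
    refine ⟨t, by rw [hcob1, ht], ?_⟩
    rw [hcob2, mul_zero]
    exact (mul_eq_zero.1 (hC.subtop_mul_eq_zero hd h5)).resolve_left
      (mul_ne_zero (mul_ne_zero hc.1 (sub_ne_zero.2 hc.2.1)) (sub_ne_zero.2 hc.2.2))

theorem extVerma_bottom_equiv (hw : ((0 : ℕ) : k) + (wt k lam + 1) = wt k mu) (h5 : 5 ≤ p)
    (hc : wt k lam + 1 = 0) : Nonempty (ExtVerma k mu lam ≃ₗ[k] k) := by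
  have n2 : (2 : k) ≠ 0 := by exact_mod_cast natCast_ne_zero_of_lt k p (n := 2) (by simp) (by omega)
  refine extVerma_equiv (by omega) hw 1 0 ?_ ?_ fun C hC h => ⟨0, ?_, ?_⟩
  · rw [hc, cobCoeff]
    simp
  · obtain ⟨C, hC, h1⟩ := exists_isSolution_bottom (k := k) h5
    rw [hc]
    exact ⟨C, hC, by rw [h1, one_mul, zero_mul, add_zero]; exact n2⟩
  · rw [zero_mul, ← h]
    ring
  · rw [hc] at hC
    rw [zero_mul, hC.bottom_eq_zero h5]
    rw [← h]
    ring

/-- The extensions of Verma modules for `p ≥ 7`, where `d` represents `lam - mu`. -/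
theorem extVerma_of_seven_le (hd : s + d + 1 = p) (hw : (s : k) + (wt k lam + 1) = wt k mu)
    (h7 : 7 ≤ p) (hroot : p = 7 → 2 * wt k lam ^ 2 - 10 * wt k lam + 3 ≠ 0) {P : Prop}
    (hP : P ↔ (d = 2 ∨ d = 3 ∨ d = 4) ∨ (d = 0 ∧ (wt k lam + 1 = 0 ∨ wt k lam + 1 = 1)) ∨
      (d = 1 ∧ (wt k lam + 1 = 0 ∨ wt k lam + 1 = 1 ∨ wt k lam + 1 = 2)) ∨
      (s = 0 ∧ wt k lam + 1 = 0) ∨ (d = 5 ∧ (wt k lam + 1 = 1 ∨ wt k lam + 1 = 5)) ∨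
      (d = 6 ∧ 2 * wt k lam ^ 2 - 10 * wt k lam + 3 = 0)) :
    (P → Nonempty (ExtVerma k mu lam ≃ₗ[k] k)) ∧ (¬P → Subsingleton (ExtVerma k mu lam)) := by
  have n2 : (2 : k) ≠ 0 := by exact_mod_cast natCast_ne_zero_of_lt k p (n := 2) (by simp) (by omega)
  rw [hP]
  by_cases h0 : d = 0
  · subst h0
    simpa [show s ≠ 0 by omega] using extVerma_top hd hw (by omega)
  by_cases h1 : d = 1
  · subst h1
    simpa [show s ≠ 0 by omega] using extVerma_subtop hd hw (by omega)
  by_cases h2 : d = 2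
  · subst h2
    refine ⟨fun _ => extVerma_equiv_of_forall hd hw le_rfl (.inl (by omega)) fun a b =>
      exists_isSolution_two hd (by omega) a b, fun h => absurd (by simp) h⟩
  by_cases h3 : d = 3
  · subst h3
    refine ⟨fun _ => extVerma_equiv_of_forall hd hw (by simp) (.inl (by omega)) fun a b =>
      exists_isSolution_three hd (by omega) a b, fun h => absurd (by simp) h⟩
  by_cases h4 : d = 4
  · subst h4
    refine ⟨fun _ => extVerma_equiv_of_forall hd hw (by simp) (.inl (by omega)) fun a b =>
      exists_isSolution_four hd (by omega) h7 a b, fun h => absurd (by simp) h⟩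
  by_cases hs : s = 0 ∧ wt k lam + 1 = 0
  · obtain ⟨rfl, hc⟩ := hs
    exact ⟨fun _ => extVerma_bottom_equiv hw (by omega) hc,
      fun h => absurd (.inr (.inr (.inr (.inl ⟨rfl, hc⟩)))) h⟩
  have hne : s ≠ 0 ∨ wt k lam + 1 ≠ 0 := not_and_or.1 hs
  by_cases h5 : d = 5
  · subst h5
    simp only [hs, h0, h1, h2, h3, h4, false_and, false_or, true_and, Nat.reduceEqDiff, or_false]
    refine ⟨fun h => extVerma_equiv_of_forall hd hw (by simp) hne fun a b =>
      exists_isSolution_five hd (by omega) h7 h a b, fun h =>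
      subsingleton_extVerma_of_det hd hw (by simp) hne fun C hC => ?_⟩
    have hq := hC.quadratic_mul_det hd le_rfl
    refine (mul_eq_zero.1 hq).resolve_left ?_
    rw [not_or] at h
    -- At `d = 5` the quadratic factor is `4 (c - 1) (c - 5)` with `c = lam + 1`.
    convert mul_ne_zero (mul_ne_zero n2 n2) (mul_ne_zero (sub_ne_zero.2 h.1) (sub_ne_zero.2 h.2)) using 2
    push_cast
    ring
  by_cases h6 : d = 6
  · subst h6
    simp only [hs, h0, h1, h2, h3, h4, h5, false_and, false_or, true_and]
    -- The cocycle on `e 1, …, e 6` needs `e 6 ≠ 0`, that is `s ≠ 0`. With `d = 6` and `s = 0` one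
    -- would have `p = 7`, which `hroot` excludes.
    refine ⟨fun h => extVerma_equiv_of_forall hd hw (by simp) hne fun a b =>
      exists_isSolution_six hd (fun h8 => hroot (by omega) h) (by simpa using h) a b, fun h =>
      subsingleton_extVerma_of_det hd hw (by simp) hne fun C hC => ?_⟩
    have hq := hC.quadratic_mul_det hd (by simp)
    refine (mul_eq_zero.1 hq).resolve_left ?_
    convert mul_ne_zero n2 h using 2
    push_cast
    ring
  · simp only [hs, h0, h1, h2, h3, h4, h5, h6, false_and, false_or, false_imp_iff, true_and,
      not_false_eq_true, true_imp_iff]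
    exact subsingleton_extVerma_of_det hd hw (by omega) hne fun C hC =>
      hC.det_eq_zero hd (by omega)

/-- The extensions of Verma modules for `p = 5`, where `d` represents `lam - mu`. -/
theorem extVerma_of_eq_five (hd : s + d + 1 = p) (hw : (s : k) + (wt k lam + 1) = wt k mu)
    (hp5 : p = 5) {P : Prop}
    (hP : P ↔ (d = 2 ∨ d = 3) ∨ (d = 0 ∧ (wt k lam + 1 = 0 ∨ wt k lam + 1 = 1)) ∨
      (d = 1 ∧ (wt k lam + 1 = 0 ∨ wt k lam + 1 = 1 ∨ wt k lam + 1 = 2)) ∨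
      (d = 4 ∧ (wt k lam + 1 = 0 ∨ wt k lam + 1 = 1 ∨ wt k lam + 1 = -1))) :
    (P → Nonempty (ExtVerma k mu lam ≃ₗ[k] k)) ∧ (¬P → Subsingleton (ExtVerma k mu lam)) := by
  rw [hP]
  obtain rfl | rfl | rfl | rfl | rfl : d = 0 ∨ d = 1 ∨ d = 2 ∨ d = 3 ∨ d = 4 := by omega
  · simpa using extVerma_top hd hw (by omega)
  · simpa using extVerma_subtop hd hw (by omega)
  · refine ⟨fun _ => extVerma_equiv_of_forall hd hw le_rfl (.inl (by omega)) fun a b =>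
      exists_isSolution_two hd (by omega) a b, fun h => absurd (by simp) h⟩
  · refine ⟨fun _ => extVerma_equiv_of_forall hd hw (by simp) (.inl (by omega)) fun a b =>
      exists_isSolution_three hd (by omega) a b, fun h => absurd (by simp) h⟩
  · obtain rfl : s = 0 := by omega
    by_cases hc : wt k lam + 1 = 0
    · exact ⟨fun _ => extVerma_bottom_equiv hw (by omega) hc,
        fun h => absurd (.inr (.inr (.inr ⟨rfl, .inl hc⟩))) h⟩
    have e : (wt k lam + 1 = 1 ∨ wt k lam + 1 = -1) ↔ (wt k lam + 1) ^ 2 = 1 := sq_eq_one_iff.symm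
    simp only [hc, Nat.reduceEqDiff, OfNat.ofNat_ne_zero, OfNat.ofNat_ne_one, false_and, false_or,
      true_and, e]
    refine ⟨fun h => extVerma_equiv_of_forall (d := 4) hd hw (by simp) (.inr hc) fun a b =>
      exists_isSolution_of_five hp5 h a b, fun h =>
      subsingleton_extVerma_of_det (d := 4) hd hw (by simp) (.inr hc) fun C hC => ?_⟩
    have h1 := (mul_eq_zero.1 (hC.det_of_five hp5)).resolve_left (sub_ne_zero.2 h)
    have n5 : (5 : k) = 0 := by exact_mod_cast hp5 ▸ CharP.cast_eq_zero k p
    push_cast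
    -- Modulo `5` the determinant is `3 c (C 1 + C 2)`, where `c = lam + 1`.
    linear_combination (3 * (wt k lam + 1)) * h1 - ((wt k lam + 1) * C 2 + C 1 - C 2) * n5

end Classification

/-! ### Weights -/

/-- For `p = 7` the difference `6` is the boundary case `s = 0`; having no roots, the quadratic
never contributes there. -/
theorem quadratic_ne_zero_of_seven (x : ZMod 7) : 2 * x ^ 2 - 10 * x + 3 ≠ 0 := by
  revert x
  decide

section Weights

variable {p : ℕ} [hp : Fact p.Prime] {mu lam : ZMod p}

theorem sub_eq_natCast_iff {n : ℕ} (hn : n < p) : lam - mu = n ↔ (lam - mu).val = n := by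
  constructor
  · intro h
    rw [h, ZMod.val_cast_of_lt hn]
  · intro h
    rw [← h, ZMod.natCast_zmod_val]

variable (k : Type u) [Field k] [CharP k p]

theorem wt_injective : Function.Injective (fun x : ZMod p => wt k x) :=
  (ZMod.castHom (dvd_refl p) k).injective

/-- A pair of weights is determined by its difference and its second entry, that is by the
parameters `d` and `c` of the classification. -/
theorem pair_eq_iff {n : ℕ} (hn : n < p) {x y : ZMod p} {c : k} (hx : y - x = n)
    (hc : wt k y + 1 = c) :
    (mu, lam) = (x, y) ↔ (lam - mu).val = n ∧ wt k lam + 1 = c := by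
  rw [Prod.mk.injEq, ← sub_eq_natCast_iff hn, ← hc, add_left_inj, (wt_injective k).eq_iff, ← hx]
  constructor
  · rintro ⟨rfl, rfl⟩
    exact ⟨rfl, rfl⟩
  · rintro ⟨h, rfl⟩
    exact ⟨sub_right_injective h, rfl⟩

theorem cast_add_wt {s : ℕ} (hd : s + (lam - mu).val + 1 = p) :
    (s : k) + (wt k lam + 1) = wt k mu := by
  have h : (((lam - mu).val : ℕ) : k) = wt k lam - wt k mu := by
    rw [wt, wt, ← map_sub, ← map_natCast (ZMod.castHom (dvd_refl p) k), ZMod.natCast_zmod_val]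
  rw [cast_start k hd, h]
  ring

end Weights

end Witt11

end

/-! ### The classification in terms of weights -/

open Witt11

theorem theorem2p2 {k : Type*} [Field k] [IsAlgClosed k] (p : ℕ) [Fact p.Prime] [CharP k p]
    (mu lam : ZMod p) :
    (p = 5 →
      ((lam - mu = 2 ∨ lam - mu = 3 ∨
          (({mu, lam} : Set (ZMod p)) = {0} ∨ ({mu, lam} : Set (ZMod p)) = {4} ∨
            ({mu, lam} : Set (ZMod p)) = {0, 1} ∨ ({mu, lam} : Set (ZMod p)) = {0, 4} ∨
            ({mu, lam} : Set (ZMod p)) = {3, 4})) →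
        Nonempty (Witt11.ExtVerma k mu lam ≃ₗ[k] k)) ∧
      (¬ (lam - mu = 2 ∨ lam - mu = 3 ∨
          (({mu, lam} : Set (ZMod p)) = {0} ∨ ({mu, lam} : Set (ZMod p)) = {4} ∨
            ({mu, lam} : Set (ZMod p)) = {0, 1} ∨ ({mu, lam} : Set (ZMod p)) = {0, 4} ∨
            ({mu, lam} : Set (ZMod p)) = {3, 4})) →
        Subsingleton (Witt11.ExtVerma k mu lam))) ∧
    (7 ≤ p →
      (((lam - mu = 2 ∨ lam - mu = 3 ∨ lam - mu = 4) ∨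
          ((mu, lam) = (0, 0) ∨ (mu, lam) = (-1, -1) ∨ (mu, lam) = (-1, 0) ∨
            (mu, lam) = (0, -1) ∨ (mu, lam) = (0, 1) ∨ (mu, lam) = (-2, -1) ∨
            (mu, lam) = (-5, 0) ∨ (mu, lam) = (-1, 4)) ∨
          (2 * lam ^ 2 - 10 * lam + 3 = 0 ∧ lam - mu = 6)) →
        Nonempty (Witt11.ExtVerma k mu lam ≃ₗ[k] k)) ∧
      (¬ ((lam - mu = 2 ∨ lam - mu = 3 ∨ lam - mu = 4) ∨
          ((mu, lam) = (0, 0) ∨ (mu, lam) = (-1, -1) ∨ (mu, lam) = (-1, 0) ∨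
            (mu, lam) = (0, -1) ∨ (mu, lam) = (0, 1) ∨ (mu, lam) = (-2, -1) ∨
            (mu, lam) = (-5, 0) ∨ (mu, lam) = (-1, 4)) ∨
          (2 * lam ^ 2 - 10 * lam + 3 = 0 ∧ lam - mu = 6)) →
        Subsingleton (Witt11.ExtVerma k mu lam))) := by
  have hlt := ZMod.val_lt (lam - mu)
  obtain ⟨s, hd⟩ : ∃ s, s + (lam - mu).val + 1 = p := ⟨p - 1 - (lam - mu).val, by omega⟩
  have hw := cast_add_wt k hd
  have wt_ofNat : ∀ n : ℕ, wt k (n : ZMod p) = n := fun n => map_natCast _ n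
  have wt_zero : wt k (0 : ZMod p) = 0 := map_zero _
  have wt_one : wt k (1 : ZMod p) = 1 := map_one _
  have wt_neg_one : wt k (-1 : ZMod p) = -1 := by rw [wt, map_neg, map_one]
  have wt_three : wt k (3 : ZMod p) = 3 := wt_ofNat 3
  have wt_four : wt k (4 : ZMod p) = 4 := wt_ofNat 4
  constructor
  · intro hp5
    have n5 : (5 : k) = 0 := by exact_mod_cast (CharP.cast_eq_zero_iff k p 5).2 (by rw [hp5])
    have z5 : (5 : ZMod p) = 0 := by exact_mod_cast (CharP.cast_eq_zero_iff (ZMod p) p 5).2 (by rw [hp5])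
    refine extVerma_of_eq_five hd hw hp5 ?_
    have h2 := sub_eq_natCast_iff (mu := mu) (lam := lam) (n := 2) (by omega)
    have h3 := sub_eq_natCast_iff (mu := mu) (lam := lam) (n := 3) (by omega)
    push_cast at h2 h3
    -- The unordered sets are unfolded into ordered pairs: each two-element set gives two pairs,
    -- with differences `1` and `4`, and a singleton gives a pair with difference `0`. The exception
    -- is `{0, 4}`, whose pair `(0, 4)` is the case `c = 0` of `d = 4`.
    have hsing : ∀ x, ({mu, lam} : Set (ZMod p)) = {x} ↔ (mu = x ∧ lam = x) := fun x => by
      rw [← Set.pair_eq_singleton x, Set.pair_eq_pair_iff, and_comm (a := mu = x), or_self]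
    rw [hsing, hsing, Set.pair_eq_pair_iff,
      Set.pair_eq_pair_iff, Set.pair_eq_pair_iff]
    simp only [← Prod.mk.injEq]
    rw [h2, h3,
      pair_eq_iff k (n := 0) (x := 0) (y := 0) (c := 1) (by omega) (by simp) (by simp [wt_zero]),
      pair_eq_iff k (n := 0) (x := 4) (y := 4) (c := 0) (by omega) (by simp)
        (by rw [wt_four]; linear_combination n5),
      pair_eq_iff k (n := 1) (x := 0) (y := 1) (c := 2) (by omega) (by simp)
        (by rw [wt_one]; norm_num),
      pair_eq_iff k (n := 4) (x := 1) (y := 0) (c := 1) (by omega)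
        (by push_cast; linear_combination -z5) (by simp [wt_zero]),
      pair_eq_iff k (n := 4) (x := 0) (y := 4) (c := 0) (by omega) (by simp)
        (by rw [wt_four]; linear_combination n5),
      pair_eq_iff k (n := 1) (x := 4) (y := 0) (c := 1) (by omega)
        (by push_cast; linear_combination -z5) (by simp [wt_zero]),
      pair_eq_iff k (n := 1) (x := 3) (y := 4) (c := 0) (by omega) (by push_cast; ring)
        (by rw [wt_four]; linear_combination n5),
      pair_eq_iff k (n := 4) (x := 4) (y := 3) (c := -1) (by omega)
        (by push_cast; linear_combination -z5) (by rw [wt_three]; linear_combination n5)]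
    generalize (lam - mu).val = d
    generalize wt k lam + 1 = c
    grind
  · intro h7
    have hroot : 2 * lam ^ 2 - 10 * lam + 3 = 0 ↔ 2 * wt k lam ^ 2 - 10 * wt k lam + 3 = 0 := by
      rw [← (wt_injective k).eq_iff]
      simp only [map_add, map_sub, map_mul, map_pow, map_ofNat, map_zero]
    refine extVerma_of_seven_le hd hw h7 (fun hp7 => ?_) ?_
    · rw [Ne, ← hroot]
      clear hroot
      subst hp7
      exact quadratic_ne_zero_of_seven lam
    have h2 := sub_eq_natCast_iff (mu := mu) (lam := lam) (n := 2) (by omega)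
    have h3 := sub_eq_natCast_iff (mu := mu) (lam := lam) (n := 3) (by omega)
    have h4 := sub_eq_natCast_iff (mu := mu) (lam := lam) (n := 4) (by omega)
    have hs : s = 0 ↔ (lam - mu).val = p - 1 := by omega
    have h6 := sub_eq_natCast_iff (mu := mu) (lam := lam) (n := 6) (by omega)
    push_cast at h2 h3 h4 h6
    rw [hroot, h2, h3, h4, h6, hs,
      pair_eq_iff k (n := 0) (x := 0) (y := 0) (c := 1) (by omega) (by simp) (by simp [wt_zero]),
      pair_eq_iff k (n := 0) (x := -1) (y := -1) (c := 0) (by omega) (by simp) (by simp [wt_neg_one]),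
      pair_eq_iff k (n := 1) (x := -1) (y := 0) (c := 1) (by omega) (by simp) (by simp [wt_zero]),
      -- The pair `(0, -1)` has difference `-1`, represented by `p - 1`: this is the boundary case
      -- `s = 0`.
      pair_eq_iff k (n := p - 1) (x := 0) (y := -1) (c := 0) (by omega)
        (by rw [cast_sub_one, sub_zero]) (by simp [wt_neg_one]),
      pair_eq_iff k (n := 1) (x := 0) (y := 1) (c := 2) (by omega) (by simp)
        (by rw [wt_one]; norm_num),
      pair_eq_iff k (n := 1) (x := -2) (y := -1) (c := 0) (by omega) (by push_cast; ring)
        (by simp [wt_neg_one]),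
      pair_eq_iff k (n := 5) (x := -5) (y := 0) (c := 1) (by omega) (by push_cast; ring)
        (by simp [wt_zero]),
      pair_eq_iff k (n := 5) (x := -1) (y := 4) (c := 5) (by omega) (by push_cast; ring)
        (by rw [wt_four]; norm_num)]
    clear h2 h3 h4 h6 hs hroot wt_ofNat wt_zero wt_one wt_neg_one wt_three wt_four hw hd hlt h7
    generalize (lam - mu).val = d, wt k lam + 1 = c, (2 * wt k lam ^ 2 - 10 * wt k lam + 3 = 0) = Q
    simp only [and_or_left, or_assoc]
    constructor
    · rintro (h | h | h | h | h | h | h | h | h | h | h | h) <;> simp [h]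
    · rintro (h | h | h | h | h | h | h | h | h | h | h | h) <;> simp [h]
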